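/- For $r,k\in\mathbb N$ with $1\le r\le k$ and $\epsilon\in(0,1]$ let $\pi_{r,k,\epsilon}$ be the law of the random vector $(p,q)$ with $$(p,q)=\begin{cases}(\tfrac1r,\tfrac1r)&\text{with probability }\tfrac rk,\\ (\tfrac{\epsilon}{k},\tfrac{2\epsilon}{k})&\text{with probability }\tfrac12(1-\tfrac rk),\\ (\tfrac{\epsilon}{k},0)&\text{with probability }\tfrac12(1-\tfrac rk).\end{cases}$$ For probability measures $\mu,\nu$ let $\chi^2(\mu\|\nu)=\int(\frac{d\mu}{d\nu}-1)^2d\nu$ (and $+\infty$ if $\mu\not\ll\nu$). Then the following hold. 1. If $2r\le k$, then $(p,q)\in[0,1]^2$ almost surely, $\mathbb E p=\mathbb E q\in[\frac1k,\frac2k]$ and $\mathbb E|p-q|\in[\frac{\epsilon}{2k},\frac{\epsilon}{k}]$. 2. There is a universal constant $C>0$ such that for all integers $0\le m\le n\le k$ with $n\ge1$ and all $\epsilon\in(0,1]$, with $(p,q)\sim\pi_{n,k,\epsilon}$, $$\chi^2\big(\mathbb E[\mathrm{Poi}(np)\otimes\mathrm{Poi}(nq)\otimes\mathrm{Poi}(mp)]\,\big\|\,\mathbb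 E[\mathrm{Poi}(np)\otimes\mathrm{Poi}(nq)\otimes\mathrm{Poi}(mq)]\big)\le C\,\frac{\epsilon^4mn^2}{k^3}.$$ 3. There is a universal constant $C>0$ such that for all integers $0\le n\le m\le k$ with $m\ge1$ and all $\epsilon\in(0,1]$, with $(p,q)\sim\pi_{m,k,\epsilon}$, $$\chi^2\big(\mathbb E[\mathrm{Poi}(np)\otimes\mathrm{Poi}(nq)\otimes\mathrm{Poi}(mp)]\,\big\|\,\mathbb E[\mathrm{Poi}(nq)\otimes\mathrm{Poi}(np)\otimes\mathrm{Poi}(mp)]\big)\le C\,\frac{\epsilon^4mn^2}{k^3}.$$ 4. Let $\epsilon_0\in(0,1)$ and $\delta_0\in(0,\frac12)$. There is a constant $c>0$ depending only on $\epsilon_0,\delta_0$ such that for all integers $k\ge2$ and $0\le n,m\le k$, all $\epsilon\in(0,\epsilon_0]$ and all $\delta\in(0,\delta_0]$: suppose there is a test $\psi:[k]^n\times[k]^n\times[k]^m\to\{0,1\}$ such that, for all probability distributions $\mathbb P_X,\mathbb P_Y$ on $[k]$ with $\mathsf{TV}(\mathbb P_X,\mathbb P_Y)\ge\epsilon$ and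 independent samples $X\sim\mathbb P_X^{\otimes n}$, $Y\sim\mathbb P_Y^{\otimes n}$, $Z\sim\mathbb P_Z^{\otimes m}$, we have $\mathbb P(\psi(X,Y,Z)\ne0)\le\delta$ if $\mathbb P_Z=\mathbb P_X$, and $\mathbb P(\psi(X,Y,Z)\ne1)\le\delta$ if $\mathbb P_Z=\mathbb P_Y$ (that is, likelihood-free hypothesis testing over all distributions on $[k]$ succeeds with error at most $\delta$). Then $$n^2m\ \ge\ c\,\frac{k^2\log(1/\delta)}{\epsilon^4}.$$ -/

import Mathlib

open MeasureTheory ProbabilityTheory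
open scoped ENNReal NNReal

noncomputable section

namespace LFHT

/-- Total variation distance: the supremum of `|μ A - ν A|` over measurable events `A`. -/
def tvDist {𝒳 : Type*} [MeasurableSpace 𝒳] (μ ν : Measure 𝒳) : ℝ :=
  ⨆ A : {A : Set 𝒳 // MeasurableSet A}, |μ.real A.1 - ν.real A.1|

open Classical in
/-- The `χ²`-divergence `χ²(μ ‖ ν) = ∫ (dμ/dν - 1)² dν` (infinite unless `μ ≪ ν`). -/
def chiSqDiv {𝒳 : Type*} [MeasurableSpace 𝒳] (μ ν : Measure 𝒳) : ℝ≥0∞ :=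
  if μ ≪ ν then ∫⁻ x, ENNReal.ofReal (((μ.rnDeriv ν x).toReal - 1) ^ 2) ∂ν else ⊤

/-- The joint law `PX^{⊗ n} ⊗ PY^{⊗ n} ⊗ PZ^{⊗ m}` of the three independent samples. -/
def sampleLaw {𝒳 : Type*} [MeasurableSpace 𝒳] (PX PY PZ : ProbabilityMeasure 𝒳) (n m : ℕ) :
    Measure ((Fin n → 𝒳) × (Fin n → 𝒳) × (Fin m → 𝒳)) :=
  (Measure.pi fun _ : Fin n => (PX : Measure 𝒳)).prod
    ((Measure.pi fun _ : Fin n => (PY : Measure 𝒳)).prod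
      (Measure.pi fun _ : Fin m => (PZ : Measure 𝒳)))

/-- Likelihood-free hypothesis testing over the class `P` is possible from `n` observations of
each of `X`, `Y` and `m` observations of `Z`: a single test `ψ` has error at most `δ` under
`H₀ : PZ = PX` and under `H₁ : PZ = PY`, for all `PX, PY ∈ P` with `TV(PX, PY) ≥ ε`. -/
def Testable {𝒳 : Type*} [MeasurableSpace 𝒳] (P : Set (ProbabilityMeasure 𝒳)) (ε δ : ℝ)
    (n m : ℕ) : Prop :=
  ∃ ψ : (Fin n → 𝒳) × (Fin n → 𝒳) × (Fin m → 𝒳) → Fin 2, Measurable ψ ∧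
    ∀ PX ∈ P, ∀ PY ∈ P, ε ≤ tvDist (PX : Measure 𝒳) (PY : Measure 𝒳) →
      (sampleLaw PX PY PX n m).real {s | ψ s ≠ 0} ≤ δ ∧
      (sampleLaw PX PY PY n m).real {s | ψ s ≠ 1} ≤ δ

/-- All probability distributions on an alphabet with `k` letters. -/
def allDistributions (k : ℕ) : Set (ProbabilityMeasure (Fin k)) := Set.univ

/-- The law of the random vector `(p, q)` that equals `(1/r, 1/r)` with probability `r/k`,
and `(ε/k, 2ε/k)` and `(ε/k, 0)` with probability `(1 - r/k)/2` each. -/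
def pseudoLaw (r k : ℕ) (ε : ℝ) : Measure (ℝ × ℝ) :=
  ENNReal.ofReal (r / k) • Measure.dirac ((1 / r : ℝ), (1 / r : ℝ)) +
    ENNReal.ofReal ((1 - r / k) / 2) • Measure.dirac (ε / k, 2 * ε / k) +
    ENNReal.ofReal ((1 - r / k) / 2) • Measure.dirac (ε / k, (0 : ℝ))

/-- `Poi(a) ⊗ Poi(b) ⊗ Poi(c)` (used for nonnegative rates only). -/
def poi3 (a b c : ℝ) : Measure (ℕ × ℕ × ℕ) :=
  (poissonMeasure a.toNNReal).prod
    ((poissonMeasure b.toNNReal).prod (poissonMeasure c.toNNReal))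

/-- `𝔼[Poi(n p) ⊗ Poi(n q) ⊗ Poi(m p)]` for `(p, q)` with law `π`. -/
def mixXYX (π : Measure (ℝ × ℝ)) (n m : ℕ) : Measure (ℕ × ℕ × ℕ) :=
  π.bind fun v => poi3 (n * v.1) (n * v.2) (m * v.1)

/-- `𝔼[Poi(n p) ⊗ Poi(n q) ⊗ Poi(m q)]` for `(p, q)` with law `π`. -/
def mixXYY (π : Measure (ℝ × ℝ)) (n m : ℕ) : Measure (ℕ × ℕ × ℕ) :=
  π.bind fun v => poi3 (n * v.1) (n * v.2) (m * v.2)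

/-- `𝔼[Poi(n q) ⊗ Poi(n p) ⊗ Poi(m p)]` for `(p, q)` with law `π`. -/
def mixYXX (π : Measure (ℝ × ℝ)) (n m : ℕ) : Measure (ℕ × ℕ × ℕ) :=
  π.bind fun v => poi3 (n * v.2) (n * v.1) (m * v.1)

end LFHT

end

/-!
The prior `pseudoLaw r k ε` puts a letter into one of three states: heavy with `p = q`, light with
`q = 2p`, light with `q = 0`. Given that a letter is light, `q` has mean `p`, so the Poisson
mixtures to be compared agree to first order in the light rates, and what remains is of second
order (`abs_poiWt_mix_sub_le`). The heavy state contributes the same component to both mixtures,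
and it is this component that the difference is measured against in the `χ²`-divergence:
the pointwise quotients are of geometric size (`chi_pointwise_XYY`, `chi_pointwise_YXX`) and are
summed against `1 / (x! y! z!)`. This gives the two `χ²`-bounds; the moments of the prior are a
direct computation.

For the lower bound on testing the prior is modified: light letters have `q = p / t` with
probability `t` and `q = 0` otherwise, for a small `t`, which allows total variation distances
up to any `ε₀ < 1`, and one distinguished letter has `p = q = 1`, so that the total masses are at
least `1`. All other letters are i.i.d., and `p`, `q` are normalised only after they are drawn.
Samples are Poissonised: a random number of letters is drawn, at rates larger than the sample sizes
by a constant factor, and the test uses the first letters (`tsum_seqWt_trunc_le`). Sequences with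
given letter counts are equally likely, so the Bhattacharyya affinity of the two mixtures over
sequences is that over counts, which is a product over the letters (`tsum_three_cnt`,
`pow_le_tsum_sqrt_mixLaw`); by the `χ²`-bound it is at least `exp (-k χ)` with `k χ` of order
`ε⁴ n² m / k²`. On the other hand a test with error `δ` forces the overlap of the two mixtures to
be at most `2 δ` plus the probabilities that a sample is too short or that the configuration of
the letters is atypical, and the overlap bounds the affinity (`sqrt_mul_le_min`).

The failure probabilities are exponentially small in `min n m`, hence at most a small multiple of
`δ` once the constants are large, because both sample sizes must be at least of order
`log (1 / δ)` (`one_sub_pow_le_of_testable`). This makes the argument uniform in `δ`: comparing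
the two bounds on the affinity yields `log (1 / δ) ≲ ε⁴ n² m / k²`.
-/

noncomputable section

namespace LFHT

/-! ### One-letter Poisson weights -/

/-- The Poisson weight `e^{-a} a^x`, without the factor `1 / x!`. -/
def poiWt (a : ℝ) (x : ℕ) : ℝ := Real.exp (-a) * a ^ x

/-- The joint weight of three independent Poisson variables, without the factorials. -/
def poiWt3 (a b c : ℝ) (v : ℕ × ℕ × ℕ) : ℝ := poiWt a v.1 * (poiWt b v.2.1 * poiWt c v.2.2)

lemma poiWt_nonneg {a : ℝ} (ha : 0 ≤ a) (x : ℕ) : 0 ≤ poiWt a x := by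
  unfold poiWt; positivity

lemma poiWt_zero_left (x : ℕ) : poiWt 0 x = 0 ^ x := by simp [poiWt]

lemma poiWt_le_pow {a : ℝ} (ha : 0 ≤ a) (x : ℕ) : poiWt a x ≤ a ^ x := by
  unfold poiWt
  have : Real.exp (-a) ≤ 1 := Real.exp_le_one_iff.2 (by linarith)
  have h := pow_nonneg ha x
  nlinarith

lemma poiWt3_nonneg {a b c : ℝ} (ha : 0 ≤ a) (hb : 0 ≤ b) (hc : 0 ≤ c) (v : ℕ × ℕ × ℕ) :
    0 ≤ poiWt3 a b c v :=
  mul_nonneg (poiWt_nonneg ha _) (mul_nonneg (poiWt_nonneg hb _) (poiWt_nonneg hc _))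

lemma abs_exp_neg_sub_one_add_le {a : ℝ} (ha : 0 ≤ a) : |Real.exp (-a) - 1 + a| ≤ a ^ 2 / 2 := by
  have h1 := Real.add_one_le_exp (-a)
  rw [abs_le]
  refine ⟨by nlinarith [sq_nonneg a], ?_⟩
  have h2 := Real.quadratic_le_exp_of_nonneg ha
  have h3 : Real.exp (-a) * Real.exp a = 1 := by rw [← Real.exp_add]; simp
  have h4 := Real.exp_pos (-a)
  have h5 : Real.exp (-a) * (1 + a + a ^ 2 / 2) ≤ 1 :=
    (mul_le_mul_of_nonneg_left h2 h4.le).trans_eq h3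
  have h6 : 1 ≤ (1 - a + a ^ 2 / 2) * (1 + a + a ^ 2 / 2) := by
    nlinarith [mul_nonneg (sq_nonneg a) (sq_nonneg a)]
  have h7 : 0 < 1 + a + a ^ 2 / 2 := by positivity
  nlinarith

/-- The mixture of `Poi(v / t)` (weight `t`) and the point mass at `0` (weight `1 - t`) has the
same mean as `Poi(v)`, so its weights differ from those of `Poi(v)` only at second order. -/
lemma abs_poiWt_mix_sub_le {v t : ℝ} (hv : 0 ≤ v) (ht : 0 < t) (ht1 : t ≤ 1) (z : ℕ) :
    |t * poiWt (v / t) z + (1 - t) * poiWt 0 z - poiWt v z| ≤ 2 * (v / t) ^ max 2 z := by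
  have hvt : 0 ≤ v / t := by positivity
  have hle : v ≤ v / t := by rw [le_div_iff₀ ht]; nlinarith
  have hv2 : v = t * (v / t) := by field_simp
  rcases z with _ | _ | z
  · simp only [poiWt, pow_zero, mul_one, neg_zero, Real.exp_zero, zero_le, sup_of_le_left]
    have h1 := abs_le.1 (abs_exp_neg_sub_one_add_le hv)
    have h2 := abs_le.1 (abs_exp_neg_sub_one_add_le hvt)
    set s := v / t
    have e : t * Real.exp (-s) + (1 - t) - Real.exp (-v) =
      t * (Real.exp (-s) - 1 + s) - (Real.exp (-v) - 1 + v) := by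
      rw [mul_add, ← hv2]; ring
    rw [e, abs_le]
    have h3 : v ^ 2 ≤ s ^ 2 := pow_le_pow_left₀ hv hle 2
    constructor <;> nlinarith [sq_nonneg s]
  · simp only [poiWt, zero_add, pow_one, mul_zero, add_zero, Nat.one_le_ofNat, sup_of_le_left]
    set s := v / t
    have e : t * (Real.exp (-s) * s) - Real.exp (-v) * v = v * (Real.exp (-s) - Real.exp (-v)) := by
      rw [show t * (Real.exp (-s) * s) = Real.exp (-s) * (t * s) by ring, ← hv2]; ring
    rw [e, abs_mul, abs_of_nonneg hv]
    have h1 : |Real.exp (-s) - Real.exp (-v)| ≤ s := by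
      have a1 := Real.add_one_le_exp (-s)
      have a2 := Real.add_one_le_exp (-v)
      have a3 : Real.exp (-s) ≤ 1 := Real.exp_le_one_iff.2 (by linarith)
      have a4 : Real.exp (-v) ≤ 1 := Real.exp_le_one_iff.2 (by linarith)
      rw [abs_le]; constructor <;> linarith
    nlinarith [abs_nonneg (Real.exp (-s) - Real.exp (-v))]
  · have hm : max 2 (z + 1 + 1) = z + 1 + 1 := by omega
    rw [hm, poiWt_zero_left]
    have a1 := poiWt_le_pow hvt (z + 1 + 1)
    have a2 := poiWt_nonneg hvt (z + 1 + 1)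
    have a3 := poiWt_le_pow hv (z + 1 + 1)
    have a4 := poiWt_nonneg hv (z + 1 + 1)
    have a5 : v ^ (z + 1 + 1) ≤ (v / t) ^ (z + 1 + 1) := pow_le_pow_left₀ hv hle _
    rw [zero_pow (by omega), mul_zero, add_zero, abs_le]
    constructor <;> nlinarith

lemma abs_poiWt_sub_le {a b : ℝ} (ha : 0 ≤ a) (hab : a ≤ b) (z : ℕ) :
    |poiWt a z - poiWt b z| ≤ b ^ max 1 z := by
  have hb := ha.trans hab
  rcases z with _ | z
  · have h1 := Real.add_one_le_exp (-a)
    have h2 := Real.add_one_le_exp (-b)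
    have h3 : Real.exp (-a) ≤ 1 := Real.exp_le_one_iff.2 (by linarith)
    have h4 : Real.exp (-b) ≤ 1 := Real.exp_le_one_iff.2 (by linarith)
    simp only [poiWt, pow_zero, mul_one, zero_le, sup_of_le_left, pow_one]
    rw [abs_le]; constructor <;> linarith
  · rw [show max 1 (z + 1) = z + 1 by omega]
    have a1 := poiWt_le_pow ha (z + 1)
    have a2 := poiWt_nonneg ha (z + 1)
    have a3 := poiWt_le_pow hb (z + 1)
    have a4 := poiWt_nonneg hb (z + 1)
    have a5 : a ^ (z + 1) ≤ b ^ (z + 1) := pow_le_pow_left₀ ha hab _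
    rw [abs_le]; constructor <;> linarith

lemma pow_le_sq_mul_pow {s K : ℝ} (hs : 0 ≤ s) (hsK : s ≤ K) (hK : 1 ≤ K) {e j : ℕ}
    (h2 : 2 ≤ e) (he : e ≤ j + 2) : s ^ e ≤ s ^ 2 * K ^ j := by
  obtain ⟨d, rfl⟩ := Nat.exists_eq_add_of_le h2
  rw [pow_add]
  gcongr
  exact (pow_le_pow_left₀ hs hsK d).trans (pow_le_pow_right₀ hK (by omega))

/-- The light-letter contribution to the difference of the laws `XYX` and `XYY`. -/
lemma abs_light_sub_le_XYY {u ρ t K : ℝ} (hu : 0 ≤ u) (hρ : 0 ≤ ρ) (hρ1 : ρ ≤ 1) (ht : 0 < t)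
    (ht1 : t ≤ 1) (hK : 1 ≤ K) (huK : u / t ≤ K) (x : ℕ × ℕ × ℕ) :
    |(t * poiWt3 u (u / t) (ρ * u) x + (1 - t) * poiWt3 u 0 (ρ * u) x) -
      (t * poiWt3 u (u / t) (ρ * u / t) x + (1 - t) * poiWt3 u 0 0 x)| ≤
      4 * (u / t) ^ 2 * ρ ^ max 1 x.2.2 * K ^ (x.1 + x.2.1 + x.2.2) := by
  obtain ⟨x, y, z⟩ := x
  simp only [poiWt3]
  set s := u / t with hs
  have hs0 : 0 ≤ s := by positivity
  have hle : u ≤ s := by rw [hs, le_div_iff₀ ht]; nlinarith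
  have hρs : ρ * u / t = ρ * s := by rw [hs]; ring
  have hv : 0 ≤ ρ * u := by positivity
  have hvle : ρ * u ≤ ρ * s := by gcongr
  have hxK : poiWt u x ≤ K ^ x :=
    (poiWt_le_pow hu x).trans (pow_le_pow_left₀ hu (hle.trans huK) x)
  have hx0 := poiWt_nonneg hu x
  have hd := abs_poiWt_sub_le hv hvle z
  rw [hρs]
  -- It suffices to bound the factor that does not involve the first sample.
  suffices h : |t * poiWt s y * (poiWt (ρ * u) z - poiWt (ρ * s) z) +
      (1 - t) * poiWt 0 y * (poiWt (ρ * u) z - poiWt 0 z)| ≤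
      4 * s ^ 2 * ρ ^ max 1 z * K ^ (y + z) by
    have e : (t * (poiWt u x * (poiWt s y * poiWt (ρ * u) z)) +
        (1 - t) * (poiWt u x * (poiWt 0 y * poiWt (ρ * u) z))) -
        (t * (poiWt u x * (poiWt s y * poiWt (ρ * s) z)) +
        (1 - t) * (poiWt u x * (poiWt 0 y * poiWt 0 z))) =
        poiWt u x * (t * poiWt s y * (poiWt (ρ * u) z - poiWt (ρ * s) z) +
      (1 - t) * poiWt 0 y * (poiWt (ρ * u) z - poiWt 0 z)) := by ring
    rw [e, abs_mul, abs_of_nonneg hx0]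
    calc _ ≤ K ^ x * (4 * s ^ 2 * ρ ^ max 1 z * K ^ (y + z)) := by gcongr
      _ = _ := by rw [show x + y + z = x + (y + z) by ring, pow_add K x]; ring
  have hρz : 0 ≤ ρ ^ max 1 z := by positivity
  rcases y with _ | y
  · have hH := abs_poiWt_mix_sub_le hv ht ht1 z
    rw [hρs] at hH
    have e : t * poiWt s 0 * (poiWt (ρ * u) z - poiWt (ρ * s) z) +
      (1 - t) * poiWt 0 0 * (poiWt (ρ * u) z - poiWt 0 z) =
      -(t * poiWt (ρ * s) z + (1 - t) * poiWt 0 z - poiWt (ρ * u) z) -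
        t * (1 - Real.exp (-s)) * (poiWt (ρ * u) z - poiWt (ρ * s) z) := by
      simp only [poiWt]; simp; ring
    rw [e]
    refine (abs_sub _ _).trans ?_
    rw [abs_neg, abs_mul]
    have h1 : |t * (1 - Real.exp (-s))| ≤ s := by
      have a1 := Real.add_one_le_exp (-s)
      have a3 : Real.exp (-s) ≤ 1 := Real.exp_le_one_iff.2 (by linarith)
      rw [abs_of_nonneg (mul_nonneg ht.le (by linarith))]
      nlinarith
    have h2 : (ρ * s) ^ max 2 z ≤ ρ ^ max 1 z * (s ^ 2 * K ^ z) := by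
      rw [mul_pow]
      exact mul_le_mul (pow_le_pow_of_le_one hρ hρ1 (by omega))
        (pow_le_sq_mul_pow hs0 huK hK (by omega) (by omega)) (by positivity) hρz
    have h3 : s * (ρ * s) ^ max 1 z ≤ ρ ^ max 1 z * (s ^ 2 * K ^ z) := by
      rw [mul_pow, show s * (ρ ^ max 1 z * s ^ max 1 z) = ρ ^ max 1 z * s ^ (max 1 z + 1) by ring]
      exact mul_le_mul_of_nonneg_left
        (pow_le_sq_mul_pow hs0 huK hK (by omega) (by omega)) hρz
    have h4 : |t * (1 - Real.exp (-s))| * |poiWt (ρ * u) z - poiWt (ρ * s) z| ≤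
        s * (ρ * s) ^ max 1 z := mul_le_mul h1 hd (abs_nonneg _) hs0
    have h5 : 0 ≤ ρ ^ max 1 z * (s ^ 2 * K ^ z) := by positivity
    rw [zero_add]
    nlinarith
  · rw [poiWt_zero_left (y + 1), zero_pow (by omega), mul_zero, zero_mul, add_zero, abs_mul,
      abs_of_nonneg (mul_nonneg ht.le (poiWt_nonneg hs0 _))]
    have h1 : t * poiWt s (y + 1) ≤ s ^ (y + 1) := by
      have := poiWt_le_pow hs0 (y + 1)
      have := poiWt_nonneg hs0 (y + 1)
      nlinarith
    calc _ ≤ s ^ (y + 1) * (ρ * s) ^ max 1 z := mul_le_mul h1 hd (abs_nonneg _) (by positivity)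
      _ = ρ ^ max 1 z * s ^ (y + 1 + max 1 z) := by rw [mul_pow]; ring
      _ ≤ ρ ^ max 1 z * (s ^ 2 * K ^ (y + 1 + z)) := by
        gcongr; exact pow_le_sq_mul_pow hs0 huK hK (by omega) (by omega)
      _ ≤ _ := by
        have : 0 ≤ ρ ^ max 1 z * (s ^ 2 * K ^ (y + 1 + z)) := by positivity
        nlinarith

/-- The light-letter contribution to the difference of the laws `XYX` and `YXX`. -/
lemma abs_light_sub_le_YXX {v ρ t K : ℝ} (hv : 0 ≤ v) (hρ : 0 ≤ ρ) (hρ1 : ρ ≤ 1) (ht : 0 < t)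
    (ht1 : t ≤ 1) (hK : 1 ≤ K) (hvK : v / t ≤ K) (x : ℕ × ℕ × ℕ) :
    |(t * poiWt3 (ρ * v) (ρ * v / t) v x + (1 - t) * poiWt3 (ρ * v) 0 v x) -
      (t * poiWt3 (ρ * v / t) (ρ * v) v x + (1 - t) * poiWt3 0 (ρ * v) v x)| ≤
      4 * (v / t) ^ 2 * ρ ^ max 2 (x.1 + x.2.1) * K ^ (x.1 + x.2.1 + x.2.2) := by
  obtain ⟨x, y, z⟩ := x
  simp only [poiWt3]
  set s := v / t with hs
  have hs0 : 0 ≤ s := by positivity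
  have hle : v ≤ s := by rw [hs, le_div_iff₀ ht]; nlinarith
  have hρs : ρ * v / t = ρ * s := by rw [hs]; ring
  have hu : 0 ≤ ρ * v := by positivity
  have hule : ρ * v ≤ ρ * s := by gcongr
  have hzK : poiWt v z ≤ K ^ z :=
    (poiWt_le_pow hv z).trans (pow_le_pow_left₀ hv (hle.trans hvK) z)
  have hz0 := poiWt_nonneg hv z
  have hH := fun j => abs_poiWt_mix_sub_le hu ht ht1 j
  rw [hρs] at *
  have hP : ∀ i, poiWt (ρ * v) i ≤ (ρ * s) ^ i := fun i =>
    (poiWt_le_pow hu i).trans (pow_le_pow_left₀ hu hule i)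
  set G : ℕ → ℝ := fun j => t * poiWt (ρ * s) j + (1 - t) * poiWt 0 j - poiWt (ρ * v) j with hG
  -- Each product of a Poisson weight and a second-order difference has the order asserted.
  have key : ∀ i j, |poiWt (ρ * v) i * G j| ≤
      2 * s ^ 2 * ρ ^ max 2 (i + j) * K ^ (i + j) := by
    intro i j
    rw [abs_mul, abs_of_nonneg (poiWt_nonneg hu i)]
    calc _ ≤ (ρ * s) ^ i * (2 * (ρ * s) ^ max 2 j) :=
          mul_le_mul (hP i) (hH j) (abs_nonneg _) (by positivity)
      _ = 2 * (ρ ^ (i + max 2 j) * s ^ (i + max 2 j)) := by rw [← mul_pow, pow_add]; ring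
      _ ≤ 2 * (ρ ^ max 2 (i + j) * (s ^ 2 * K ^ (i + j))) := by
        gcongr 2 * ?_
        exact mul_le_mul (pow_le_pow_of_le_one hρ hρ1 (by omega))
          (pow_le_sq_mul_pow hs0 hvK hK (by omega) (by omega)) (by positivity) (by positivity)
      _ = _ := by ring
  have e : (t * (poiWt (ρ * v) x * (poiWt (ρ * s) y * poiWt v z)) +
      (1 - t) * (poiWt (ρ * v) x * (poiWt 0 y * poiWt v z))) -
      (t * (poiWt (ρ * s) x * (poiWt (ρ * v) y * poiWt v z)) +
      (1 - t) * (poiWt 0 x * (poiWt (ρ * v) y * poiWt v z))) =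
      poiWt v z * (poiWt (ρ * v) x * G y - poiWt (ρ * v) y * G x) := by
    simp only [hG]; ring
  rw [e, abs_mul, abs_of_nonneg hz0]
  have h1 := key x y
  have h2 := key y x
  rw [add_comm y x] at h2
  have h3 : |poiWt (ρ * v) x * G y - poiWt (ρ * v) y * G x| ≤
      4 * s ^ 2 * ρ ^ max 2 (x + y) * K ^ (x + y) := by
    refine (abs_sub _ _).trans ?_; linarith
  calc _ ≤ K ^ z * (4 * s ^ 2 * ρ ^ max 2 (x + y) * K ^ (x + y)) := by gcongr
    _ = _ := by rw [pow_add K (x + y)]; ring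

/-! ### The three-state letter and its `χ²`-bound -/

/-- Probabilities of the three states of a letter: heavy (`0`), light with `q > 0` (`1`),
light with `q = 0` (`2`). -/
def stWt (w t : ℝ) : Fin 3 → ℝ := ![w, (1 - w) * t, (1 - w) * (1 - t)]

/-- The value of `p` in each of the three states of a letter. -/
def stP (a b : ℝ) : Fin 3 → ℝ := ![a, b, b]

/-- The value of `q` in each of the three states of a letter; given that the letter is light,
its mean is the value `b` of `p`. -/
def stQ (a b t : ℝ) : Fin 3 → ℝ := ![a, b / t, 0]

/-- The weights (without factorials) of a mixture of triples of Poisson variables. -/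
def mixWt {Θ : Type*} [Fintype Θ] (w : Θ → ℝ) (r₁ r₂ r₃ : Θ → ℝ) (x : ℕ × ℕ × ℕ) : ℝ :=
  ∑ θ, w θ * poiWt3 (r₁ θ) (r₂ θ) (r₃ θ) x

/-- The product `x! y! z!` of the factorials in the density of three Poisson variables. -/
def fact3 (x : ℕ × ℕ × ℕ) : ℝ := (x.1.factorial : ℝ) * (x.2.1.factorial * x.2.2.factorial)

lemma fact3_pos (x : ℕ × ℕ × ℕ) : 0 < fact3 x := by
  unfold fact3; positivity

lemma stWt_nonneg {w t : ℝ} (hw : 0 ≤ w) (hw1 : w ≤ 1) (ht : 0 ≤ t) (ht1 : t ≤ 1) (θ : Fin 3) :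
    0 ≤ stWt w t θ := by
  have := sub_nonneg.2 hw1
  have := sub_nonneg.2 ht1
  fin_cases θ <;> simp [stWt] <;> positivity

lemma sum_stWt (w t : ℝ) : ∑ θ, stWt w t θ = 1 := by
  simp [stWt, Fin.sum_univ_three]; ring

lemma stP_nonneg {a b : ℝ} (ha : 0 ≤ a) (hb : 0 ≤ b) (θ : Fin 3) : 0 ≤ stP a b θ := by
  fin_cases θ <;> simp [stP] <;> positivity

lemma stQ_nonneg {a b t : ℝ} (ha : 0 ≤ a) (hb : 0 ≤ b) (ht : 0 ≤ t) (θ : Fin 3) :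
    0 ≤ stQ a b t θ := by
  fin_cases θ <;> simp [stQ] <;> positivity

/-- When two mixtures share a heavy component `F`, their `χ²`-contribution at a point is at most
that of the difference of the light components relative to `F`. -/
lemma sq_sub_div_le_of_common {w F L₀ L₁ D : ℝ} (hw : 0 < w) (hw1 : w ≤ 1) (hF : 0 < F)
    (h1 : 0 ≤ L₁) (hD : |L₀ - L₁| ≤ D) :
    ((w * F + (1 - w) * L₀) - (w * F + (1 - w) * L₁)) ^ 2 / (w * F + (1 - w) * L₁) ≤
      D ^ 2 / (w * F) := by
  have hwF := mul_pos hw hF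
  have h2 := mul_nonneg (sub_nonneg.2 hw1) h1
  have e : ((w * F + (1 - w) * L₀) - (w * F + (1 - w) * L₁)) ^ 2 =
      (1 - w) ^ 2 * |L₀ - L₁| ^ 2 := by rw [sq_abs]; ring
  rw [e]
  have h3 : (1 - w) ^ 2 * |L₀ - L₁| ^ 2 ≤ D ^ 2 := by
    have : (1 - w) ^ 2 ≤ 1 := by nlinarith
    have h4 : |L₀ - L₁| ^ 2 ≤ D ^ 2 := pow_le_pow_left₀ (abs_nonneg _) hD 2
    nlinarith [sq_nonneg |L₀ - L₁|]
  exact div_le_div₀ (sq_nonneg D) h3 hwF (by linarith)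

lemma mixWt_st_eq (w t : ℝ) (r₁ r₂ r₃ : Fin 3 → ℝ) (x : ℕ × ℕ × ℕ) :
    mixWt (stWt w t) r₁ r₂ r₃ x = w * poiWt3 (r₁ 0) (r₂ 0) (r₃ 0) x +
      (1 - w) * (t * poiWt3 (r₁ 1) (r₂ 1) (r₃ 1) x +
        (1 - t) * poiWt3 (r₁ 2) (r₂ 2) (r₃ 2) x) := by
  simp [mixWt, stWt, Fin.sum_univ_three]; ring

lemma mixWt_nonneg {Θ : Type*} [Fintype Θ] {w r₁ r₂ r₃ : Θ → ℝ} (hw : ∀ θ, 0 ≤ w θ)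
    (h₁ : ∀ θ, 0 ≤ r₁ θ) (h₂ : ∀ θ, 0 ≤ r₂ θ) (h₃ : ∀ θ, 0 ≤ r₃ θ) (x : ℕ × ℕ × ℕ) :
    0 ≤ mixWt w r₁ r₂ r₃ x :=
  Finset.sum_nonneg fun θ _ => mul_nonneg (hw θ) (poiWt3_nonneg (h₁ θ) (h₂ θ) (h₃ θ) x)

lemma mixWt_st_pos {w t : ℝ} {r₁ r₂ r₃ : Fin 3 → ℝ} (hw : 0 < w) (hw1 : w ≤ 1) (ht : 0 < t)
    (ht1 : t ≤ 1) (h₁ : ∀ θ, 0 ≤ r₁ θ) (h₂ : ∀ θ, 0 ≤ r₂ θ) (h₃ : ∀ θ, 0 ≤ r₃ θ)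
    (p₁ : 0 < r₁ 0) (p₂ : 0 < r₂ 0) (p₃ : 0 < r₃ 0) (x : ℕ × ℕ × ℕ) :
    0 < mixWt (stWt w t) r₁ r₂ r₃ x := by
  rw [mixWt_st_eq]
  have a1 := poiWt3_nonneg (h₁ 1) (h₂ 1) (h₃ 1) x
  have a2 := poiWt3_nonneg (h₁ 2) (h₂ 2) (h₃ 2) x
  have := sub_nonneg.2 hw1
  have := sub_nonneg.2 ht1
  have : 0 < poiWt3 (r₁ 0) (r₂ 0) (r₃ 0) x := by unfold poiWt3 poiWt; positivity
  positivity

lemma exp_neg_three_mul_pow_le_one_one {ρ : ℝ} (hρ : 0 ≤ ρ) (hρ1 : ρ ≤ 1) (x : ℕ × ℕ × ℕ) :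
    Real.exp (-3) * ρ ^ x.2.2 ≤ poiWt3 1 1 ρ x := by
  have : poiWt3 1 1 ρ x = Real.exp (-(2 + ρ)) * ρ ^ x.2.2 := by
    simp only [poiWt3, poiWt, one_pow, mul_one, ← mul_assoc, ← Real.exp_add]; ring_nf
  rw [this]
  gcongr
  linarith

lemma exp_neg_three_mul_pow_le_one {ρ : ℝ} (hρ : 0 ≤ ρ) (hρ1 : ρ ≤ 1) (x : ℕ × ℕ × ℕ) :
    Real.exp (-3) * ρ ^ (x.1 + x.2.1) ≤ poiWt3 ρ ρ 1 x := by
  have : poiWt3 ρ ρ 1 x = Real.exp (-(2 * ρ + 1)) * ρ ^ (x.1 + x.2.1) := by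
    have e : Real.exp (-(2 * ρ + 1)) = Real.exp (-ρ) * (Real.exp (-ρ) * Real.exp (-1)) := by
      rw [← Real.exp_add, ← Real.exp_add]; ring_nf
    simp only [poiWt3, poiWt, one_pow, mul_one, pow_add, e]; ring
  rw [this]
  gcongr
  linarith

/-- The constant in the pointwise `χ²`-bounds below. -/
def chiConst (t : ℝ) : ℝ := 16 * Real.exp 3 / t ^ 4

lemma chiConst_pos {t : ℝ} (ht : 0 < t) : 0 < chiConst t := by unfold chiConst; positivity

lemma sq_div_heavy_le {w t u ρ K F : ℝ} (hw : 0 < w) (ht : 0 < t) (hρ : 0 < ρ)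
    (hρ1 : ρ ≤ 1) (hK : 1 ≤ K) {e f d j : ℕ} (he : d + f ≤ 2 * e)
    (hF : Real.exp (-3) * ρ ^ f ≤ F) :
    (4 * (u / t) ^ 2 * ρ ^ e * K ^ j) ^ 2 / (w * F) ≤
      chiConst t * (u ^ 4 * ρ ^ d / w) * (K ^ 2) ^ j := by
  have hF0 : 0 < Real.exp (-3) * ρ ^ f := by positivity
  calc _ ≤ (4 * (u / t) ^ 2 * ρ ^ e * K ^ j) ^ 2 / (w * (Real.exp (-3) * ρ ^ f)) := by gcongr
    _ = chiConst t * (u ^ 4 / w) * (K ^ 2) ^ j * (ρ ^ (2 * e) / ρ ^ f) := by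
      unfold chiConst
      rw [Real.exp_neg, ← pow_mul, mul_comm 2 j, pow_mul K, mul_comm 2 e, pow_mul ρ e]
      field_simp
      ring
    _ ≤ chiConst t * (u ^ 4 / w) * (K ^ 2) ^ j * ρ ^ d := by
      have : 0 < chiConst t := chiConst_pos ht
      have h4 : 0 ≤ u ^ 4 := by positivity
      gcongr
      rw [div_le_iff₀ (by positivity), ← pow_add]
      exact pow_le_pow_of_le_one hρ.le hρ1 he
    _ = _ := by ring

/-- Pointwise `χ²`-bound for one letter when the third sample is the smaller one: the first two
samples see a heavy letter at rate `1`, the third at rate `M / N`. -/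
lemma chi_pointwise_XYY {N M a b w t K : ℝ} (hN : N * a = 1) (hN0 : 0 < N) (hM0 : 0 < M)
    (hMN : M ≤ N) (hw : 0 < w) (hw1 : w ≤ 1) (ht : 0 < t) (ht1 : t ≤ 1) (hb : 0 ≤ b)
    (hK : 1 ≤ K) (hbK : N * b / t ≤ K) (x : ℕ × ℕ × ℕ) :
    (mixWt (stWt w t) (fun θ => N * stP a b θ) (fun θ => N * stQ a b t θ)
        (fun θ => M * stP a b θ) x -
      mixWt (stWt w t) (fun θ => N * stP a b θ) (fun θ => N * stQ a b t θ)
        (fun θ => M * stQ a b t θ) x) ^ 2 /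
      mixWt (stWt w t) (fun θ => N * stP a b θ) (fun θ => N * stQ a b t θ)
        (fun θ => M * stQ a b t θ) x ≤
    chiConst t * ((N * b) ^ 4 * (M / N) / w) * (K ^ 2) ^ (x.1 + x.2.1 + x.2.2) := by
  have hρ : 0 < M / N := by positivity
  have hρ1 : M / N ≤ 1 := (div_le_one hN0).2 hMN
  have hMb : M * b = M / N * (N * b) := by field_simp
  have hMa : M * a = M / N := by
    rw [eq_div_iff hN0.ne', mul_assoc, mul_comm a, hN, mul_one]
  have hMbt : M * (b / t) = M / N * (N * b) / t := by field_simp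
  have hNbt : N * (b / t) = N * b / t := by ring
  rw [mixWt_st_eq, mixWt_st_eq]
  simp only [stP, stQ, Fin.isValue, Matrix.cons_val_zero, Matrix.cons_val_one, Matrix.cons_val,
    hN, hMa, hMb, hMbt, mul_zero, hNbt]
  have hu : 0 ≤ N * b := by positivity
  have hF := exp_neg_three_mul_pow_le_one_one hρ.le hρ1 x
  refine (sq_sub_div_le_of_common hw hw1 (lt_of_lt_of_le (by positivity) hF) ?_
    (abs_light_sub_le_XYY hu hρ.le hρ1 ht ht1 hK hbK x)).trans ?_
  · have := sub_nonneg.2 ht1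
    have := poiWt3_nonneg hu (by positivity : 0 ≤ N * b / t)
      (by positivity : 0 ≤ M / N * (N * b) / t) x
    have := poiWt3_nonneg hu le_rfl le_rfl x
    positivity
  · have := sq_div_heavy_le (u := N * b) (d := 1) (e := max 1 x.2.2) (j := x.1 + x.2.1 + x.2.2)
      hw ht hρ hρ1 hK (by omega) hF
    rwa [pow_one] at this

/-- Pointwise `χ²`-bound for one letter when the third sample is the larger one: the third sample
sees a heavy letter at rate `1`, the first two at rate `N / M`. -/
lemma chi_pointwise_YXX {N M a b w t K : ℝ} (hM : M * a = 1) (hN0 : 0 < N) (hM0 : 0 < M)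
    (hNM : N ≤ M) (hw : 0 < w) (hw1 : w ≤ 1) (ht : 0 < t) (ht1 : t ≤ 1) (hb : 0 ≤ b)
    (hK : 1 ≤ K) (hbK : M * b / t ≤ K) (x : ℕ × ℕ × ℕ) :
    (mixWt (stWt w t) (fun θ => N * stP a b θ) (fun θ => N * stQ a b t θ)
        (fun θ => M * stP a b θ) x -
      mixWt (stWt w t) (fun θ => N * stQ a b t θ) (fun θ => N * stP a b θ)
        (fun θ => M * stP a b θ) x) ^ 2 /
      mixWt (stWt w t) (fun θ => N * stQ a b t θ) (fun θ => N * stP a b θ)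
        (fun θ => M * stP a b θ) x ≤
    chiConst t * ((M * b) ^ 4 * (N / M) ^ 2 / w) * (K ^ 2) ^ (x.1 + x.2.1 + x.2.2) := by
  have hρ : 0 < N / M := by positivity
  have hρ1 : N / M ≤ 1 := (div_le_one hM0).2 hNM
  have hNb : N * b = N / M * (M * b) := by field_simp
  have hNa : N * a = N / M := by
    rw [eq_div_iff hM0.ne', mul_assoc, mul_comm a, hM, mul_one]
  have hNbt : N * (b / t) = N / M * (M * b) / t := by field_simp
  rw [mixWt_st_eq, mixWt_st_eq]
  simp only [stP, stQ, Fin.isValue, Matrix.cons_val_zero, Matrix.cons_val_one, Matrix.cons_val,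
    hM, hNa, hNb, hNbt, mul_zero]
  have hu : 0 ≤ M * b := by positivity
  have hF := exp_neg_three_mul_pow_le_one hρ.le hρ1 x
  refine (sq_sub_div_le_of_common hw hw1 (lt_of_lt_of_le (by positivity) hF) ?_
    (abs_light_sub_le_YXX hu hρ.le hρ1 ht ht1 hK hbK x)).trans ?_
  · have := sub_nonneg.2 ht1
    have := poiWt3_nonneg (by positivity : 0 ≤ N / M * (M * b) / t)
      (by positivity : 0 ≤ N / M * (M * b)) hu x
    have := poiWt3_nonneg le_rfl (by positivity : 0 ≤ N / M * (M * b)) hu x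
    positivity
  · exact sq_div_heavy_le (u := M * b) (d := 2) (e := max 2 (x.1 + x.2.1))
      (j := x.1 + x.2.1 + x.2.2) hw ht hρ hρ1 hK (by omega) hF

lemma tsum_ofReal_pow_div_factorial {K : ℝ} (hK : 0 ≤ K) :
    ∑' x : ℕ, ENNReal.ofReal (K ^ x / x.factorial) = ENNReal.ofReal (Real.exp K) := by
  rw [← ENNReal.ofReal_tsum_of_nonneg (fun x => by positivity) (Real.summable_pow_div_factorial K)]
  congr 1
  rw [Real.exp_eq_exp_ℝ, NormedSpace.exp_eq_tsum_div]

/-- Sums over `ℕ³` of product functions with the factorial weights factorise. -/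
lemma tsum_fact3 {f g h : ℕ → ℝ} (hf : ∀ x, 0 ≤ f x) (hg : ∀ x, 0 ≤ g x) :
    ∑' x : ℕ × ℕ × ℕ, ENNReal.ofReal (f x.1 * (g x.2.1 * h x.2.2) / fact3 x) =
      (∑' x : ℕ, ENNReal.ofReal (f x / x.factorial)) *
      ((∑' x : ℕ, ENNReal.ofReal (g x / x.factorial)) *
      (∑' x : ℕ, ENNReal.ofReal (h x / x.factorial))) := by
  have e : ∀ x : ℕ × ℕ × ℕ, ENNReal.ofReal (f x.1 * (g x.2.1 * h x.2.2) / fact3 x) =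
      ENNReal.ofReal (f x.1 / x.1.factorial) * (ENNReal.ofReal (g x.2.1 / x.2.1.factorial) *
        ENNReal.ofReal (h x.2.2 / x.2.2.factorial)) := by
    intro x
    have h1 := div_nonneg (hf x.1) (Nat.cast_nonneg (α := ℝ) x.1.factorial)
    have h2 := div_nonneg (hg x.2.1) (Nat.cast_nonneg (α := ℝ) x.2.1.factorial)
    rw [← ENNReal.ofReal_mul h2, ← ENNReal.ofReal_mul h1]
    congr 1
    unfold fact3
    field_simp
  simp_rw [e]
  rw [ENNReal.tsum_prod']
  simp_rw [ENNReal.tsum_mul_left]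
  rw [ENNReal.tsum_mul_right]
  congr 1
  rw [ENNReal.tsum_prod']
  simp_rw [ENNReal.tsum_mul_left]
  rw [ENNReal.tsum_mul_right]

lemma tsum_pow_fact3 {K : ℝ} (hK : 0 ≤ K) :
    ∑' x : ℕ × ℕ × ℕ, ENNReal.ofReal (K ^ (x.1 + x.2.1 + x.2.2) / fact3 x) =
      ENNReal.ofReal (Real.exp (3 * K)) := by
  have h := tsum_fact3 (f := fun x => K ^ x) (g := fun x => K ^ x) (h := fun x => K ^ x)
    (fun x => by positivity) (fun x => by positivity)
  simp_rw [tsum_ofReal_pow_div_factorial hK] at h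
  rw [← ENNReal.ofReal_mul (Real.exp_pos _).le, ← ENNReal.ofReal_mul (Real.exp_pos _).le,
    ← Real.exp_add, ← Real.exp_add] at h
  rw [show 3 * K = K + (K + K) by ring, ← h]
  simp_rw [pow_add, mul_assoc]

lemma tsum_poiWt {a : ℝ} (ha : 0 ≤ a) :
    ∑' x : ℕ, ENNReal.ofReal (poiWt a x / x.factorial) = 1 := by
  simp_rw [poiWt, mul_div_assoc, ENNReal.ofReal_mul (Real.exp_pos (-a)).le]
  rw [ENNReal.tsum_mul_left, tsum_ofReal_pow_div_factorial ha,
    ← ENNReal.ofReal_mul (Real.exp_pos _).le, ← Real.exp_add]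
  simp

lemma tsum_poiWt3 {a b c : ℝ} (ha : 0 ≤ a) (hb : 0 ≤ b) (hc : 0 ≤ c) :
    ∑' x : ℕ × ℕ × ℕ, ENNReal.ofReal (poiWt3 a b c x / fact3 x) = 1 := by
  simp only [poiWt3]
  rw [tsum_fact3 (poiWt_nonneg ha) (poiWt_nonneg hb), tsum_poiWt ha,
    tsum_poiWt hb, tsum_poiWt hc]
  simp

lemma tsum_mixWt {Θ : Type*} [Fintype Θ] {w r₁ r₂ r₃ : Θ → ℝ} (hw : ∀ θ, 0 ≤ w θ)
    (hw1 : ∑ θ, w θ = 1) (h₁ : ∀ θ, 0 ≤ r₁ θ) (h₂ : ∀ θ, 0 ≤ r₂ θ) (h₃ : ∀ θ, 0 ≤ r₃ θ) :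
    ∑' x : ℕ × ℕ × ℕ, ENNReal.ofReal (mixWt w r₁ r₂ r₃ x / fact3 x) = 1 := by
  have e : ∀ x, ENNReal.ofReal (mixWt w r₁ r₂ r₃ x / fact3 x) =
      ∑ θ, ENNReal.ofReal (w θ) *
        ENNReal.ofReal (poiWt3 (r₁ θ) (r₂ θ) (r₃ θ) x / fact3 x) := by
    intro x
    rw [mixWt, Finset.sum_div, ENNReal.ofReal_sum_of_nonneg]
    · simp_rw [mul_div_assoc, ENNReal.ofReal_mul (hw _)]
    · intro θ _
      exact div_nonneg (mul_nonneg (hw θ) (poiWt3_nonneg (h₁ θ) (h₂ θ) (h₃ θ) x)) (fact3_pos x).le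
  simp_rw [e]
  rw [Summable.tsum_finsetSum fun _ _ => ENNReal.summable]
  simp_rw [ENNReal.tsum_mul_left, tsum_poiWt3 (h₁ _) (h₂ _) (h₃ _), mul_one]
  rw [← ENNReal.ofReal_sum_of_nonneg fun θ _ => hw θ, hw1, ENNReal.ofReal_one]

/-- A pointwise geometric bound of a nonnegative function on `ℕ³` bounds its sum with the
factorial weights. -/
lemma tsum_fact3_le {f : ℕ × ℕ × ℕ → ℝ} {c K : ℝ} (hc : 0 ≤ c) (hK : 0 ≤ K)
    (h : ∀ x, f x ≤ c * K ^ (x.1 + x.2.1 + x.2.2)) :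
    ∑' x, ENNReal.ofReal (f x / fact3 x) ≤ ENNReal.ofReal (c * Real.exp (3 * K)) := by
  rw [ENNReal.ofReal_mul hc, ← tsum_pow_fact3 hK, ← ENNReal.tsum_mul_left]
  refine ENNReal.tsum_le_tsum fun x => ?_
  rw [← ENNReal.ofReal_mul hc, ← mul_div_assoc]
  exact ENNReal.ofReal_le_ofReal (div_le_div_of_nonneg_right (h x) (fact3_pos x).le)

/-! ### The pseudo-distribution and its `χ²`-divergences -/

/-- On a countable space with a strictly positive reference measure, the `χ²`-divergence is a
sum over points. -/
lemma chiSqDiv_eq_tsum {Ω : Type*} [MeasurableSpace Ω] [Countable Ω] [MeasurableSingletonClass Ω]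
    (μ ν : Measure Ω) [IsFiniteMeasure μ] [IsFiniteMeasure ν] (hν : ∀ s, 0 < ν.real {s}) :
    chiSqDiv μ ν = ∑' s, ENNReal.ofReal ((μ.real {s} - ν.real {s}) ^ 2 / ν.real {s}) := by
  have hν0 : ∀ s, ν {s} ≠ 0 := fun s h => by
    have := hν s
    rw [measureReal_def, h] at this; simp at this
  have hνt : ∀ s, ν {s} ≠ ⊤ := fun s => measure_ne_top _ _
  have hac : μ ≪ ν := by
    intro A hA
    have : A = ∅ := by
      by_contra hne
      obtain ⟨s, hs⟩ := Set.nonempty_iff_ne_empty.2 hne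
      exact hν0 s (measure_mono_null (Set.singleton_subset_iff.2 hs) hA)
    simp [this]
  have hwd : μ = ν.withDensity fun s => μ {s} / ν {s} := by
    refine Measure.ext_of_singleton fun s => ?_
    rw [withDensity_apply _ (measurableSet_singleton s), lintegral_singleton,
      ENNReal.div_mul_cancel (hν0 s) (hνt s)]
  have hrn : μ.rnDeriv ν =ᵐ[ν] fun s => μ {s} / ν {s} := by
    conv_lhs => rw [hwd]
    exact Measure.rnDeriv_withDensity ν (Measurable.of_discrete)
  rw [chiSqDiv, if_pos hac, lintegral_countable']
  refine tsum_congr fun s => ?_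
  have hs : μ.rnDeriv ν s = μ {s} / ν {s} := by
    by_contra hne
    have h1 := ae_iff.1 hrn
    exact hν0 s (measure_mono_null (Set.singleton_subset_iff.2 hne) h1)
  rw [hs, ENNReal.toReal_div, ← measureReal_def, ← measureReal_def,
    ← ENNReal.ofReal_toReal (hνt s), ← measureReal_def, ← ENNReal.ofReal_mul (sq_nonneg _)]
  congr 1
  have := (hν s).ne'
  field_simp

lemma chiSqDiv_self {Ω : Type*} [MeasurableSpace Ω] (μ : Measure Ω) [SigmaFinite μ] :
    chiSqDiv μ μ = 0 := by
  rw [chiSqDiv, if_pos Measure.AbsolutelyContinuous.rfl]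
  rw [lintegral_congr_ae (g := fun _ => 0)]
  · simp
  · filter_upwards [Measure.rnDeriv_self μ] with x hx
    simp [hx]

lemma aemeasurable_pseudoLaw {β : Type*} [MeasurableSpace β] (f : ℝ × ℝ → β) (r k : ℕ) (ε : ℝ) :
    AEMeasurable f (pseudoLaw r k ε) := by
  unfold pseudoLaw
  refine AEMeasurable.add_measure (AEMeasurable.add_measure ?_ ?_) ?_ <;>
  exact aemeasurable_dirac.smul_measure _

lemma isProbabilityMeasure_pseudoLaw {r k : ℕ} (ε : ℝ) (hrk : r ≤ k) :
    IsProbabilityMeasure (pseudoLaw r k ε) := by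
  have h0 : (0 : ℝ) ≤ r / k := by positivity
  have h1 : (r : ℝ) / k ≤ 1 := div_le_one_of_le₀ (by exact_mod_cast hrk) (by positivity)
  constructor
  simp only [pseudoLaw, Measure.coe_add, Measure.coe_smul, Pi.add_apply, Pi.smul_apply,
    measure_univ, smul_eq_mul, mul_one]
  rw [← ENNReal.ofReal_add h0 (by linarith), ← ENNReal.ofReal_add (by linarith) (by linarith),
    ← ENNReal.ofReal_one]
  congr 1
  ring

lemma integral_pseudoLaw {r k : ℕ} {ε : ℝ} (hrk : r ≤ k) (f : ℝ × ℝ → ℝ) :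
    ∫ v, f v ∂(pseudoLaw r k ε) = (r / k : ℝ) * f (1 / r, 1 / r) +
      (1 - r / k) / 2 * f (ε / k, 2 * ε / k) + (1 - r / k) / 2 * f (ε / k, 0) := by
  have h0 : (0 : ℝ) ≤ r / k := by positivity
  have h1 : (r : ℝ) / k ≤ 1 := div_le_one_of_le₀ (by exact_mod_cast hrk) (by positivity)
  have h2 : (0 : ℝ) ≤ (1 - r / k) / 2 := by linarith
  have hi : ∀ (c : ℝ) (x : ℝ × ℝ), Integrable f (ENNReal.ofReal c • Measure.dirac x) :=
    fun c x => (integrable_dirac (by simp)).smul_measure ENNReal.ofReal_ne_top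
  unfold pseudoLaw
  rw [integral_add_measure ((hi _ _).add_measure (hi _ _)) (hi _ _),
    integral_add_measure (hi _ _) (hi _ _)]
  simp only [integral_smul_measure, integral_dirac, ENNReal.toReal_ofReal h0,
    ENNReal.toReal_ofReal h2, smul_eq_mul]

lemma ae_pseudoLaw {r k : ℕ} {ε : ℝ} {P : ℝ × ℝ → Prop} (h1 : P (1 / r, 1 / r))
    (h2 : P (ε / k, 2 * ε / k)) (h3 : P (ε / k, 0)) : ∀ᵐ v ∂(pseudoLaw r k ε), P v := by
  unfold pseudoLaw
  rw [ae_add_measure_iff, ae_add_measure_iff]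
  refine ⟨⟨?_, ?_⟩, ?_⟩ <;> refine Measure.ae_smul_measure ?_ _ <;> rw [ae_dirac_eq] <;> assumption

/-- The normalisation and moment conditions on the pseudo-distribution. -/
lemma pseudoLaw_moments (r k : ℕ) (ε : ℝ) (hr : 1 ≤ r) (hrk : 2 * r ≤ k) (hε : 0 < ε)
    (hε1 : ε ≤ 1) :
    IsProbabilityMeasure (pseudoLaw r k ε) ∧
      (∀ᵐ v ∂(pseudoLaw r k ε), v ∈ Set.Icc (0 : ℝ) 1 ×ˢ Set.Icc (0 : ℝ) 1) ∧
      ∫ v, v.1 ∂(pseudoLaw r k ε) = ∫ v, v.2 ∂(pseudoLaw r k ε) ∧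
      ∫ v, v.1 ∂(pseudoLaw r k ε) ∈ Set.Icc (1 / (k : ℝ)) (2 / k) ∧
      ∫ v, |v.1 - v.2| ∂(pseudoLaw r k ε) ∈ Set.Icc (ε / (2 * k)) (ε / k) := by
  have hr1 : (1 : ℝ) ≤ r := by exact_mod_cast hr
  have hrk' : 2 * (r : ℝ) ≤ k := by exact_mod_cast hrk
  have hr0 : (0 : ℝ) < r := by linarith
  have hk0 : (0 : ℝ) < k := by linarith
  have h1r : 1 / (r : ℝ) ≤ 1 := (div_le_one hr0).2 hr1
  have hεk : ε / k ≤ 1 := (div_le_one hk0).2 (by linarith)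
  have h2εk : 2 * ε / k ≤ 1 := (div_le_one hk0).2 (by linarith)
  have hw : (r : ℝ) / k ≤ 1 / 2 := by rw [div_le_iff₀ hk0]; linarith
  have hw0 : 0 ≤ (r : ℝ) / k := by positivity
  have hs : 0 < ε / k := by positivity
  have hs1 : ε / k ≤ 1 / k := by gcongr
  have h1 : (r / k : ℝ) * (1 / r) = 1 / k := by field_simp
  refine ⟨isProbabilityMeasure_pseudoLaw ε (by omega), ?_, ?_, ?_, ?_⟩
  · refine ae_pseudoLaw ?_ ?_ ?_ <;> simp only [Set.mem_prod, Set.mem_Icc] <;>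
      refine ⟨⟨?_, ?_⟩, ?_, ?_⟩ <;> first | assumption | positivity
  · rw [integral_pseudoLaw (by omega), integral_pseudoLaw (by omega)]
    ring
  · rw [integral_pseudoLaw (by omega)]
    simp only [h1]
    have e : 2 / (k : ℝ) = 1 / k + 1 / k := by ring
    constructor
    · nlinarith
    · rw [e]; nlinarith
  · rw [integral_pseudoLaw (by omega)]
    have e1 : |ε / k - 2 * ε / k| = ε / k := by
      rw [show ε / k - 2 * ε / k = -(ε / k) by ring, abs_neg, abs_of_pos hs]
    simp only [sub_self, abs_zero, mul_zero, zero_add, e1, sub_zero, abs_of_pos hs]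
    have e : ε / (2 * k) = ε / k / 2 := by field_simp
    rw [e]
    constructor <;> nlinarith

lemma bind_pseudoLaw_apply {β : Type*} [MeasurableSpace β] (f : ℝ × ℝ → Measure β) (r k : ℕ)
    (ε : ℝ) {A : Set β} (hA : MeasurableSet A) :
    (pseudoLaw r k ε).bind f A = ENNReal.ofReal (r / k) * f (1 / r, 1 / r) A +
      ENNReal.ofReal ((1 - r / k) / 2) * f (ε / k, 2 * ε / k) A +
      ENNReal.ofReal ((1 - r / k) / 2) * f (ε / k, 0) A := by
  rw [Measure.bind_apply hA (aemeasurable_pseudoLaw f r k ε)]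
  unfold pseudoLaw
  simp only [lintegral_add_measure, lintegral_smul_measure, lintegral_dirac, smul_eq_mul]

instance isFiniteMeasure_bind_pseudoLaw {β : Type*} [MeasurableSpace β] (f : ℝ × ℝ → Measure β)
    [∀ v, IsFiniteMeasure (f v)] (r k : ℕ) (ε : ℝ) :
    IsFiniteMeasure ((pseudoLaw r k ε).bind f) := by
  constructor
  rw [bind_pseudoLaw_apply f r k ε MeasurableSet.univ]
  simp only [ENNReal.add_lt_top]
  refine ⟨⟨?_, ?_⟩, ?_⟩ <;> exact ENNReal.mul_lt_top ENNReal.ofReal_lt_top (measure_lt_top _ _)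

instance isProbabilityMeasure_poi3 (a b c : ℝ) : IsProbabilityMeasure (poi3 a b c) := by
  unfold poi3; infer_instance

lemma poi3_real_singleton {a b c : ℝ} (ha : 0 ≤ a) (hb : 0 ≤ b) (hc : 0 ≤ c) (x : ℕ × ℕ × ℕ) :
    (poi3 a b c).real {x} = poiWt3 a b c x / fact3 x := by
  obtain ⟨x, y, z⟩ := x
  have e : ({(x, y, z)} : Set (ℕ × ℕ × ℕ)) = {x} ×ˢ ({y} ×ˢ {z}) := by simp
  rw [e, poi3, measureReal_prod_prod, measureReal_prod_prod, poissonMeasure_real_singleton,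
    poissonMeasure_real_singleton, poissonMeasure_real_singleton, Real.coe_toNNReal _ ha,
    Real.coe_toNNReal _ hb, Real.coe_toNNReal _ hc]
  simp only [poiWt3, poiWt, fact3]
  field_simp

instance isFiniteMeasure_mixXYX (r k : ℕ) (ε : ℝ) (n m : ℕ) :
    IsFiniteMeasure (mixXYX (pseudoLaw r k ε) n m) := by
  unfold mixXYX; infer_instance

instance isFiniteMeasure_mixXYY (r k : ℕ) (ε : ℝ) (n m : ℕ) :
    IsFiniteMeasure (mixXYY (pseudoLaw r k ε) n m) := by
  unfold mixXYY; infer_instance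

instance isFiniteMeasure_mixYXX (r k : ℕ) (ε : ℝ) (n m : ℕ) :
    IsFiniteMeasure (mixYXX (pseudoLaw r k ε) n m) := by
  unfold mixYXX; infer_instance

/-- The one-letter Poisson mixtures over the pseudo-distribution in terms of the three-state
letter with `t = 1 / 2`. -/
lemma bind_pseudoLaw_real_singleton {r k : ℕ} {ε : ℝ} (hrk : r ≤ k) (hε : 0 ≤ ε)
    (g₁ g₂ g₃ : ℝ × ℝ → ℝ) (h₁ : ∀ v, 0 ≤ v.1 → 0 ≤ v.2 → 0 ≤ g₁ v)
    (h₂ : ∀ v, 0 ≤ v.1 → 0 ≤ v.2 → 0 ≤ g₂ v) (h₃ : ∀ v, 0 ≤ v.1 → 0 ≤ v.2 → 0 ≤ g₃ v)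
    (x : ℕ × ℕ × ℕ) :
    ((pseudoLaw r k ε).bind fun v => poi3 (g₁ v) (g₂ v) (g₃ v)).real {x} =
      mixWt (stWt (r / k) (1 / 2))
        (fun θ => g₁ (stP (1 / r) (ε / k) θ, stQ (1 / r) (ε / k) (1 / 2) θ))
        (fun θ => g₂ (stP (1 / r) (ε / k) θ, stQ (1 / r) (ε / k) (1 / 2) θ))
        (fun θ => g₃ (stP (1 / r) (ε / k) θ, stQ (1 / r) (ε / k) (1 / 2) θ)) x / fact3 x := by
  have hw0 : (0 : ℝ) ≤ r / k := by positivity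
  have hw1 : (r : ℝ) / k ≤ 1 := div_le_one_of_le₀ (by exact_mod_cast hrk) (by positivity)
  have hw2 : (0 : ℝ) ≤ (1 - r / k) / 2 := by linarith
  have hp : ∀ c (v : ℝ × ℝ), ENNReal.ofReal c * (poi3 (g₁ v) (g₂ v) (g₃ v)) {x} ≠ ⊤ :=
    fun c v => ENNReal.mul_ne_top ENNReal.ofReal_ne_top (measure_ne_top _ _)
  have hv : ∀ v : ℝ × ℝ, 0 ≤ v.1 → 0 ≤ v.2 → (poi3 (g₁ v) (g₂ v) (g₃ v)).real {x} =
      poiWt3 (g₁ v) (g₂ v) (g₃ v) x / fact3 x := fun v a b =>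
    poi3_real_singleton (h₁ v a b) (h₂ v a b) (h₃ v a b) x
  rw [measureReal_def, bind_pseudoLaw_apply _ r k ε (measurableSet_singleton x),
    ENNReal.toReal_add (ENNReal.add_ne_top.2 ⟨hp _ _, hp _ _⟩) (hp _ _),
    ENNReal.toReal_add (hp _ _) (hp _ _), ENNReal.toReal_mul, ENNReal.toReal_mul,
    ENNReal.toReal_mul, ENNReal.toReal_ofReal hw0, ENNReal.toReal_ofReal hw2,
    ← measureReal_def, ← measureReal_def, ← measureReal_def,
    hv _ (by simp) (by simp), hv _ (by simp; positivity) (by simp; positivity),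
    hv _ (by simp; positivity) (by simp)]
  have e : 2 * ε / (k : ℝ) = ε / k / (1 / 2) := by ring
  rw [mixWt_st_eq, e]
  simp only [stP, stQ, Fin.isValue, Matrix.cons_val_zero, Matrix.cons_val_one, Matrix.cons_val]
  ring

/-- The `χ²`-bound obtained by summing a pointwise bound on Poisson mixtures. -/
lemma chiSqDiv_le_of_pointwise {μ ν : Measure (ℕ × ℕ × ℕ)} [IsFiniteMeasure μ] [IsFiniteMeasure ν]
    {f g : ℕ × ℕ × ℕ → ℝ} (hμ : ∀ x, μ.real {x} = f x / fact3 x)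
    (hν : ∀ x, ν.real {x} = g x / fact3 x) (hg : ∀ x, 0 < g x) {c K : ℝ} (hc : 0 ≤ c)
    (hK : 0 ≤ K) (h : ∀ x, (f x - g x) ^ 2 / g x ≤ c * K ^ (x.1 + x.2.1 + x.2.2)) :
    chiSqDiv μ ν ≤ ENNReal.ofReal (c * Real.exp (3 * K)) := by
  rw [chiSqDiv_eq_tsum μ ν fun s => by rw [hν]; exact div_pos (hg s) (fact3_pos s)]
  refine le_of_eq_of_le (tsum_congr fun x => ?_) (tsum_fact3_le hc hK h)
  congr 1
  rw [hμ, hν]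
  have h1 := (hg x).ne'
  have h2 := (fact3_pos x).ne'
  field_simp

/-- The `χ²`-bound for one letter when `m ≤ n`. -/
lemma exists_chiSqDiv_XYY_le :
    ∃ C : ℝ, 0 < C ∧ ∀ (k n m : ℕ) (ε : ℝ), 1 ≤ n → m ≤ n → n ≤ k → 0 < ε → ε ≤ 1 →
      chiSqDiv (mixXYX (pseudoLaw n k ε) n m) (mixXYY (pseudoLaw n k ε) n m) ≤
        ENNReal.ofReal (C * (ε ^ 4 * m * n ^ 2 / k ^ 3)) := by
  refine ⟨chiConst (1 / 2) * Real.exp (3 * 2 ^ 2),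
    mul_pos (chiConst_pos (by norm_num)) (Real.exp_pos _), ?_⟩
  intro k n m ε hn hmn hnk hε hε1
  rcases Nat.eq_zero_or_pos m with rfl | hm
  · have : mixXYX (pseudoLaw n k ε) n 0 = mixXYY (pseudoLaw n k ε) n 0 := by
      simp [mixXYX, mixXYY]
    rw [this]
    rw [chiSqDiv_self]
    exact zero_le
  have hn0 : (0 : ℝ) < n := by exact_mod_cast hn
  have hm0 : (0 : ℝ) < m := by exact_mod_cast hm
  have hk0 : (0 : ℝ) < k := by exact_mod_cast (by omega : 0 < k)
  have hw : 0 < (n : ℝ) / k := by positivity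
  have hw1 : (n : ℝ) / k ≤ 1 := (div_le_one hk0).2 (by exact_mod_cast hnk)
  have hb : 0 ≤ ε / k := by positivity
  have hbK : n * (ε / k) / (1 / 2) ≤ 2 := by
    have : n * (ε / k) ≤ 1 := by
      rw [show n * (ε / k) = n / k * ε by ring]; nlinarith
    linarith
  have hP := stP_nonneg (a := 1 / (n : ℝ)) (by positivity) hb
  have hQ := stQ_nonneg (a := 1 / (n : ℝ)) (t := 1 / 2) (by positivity) hb (by norm_num)
  have key := chiSqDiv_le_of_pointwise (μ := mixXYX (pseudoLaw n k ε) n m)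
    (ν := mixXYY (pseudoLaw n k ε) n m)
    (bind_pseudoLaw_real_singleton hnk hε.le (fun v => n * v.1) (fun v => n * v.2)
      (fun v => m * v.1) (fun v a b => by positivity) (fun v a b => by positivity)
      (fun v a b => by positivity))
    (bind_pseudoLaw_real_singleton hnk hε.le (fun v => n * v.1) (fun v => n * v.2)
      (fun v => m * v.2) (fun v a b => by positivity) (fun v a b => by positivity)
      (fun v a b => by positivity))
    (mixWt_st_pos hw hw1 (by norm_num) (by norm_num) (fun θ => mul_nonneg hn0.le (hP θ))
      (fun θ => mul_nonneg hn0.le (hQ θ)) (fun θ => mul_nonneg hm0.le (hQ θ))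
      (by simp only [stP, Matrix.cons_val_zero]; positivity)
      (by simp only [stQ, Matrix.cons_val_zero]; positivity)
      (by simp only [stQ, Matrix.cons_val_zero]; positivity))
    (mul_nonneg (chiConst_pos (by norm_num)).le (by positivity)) (by norm_num)
    (chi_pointwise_XYY (mul_one_div_cancel hn0.ne') hn0 hm0 (by exact_mod_cast hmn) hw hw1
      (by norm_num) (by norm_num) hb (by norm_num) hbK)
  refine key.trans_eq ?_
  congr 1
  field_simp

/-- The `χ²`-bound for one letter when `n ≤ m`. -/
lemma exists_chiSqDiv_YXX_le :
    ∃ C : ℝ, 0 < C ∧ ∀ (k n m : ℕ) (ε : ℝ), 1 ≤ m → n ≤ m → m ≤ k → 0 < ε → ε ≤ 1 →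
      chiSqDiv (mixXYX (pseudoLaw m k ε) n m) (mixYXX (pseudoLaw m k ε) n m) ≤
        ENNReal.ofReal (C * (ε ^ 4 * m * n ^ 2 / k ^ 3)) := by
  refine ⟨chiConst (1 / 2) * Real.exp (3 * 2 ^ 2),
    mul_pos (chiConst_pos (by norm_num)) (Real.exp_pos _), ?_⟩
  intro k n m ε hm hnm hmk hε hε1
  rcases Nat.eq_zero_or_pos n with rfl | hn
  · have : mixXYX (pseudoLaw m k ε) 0 m = mixYXX (pseudoLaw m k ε) 0 m := by
      simp [mixXYX, mixYXX]
    rw [this]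
    rw [chiSqDiv_self]
    exact zero_le
  have hn0 : (0 : ℝ) < n := by exact_mod_cast hn
  have hm0 : (0 : ℝ) < m := by exact_mod_cast hm
  have hk0 : (0 : ℝ) < k := by exact_mod_cast (by omega : 0 < k)
  have hw : 0 < (m : ℝ) / k := by positivity
  have hw1 : (m : ℝ) / k ≤ 1 := (div_le_one hk0).2 (by exact_mod_cast hmk)
  have hb : 0 ≤ ε / k := by positivity
  have hbK : m * (ε / k) / (1 / 2) ≤ 2 := by
    have : m * (ε / k) ≤ 1 := by
      rw [show m * (ε / k) = m / k * ε by ring]; nlinarith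
    linarith
  have hP := stP_nonneg (a := 1 / (m : ℝ)) (by positivity) hb
  have hQ := stQ_nonneg (a := 1 / (m : ℝ)) (t := 1 / 2) (by positivity) hb (by norm_num)
  have key := chiSqDiv_le_of_pointwise (μ := mixXYX (pseudoLaw m k ε) n m)
    (ν := mixYXX (pseudoLaw m k ε) n m)
    (bind_pseudoLaw_real_singleton hmk hε.le (fun v => n * v.1) (fun v => n * v.2)
      (fun v => m * v.1) (fun v a b => by positivity) (fun v a b => by positivity)
      (fun v a b => by positivity))
    (bind_pseudoLaw_real_singleton hmk hε.le (fun v => n * v.2) (fun v => n * v.1)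
      (fun v => m * v.1) (fun v a b => by positivity) (fun v a b => by positivity)
      (fun v a b => by positivity))
    (mixWt_st_pos hw hw1 (by norm_num) (by norm_num) (fun θ => mul_nonneg hn0.le (hQ θ))
      (fun θ => mul_nonneg hn0.le (hP θ)) (fun θ => mul_nonneg hm0.le (hP θ))
      (by simp only [stQ, Matrix.cons_val_zero]; positivity)
      (by simp only [stP, Matrix.cons_val_zero]; positivity)
      (by simp only [stP, Matrix.cons_val_zero]; positivity))
    (mul_nonneg (chiConst_pos (by norm_num)).le (by positivity)) (by norm_num)
    (chi_pointwise_YXX (mul_one_div_cancel hm0.ne') hn0 hm0 (by exact_mod_cast hnm) hw hw1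
      (by norm_num) (by norm_num) hb (by norm_num) hbK)
  refine key.trans_eq ?_
  congr 1
  field_simp

/-! ### Poissonised samples and their letter counts -/

/-- Finite sequences of letters: a sample of random size. -/
abbrev Seqs (ι : Type*) := Σ N : ℕ, Fin N → ι

/-- The number of occurrences of the letter `i` in the sequence `s`. -/
def cnt {ι : Type*} [DecidableEq ι] {N : ℕ} (s : Fin N → ι) (i : ι) : ℕ :=
  (Finset.univ.filter fun j => s j = i).card

lemma prod_comp_eq_prod_pow_cnt {ι M : Type*} [Fintype ι] [DecidableEq ι] [CommMonoid M] {N : ℕ}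
    (s : Fin N → ι) (f : ι → M) : ∏ j, f (s j) = ∏ i, f i ^ cnt s i := by
  rw [← Finset.prod_fiberwise (s := Finset.univ) (g := s)]
  refine Finset.prod_congr rfl fun i _ => ?_
  rw [cnt, ← Finset.prod_const]
  refine Finset.prod_congr rfl fun j hj => ?_
  rw [(Finset.mem_filter.1 hj).2]

/-- The number of sequences with given letter counts is a multinomial coefficient: compare
coefficients in the two expansions of `(∑ Xᵢ)^N`. -/
lemma card_cnt_eq {ι : Type*} [Fintype ι] [DecidableEq ι] (N : ℕ) (c : ι → ℕ) :
    (Finset.univ.filter fun s : Fin N → ι => cnt s = c).card =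
      if ∑ i, c i = N then Nat.multinomial Finset.univ c else 0 := by
  classical
  have h := MvPolynomial.coeff_sum_X_pow_of_fintype (R := ℕ) (Finsupp.equivFunOnFinite.symm c) N
  have hsum : (Finsupp.equivFunOnFinite.symm c).sum (fun _ m => m) = ∑ i, c i := by
    rw [Finsupp.sum_fintype _ _ fun _ => rfl]; simp
  have hmul : (Finsupp.equivFunOnFinite.symm c).multinomial = Nat.multinomial Finset.univ c := by
    rw [← Finsupp.multinomial_of_support_subset (Finset.subset_univ _)]; simp
  rw [hsum, hmul] at h
  have h2 : MvPolynomial.coeff (Finsupp.equivFunOnFinite.symm c)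
      ((∑ i, MvPolynomial.X i : MvPolynomial ι ℕ) ^ N) =
      (Finset.univ.filter fun s : Fin N → ι => cnt s = c).card := by
    rw [Fintype.sum_pow, MvPolynomial.coeff_sum, Finset.card_filter]
    refine Finset.sum_congr rfl fun s _ => ?_
    have : (∏ j, MvPolynomial.X (s j) : MvPolynomial ι ℕ) =
        MvPolynomial.monomial (Finsupp.equivFunOnFinite.symm (cnt s)) 1 := by
      rw [prod_comp_eq_prod_pow_cnt s, MvPolynomial.monomial_eq, Finsupp.prod_fintype _ _ (by simp)]
      simp
    rw [this, MvPolynomial.coeff_monomial]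
    simp
  rw [← h2, h]
  split_ifs <;> simp

/-- The law of the letter counts of a Poissonised sample: sequences weighted by `1 / N!` turn into
count vectors weighted by `1 / ∏ᵢ cᵢ!`. -/
lemma tsum_cnt {ι : Type*} [Fintype ι] [DecidableEq ι] (G : (ι → ℕ) → ℝ≥0∞) :
    ∑' s : Seqs ι, ENNReal.ofReal (1 / (s.1.factorial : ℝ)) * G (cnt s.2) =
      ∑' c : ι → ℕ, ENNReal.ofReal (1 / ∏ i, ((c i).factorial : ℝ)) * G c := by
  classical
  rw [ENNReal.tsum_sigma']
  have h1 : ∀ N : ℕ, ∑' s : Fin N → ι, ENNReal.ofReal (1 / (N.factorial : ℝ)) * G (cnt s) =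
      ∑' c : ι → ℕ, if ∑ i, c i = N then
        ENNReal.ofReal (1 / ∏ i, ((c i).factorial : ℝ)) * G c else 0 := by
    intro N
    rw [← (Equiv.sigmaFiberEquiv (fun s : Fin N → ι => cnt s)).tsum_eq, ENNReal.tsum_sigma']
    refine tsum_congr fun c => ?_
    have : ∀ s : {s : Fin N → ι // cnt s = c},
        ENNReal.ofReal (1 / (N.factorial : ℝ)) *
          G (cnt ((Equiv.sigmaFiberEquiv (fun s : Fin N → ι => cnt s)) ⟨c, s⟩)) =
        ENNReal.ofReal (1 / (N.factorial : ℝ)) * G c := by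
      intro s
      simp [Equiv.sigmaFiberEquiv, s.2]
    rw [tsum_congr this, tsum_fintype, Finset.sum_const, Finset.card_univ, Fintype.card_subtype,
      card_cnt_eq]
    split_ifs with hN
    · have hspec := Nat.multinomial_spec Finset.univ c
      rw [hN] at hspec
      have hspec' : (∏ i, ((c i).factorial : ℝ)) * (Nat.multinomial Finset.univ c : ℝ) =
          N.factorial := by exact_mod_cast hspec
      rw [nsmul_eq_mul, ← mul_assoc]
      congr 1
      rw [← ENNReal.ofReal_natCast, ← ENNReal.ofReal_mul (Nat.cast_nonneg _), ← hspec']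
      congr 1
      have h3 : (∏ i, ((c i).factorial : ℝ)) ≠ 0 :=
        Finset.prod_ne_zero_iff.2 fun i _ => by positivity
      have h4 : (Nat.multinomial Finset.univ c : ℝ) ≠ 0 := by
        exact_mod_cast (Nat.multinomial_pos _ _).ne'
      field_simp
    · simp
  rw [tsum_congr h1, ENNReal.tsum_comm]
  refine tsum_congr fun c => ?_
  rw [tsum_eq_single (∑ i, c i) fun N hN => if_neg (Ne.symm hN), if_pos rfl]

lemma tsum_pi_prod {α : Type*} {k : ℕ} (f : Fin k → α → ℝ≥0∞) :
    ∑' c : Fin k → α, ∏ i, f i (c i) = ∏ i, ∑' x, f i x := by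
  induction k with
  | zero => simp
  | succ k ih =>
    rw [← (Fin.consEquiv (fun _ : Fin (k + 1) => α)).tsum_eq, ENNReal.tsum_prod',
      Fin.prod_univ_succ, ← ih]
    simp only [Fin.consEquiv, Equiv.coe_fn_mk, Fin.prod_univ_succ, Fin.cons_zero, Fin.cons_succ]
    simp_rw [ENNReal.tsum_mul_left]
    rw [ENNReal.tsum_mul_right]

/-- Sums over three Poissonised samples of functions that factorise over the letter counts are
products over the letters. -/
lemma tsum_three_cnt {k : ℕ} {g : Fin k → ℕ × ℕ × ℕ → ℝ} (hg : ∀ i x, 0 ≤ g i x) :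
    ∑' D : Seqs (Fin k) × Seqs (Fin k) × Seqs (Fin k),
      ENNReal.ofReal ((∏ i, g i (cnt D.1.2 i, cnt D.2.1.2 i, cnt D.2.2.2 i)) /
        fact3 (D.1.1, D.2.1.1, D.2.2.1)) =
      ∏ i, ∑' x, ENNReal.ofReal (g i x / fact3 x) := by
  have hf : ∀ n : ℕ, (0 : ℝ) ≤ 1 / (n.factorial : ℝ) := fun n => by positivity
  have e : ∀ D : Seqs (Fin k) × Seqs (Fin k) × Seqs (Fin k),
      ENNReal.ofReal ((∏ i, g i (cnt D.1.2 i, cnt D.2.1.2 i, cnt D.2.2.2 i)) /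
        fact3 (D.1.1, D.2.1.1, D.2.2.1)) =
      ENNReal.ofReal (1 / (D.1.1.factorial : ℝ)) * (ENNReal.ofReal (1 / (D.2.1.1.factorial : ℝ)) *
        (ENNReal.ofReal (1 / (D.2.2.1.factorial : ℝ)) *
          ENNReal.ofReal (∏ i, g i (cnt D.1.2 i, cnt D.2.1.2 i, cnt D.2.2.2 i)))) := by
    intro D
    rw [← ENNReal.ofReal_mul (hf _), ← ENNReal.ofReal_mul (hf _), ← ENNReal.ofReal_mul (hf _)]
    congr 1
    simp only [fact3]
    field_simp
  simp_rw [e]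
  rw [← tsum_pi_prod, ENNReal.tsum_prod']
  simp_rw [ENNReal.tsum_prod', ENNReal.tsum_mul_left]
  rw [tsum_cnt fun c₁ => ∑' s₂ : Seqs (Fin k), ENNReal.ofReal (1 / (s₂.1.factorial : ℝ)) *
    ∑' s₃ : Seqs (Fin k), ENNReal.ofReal (1 / (s₃.1.factorial : ℝ)) *
      ENNReal.ofReal (∏ i, g i (c₁ i, cnt s₂.2 i, cnt s₃.2 i))]
  have h2 : ∀ c₁ : Fin k → ℕ, _ := fun c₁ =>
    tsum_cnt fun c₂ => ∑' s₃ : Seqs (Fin k), ENNReal.ofReal (1 / (s₃.1.factorial : ℝ)) *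
      ENNReal.ofReal (∏ i, g i (c₁ i, c₂ i, cnt s₃.2 i))
  simp_rw [h2]
  have h3 : ∀ c₁ c₂ : Fin k → ℕ, _ := fun c₁ c₂ =>
    tsum_cnt fun c₃ => ENNReal.ofReal (∏ i, g i (c₁ i, c₂ i, c₃ i))
  simp_rw [h3, ← ENNReal.tsum_mul_left]
  rw [← (Equiv.arrowProdEquivProdArrow (Fin k) (fun _ => ℕ) (fun _ => ℕ × ℕ)).symm.tsum_eq,
    ENNReal.tsum_prod']
  refine tsum_congr fun c₁ => ?_
  rw [← (Equiv.arrowProdEquivProdArrow (Fin k) (fun _ => ℕ) (fun _ => ℕ)).symm.tsum_eq,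
    ENNReal.tsum_prod']
  refine tsum_congr fun c₂ => tsum_congr fun c₃ => ?_
  have hF : ∀ c : Fin k → ℕ, (0 : ℝ) ≤ 1 / ∏ i, ((c i).factorial : ℝ) := fun c => by positivity
  rw [← ENNReal.ofReal_mul (hF _), ← ENNReal.ofReal_mul (hF _), ← ENNReal.ofReal_mul (hF _),
    ← ENNReal.ofReal_prod_of_nonneg fun i _ => div_nonneg (hg i _) (fact3_pos _).le]
  congr 1
  simp only [Equiv.arrowProdEquivProdArrow, Equiv.coe_fn_symm_mk, fact3, Finset.prod_div_distrib,
    Finset.prod_mul_distrib]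
  field_simp

/-- The probability of the sequence `s` when a `Poi(∑ pᵢ)`-number of letters is drawn
independently with probabilities proportional to `p`. -/
def seqWt {ι : Type*} [Fintype ι] (p : ι → ℝ) (s : Seqs ι) : ℝ :=
  Real.exp (-∑ i, p i) * (∏ j, p (s.2 j)) / s.1.factorial

lemma seqWt_nonneg {ι : Type*} [Fintype ι] {p : ι → ℝ} (hp : ∀ i, 0 ≤ p i) (s : Seqs ι) :
    0 ≤ seqWt p s :=
  div_nonneg (mul_nonneg (Real.exp_pos _).le (Finset.prod_nonneg fun _ _ => hp _))
    (Nat.cast_nonneg _)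

lemma seqWt_eq_prod_poiWt {ι : Type*} [Fintype ι] [DecidableEq ι] (p : ι → ℝ) (s : Seqs ι) :
    seqWt p s = (∏ i, poiWt (p i) (cnt s.2 i)) / s.1.factorial := by
  rw [seqWt, prod_comp_eq_prod_pow_cnt]
  simp only [poiWt, Finset.prod_mul_distrib, ← Real.exp_sum, Finset.sum_neg_distrib]

lemma sum_ofReal_prod {ι : Type*} [Fintype ι] {p : ι → ℝ} (hp : ∀ i, 0 ≤ p i) (N : ℕ) :
    ∑ s : Fin N → ι, ENNReal.ofReal (∏ j, p (s j)) = ENNReal.ofReal ((∑ i, p i) ^ N) := by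
  rw [Fintype.sum_pow, ENNReal.ofReal_sum_of_nonneg]
  exact fun s _ => Finset.prod_nonneg fun _ _ => hp _

/-- The first `n` letters of a sequence fed into `F`, and `0` if the sequence is too short. -/
def trunc {ι : Type*} (n : ℕ) (s : Seqs ι) (F : (Fin n → ι) → ℝ≥0∞) : ℝ≥0∞ :=
  if h : n ≤ s.1 then F fun j => s.2 (Fin.castLE h j) else 0

/-- Given that a Poissonised sample has at least `n` letters, its first `n` letters are an i.i.d.
sample from the normalised distribution. -/
lemma tsum_seqWt_trunc_le {ι : Type*} [Fintype ι] {p : ι → ℝ} (hp : ∀ i, 0 ≤ p i)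
    (hP : 0 < ∑ i, p i) (n : ℕ) (F : (Fin n → ι) → ℝ≥0∞) :
    ∑' s : Seqs ι, ENNReal.ofReal (seqWt p s) * trunc n s F ≤
      ∑ x : Fin n → ι, ENNReal.ofReal (∏ j, p (x j) / ∑ i, p i) * F x := by
  classical
  set P := ∑ i, p i with hPdef
  set T := ∑ x : Fin n → ι, ENNReal.ofReal (∏ j, p (x j) / P) * F x with hT
  rw [ENNReal.tsum_sigma']
  have key : ∀ N : ℕ, ∑' s : Fin N → ι, ENNReal.ofReal (seqWt p ⟨N, s⟩) * trunc n ⟨N, s⟩ F ≤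
      ENNReal.ofReal (poiWt P N / N.factorial) * T := by
    intro N
    rw [tsum_fintype]
    by_cases h : n ≤ N
    · obtain ⟨d, rfl⟩ := Nat.exists_eq_add_of_le h
      simp only [trunc, h, dif_pos]
      rw [← (Fin.appendEquiv n d).sum_comp, Fintype.sum_prod_type, hT, Finset.mul_sum]
      refine Finset.sum_le_sum fun x _ => ?_
      have e : ∀ y : Fin d → ι, ENNReal.ofReal (seqWt p ⟨n + d, Fin.appendEquiv n d (x, y)⟩) *
          F (fun j => Fin.appendEquiv n d (x, y) (Fin.castLE h j)) =
          ENNReal.ofReal (Real.exp (-P) * (∏ j, p (x j)) / (n + d).factorial) * F x *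
            ENNReal.ofReal (∏ j, p (y j)) := by
        intro y
        have h1 : (fun j => Fin.appendEquiv n d (x, y) (Fin.castLE h j)) = x := by
          funext j
          exact Fin.append_left x y j
        have h2 : seqWt p ⟨n + d, Fin.appendEquiv n d (x, y)⟩ =
            (Real.exp (-P) * (∏ j, p (x j)) / (n + d).factorial) * ∏ j, p (y j) := by
          simp only [seqWt, Fin.appendEquiv, Equiv.coe_fn_mk, Fin.prod_univ_add, Fin.append_left,
            Fin.append_right]
          ring
        have h3 : 0 ≤ Real.exp (-P) * (∏ j, p (x j)) / (n + d).factorial :=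
          div_nonneg (mul_nonneg (Real.exp_pos _).le (Finset.prod_nonneg fun _ _ => hp _))
            (Nat.cast_nonneg _)
        rw [h1, h2, ENNReal.ofReal_mul h3]
        ring
      simp_rw [e]
      rw [← Finset.mul_sum, sum_ofReal_prod hp, mul_right_comm, ← mul_assoc]
      refine le_of_eq ?_
      have h3 : 0 ≤ Real.exp (-P) * (∏ j, p (x j)) / (n + d).factorial :=
          div_nonneg (mul_nonneg (Real.exp_pos _).le (Finset.prod_nonneg fun _ _ => hp _))
            (Nat.cast_nonneg _)
      rw [← ENNReal.ofReal_mul h3, ← ENNReal.ofReal_mul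
        (div_nonneg (poiWt_nonneg hP.le _) (Nat.cast_nonneg _))]
      congr 2
      rw [Finset.prod_div_distrib, Finset.prod_const, Finset.card_univ, Fintype.card_fin, poiWt,
        pow_add]
      field_simp
      rw [hPdef]
    · simp [trunc, h]
  refine (ENNReal.tsum_le_tsum key).trans ?_
  rw [ENNReal.tsum_mul_right, tsum_poiWt hP.le, one_mul]

lemma tsum_seqWt {ι : Type*} [Fintype ι] {p : ι → ℝ} (hp : ∀ i, 0 ≤ p i) :
    ∑' s : Seqs ι, ENNReal.ofReal (seqWt p s) = 1 := by
  have hP : 0 ≤ ∑ i, p i := Finset.sum_nonneg fun i _ => hp i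
  rw [ENNReal.tsum_sigma', ← tsum_poiWt hP]
  refine tsum_congr fun N => ?_
  have h0 : 0 ≤ Real.exp (-∑ i, p i) / N.factorial := by positivity
  have e : ∀ s : Fin N → ι, ENNReal.ofReal (seqWt p ⟨N, s⟩) =
      ENNReal.ofReal (Real.exp (-∑ i, p i) / N.factorial) * ENNReal.ofReal (∏ j, p (s j)) := by
    intro s
    rw [← ENNReal.ofReal_mul h0, seqWt]
    congr 1
    ring
  rw [tsum_fintype]
  simp_rw [e]
  rw [← Finset.mul_sum, sum_ofReal_prod hp, ← ENNReal.ofReal_mul h0, poiWt]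
  congr 1
  ring

/-- The probability generating function of the size of a Poissonised sample at `1 / 2`. -/
lemma tsum_seqWt_mul_half_pow {ι : Type*} [Fintype ι] {p : ι → ℝ} (hp : ∀ i, 0 ≤ p i) :
    ∑' s : Seqs ι, ENNReal.ofReal (seqWt p s) * ENNReal.ofReal ((1 / 2) ^ s.1) =
      ENNReal.ofReal (Real.exp (-(∑ i, p i) / 2)) := by
  have e : ∀ s : Seqs ι, ENNReal.ofReal (seqWt p s) * ENNReal.ofReal ((1 / 2) ^ s.1) =
      ENNReal.ofReal (Real.exp (-(∑ i, p i) / 2)) *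
        ENNReal.ofReal (seqWt (fun i => p i / 2) s) := by
    intro s
    rw [← ENNReal.ofReal_mul (seqWt_nonneg hp s), ← ENNReal.ofReal_mul (Real.exp_pos _).le]
    congr 1
    simp only [seqWt, Finset.prod_div_distrib, ← Finset.sum_div, Finset.prod_const,
      Finset.card_univ, Fintype.card_fin]
    have : Real.exp (-∑ i, p i) =
        Real.exp (-(∑ i, p i) / 2) * Real.exp (-((∑ i, p i) / 2)) := by
      rw [← Real.exp_add]; ring_nf
    rw [this, one_div, inv_pow]
    ring
  simp_rw [e]
  rw [ENNReal.tsum_mul_left, tsum_seqWt fun i => div_nonneg (hp i) (by norm_num), mul_one]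

/-- Three independent Poissonised samples. -/
abbrev Seqs3 (ι : Type*) := Seqs ι × Seqs ι × Seqs ι

/-- The probability of a triple of sequences under three independent Poissonised samples. -/
def seqWt3 {ι : Type*} [Fintype ι] (p₁ p₂ p₃ : ι → ℝ) (D : Seqs3 ι) : ℝ :=
  seqWt p₁ D.1 * (seqWt p₂ D.2.1 * seqWt p₃ D.2.2)

lemma seqWt3_nonneg {ι : Type*} [Fintype ι] {p₁ p₂ p₃ : ι → ℝ} (h₁ : ∀ i, 0 ≤ p₁ i)
    (h₂ : ∀ i, 0 ≤ p₂ i) (h₃ : ∀ i, 0 ≤ p₃ i) (D : Seqs3 ι) : 0 ≤ seqWt3 p₁ p₂ p₃ D :=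
  mul_nonneg (seqWt_nonneg h₁ _) (mul_nonneg (seqWt_nonneg h₂ _) (seqWt_nonneg h₃ _))

lemma ofReal_seqWt3 {ι : Type*} [Fintype ι] {p₁ p₂ : ι → ℝ} (p₃ : ι → ℝ) (h₁ : ∀ i, 0 ≤ p₁ i)
    (h₂ : ∀ i, 0 ≤ p₂ i) (D : Seqs3 ι) :
    ENNReal.ofReal (seqWt3 p₁ p₂ p₃ D) = ENNReal.ofReal (seqWt p₁ D.1) *
      (ENNReal.ofReal (seqWt p₂ D.2.1) * ENNReal.ofReal (seqWt p₃ D.2.2)) := by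
  rw [seqWt3, ENNReal.ofReal_mul (seqWt_nonneg h₁ _), ENNReal.ofReal_mul (seqWt_nonneg h₂ _)]

lemma tsum_seqWt3_mul {ι : Type*} [Fintype ι] {p₁ p₂ : ι → ℝ} (p₃ : ι → ℝ) (h₁ : ∀ i, 0 ≤ p₁ i)
    (h₂ : ∀ i, 0 ≤ p₂ i) (f₁ f₂ f₃ : Seqs ι → ℝ≥0∞) :
    ∑' D : Seqs3 ι, ENNReal.ofReal (seqWt3 p₁ p₂ p₃ D) * (f₁ D.1 * (f₂ D.2.1 * f₃ D.2.2)) =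
      (∑' s, ENNReal.ofReal (seqWt p₁ s) * f₁ s) * ((∑' s, ENNReal.ofReal (seqWt p₂ s) * f₂ s) *
        ∑' s, ENNReal.ofReal (seqWt p₃ s) * f₃ s) := by
  have e : ∀ D : Seqs3 ι,
      ENNReal.ofReal (seqWt3 p₁ p₂ p₃ D) * (f₁ D.1 * (f₂ D.2.1 * f₃ D.2.2)) =
      (ENNReal.ofReal (seqWt p₁ D.1) * f₁ D.1) * ((ENNReal.ofReal (seqWt p₂ D.2.1) * f₂ D.2.1) *
        (ENNReal.ofReal (seqWt p₃ D.2.2) * f₃ D.2.2)) := by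
    intro D
    rw [ofReal_seqWt3 p₃ h₁ h₂]
    ring
  simp_rw [e]
  rw [ENNReal.tsum_prod']
  simp_rw [ENNReal.tsum_mul_left]
  rw [ENNReal.tsum_mul_right, ENNReal.tsum_prod']
  simp_rw [ENNReal.tsum_mul_left]
  rw [ENNReal.tsum_mul_right]

lemma tsum_seqWt3 {ι : Type*} [Fintype ι] {p₁ p₂ p₃ : ι → ℝ} (h₁ : ∀ i, 0 ≤ p₁ i)
    (h₂ : ∀ i, 0 ≤ p₂ i) (h₃ : ∀ i, 0 ≤ p₃ i) :
    ∑' D : Seqs3 ι, ENNReal.ofReal (seqWt3 p₁ p₂ p₃ D) = 1 := by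
  have := tsum_seqWt3_mul p₃ h₁ h₂ (fun _ => 1) (fun _ => 1) (fun _ => 1)
  simpa [tsum_seqWt h₁, tsum_seqWt h₂, tsum_seqWt h₃] using this

/-- A function of fixed-size samples evaluated on the first letters of three Poissonised samples,
and `0` if one of these is too short. -/
def trunc3 {ι : Type*} (n m : ℕ) (e : (Fin n → ι) × (Fin n → ι) × (Fin m → ι) → ℝ≥0∞)
    (D : Seqs3 ι) : ℝ≥0∞ :=
  trunc n D.1 fun x => trunc n D.2.1 fun y => trunc m D.2.2 fun z => e (x, y, z)

lemma tsum_seqWt3_trunc3_le {ι : Type*} [Fintype ι] {p₁ p₂ p₃ : ι → ℝ} (h₁ : ∀ i, 0 ≤ p₁ i)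
    (h₂ : ∀ i, 0 ≤ p₂ i) (h₃ : ∀ i, 0 ≤ p₃ i) (P₁ : 0 < ∑ i, p₁ i) (P₂ : 0 < ∑ i, p₂ i)
    (P₃ : 0 < ∑ i, p₃ i) (n m : ℕ) (e : (Fin n → ι) × (Fin n → ι) × (Fin m → ι) → ℝ≥0∞) :
    ∑' D : Seqs3 ι, ENNReal.ofReal (seqWt3 p₁ p₂ p₃ D) * trunc3 n m e D ≤
      ∑ x : Fin n → ι, ENNReal.ofReal (∏ j, p₁ (x j) / ∑ i, p₁ i) *
        ∑ y : Fin n → ι, ENNReal.ofReal (∏ j, p₂ (y j) / ∑ i, p₂ i) *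
          ∑ z : Fin m → ι, ENNReal.ofReal (∏ j, p₃ (z j) / ∑ i, p₃ i) * e (x, y, z) := by
  have pull : ∀ {n : ℕ} (c : ℝ≥0∞) (s : Seqs ι) (F : (Fin n → ι) → ℝ≥0∞),
      c * trunc n s F = trunc n s fun x => c * F x := by
    intro n c s F
    unfold trunc; split_ifs <;> simp
  have pullsum : ∀ {n : ℕ} (s : Seqs ι) (F : Seqs ι → (Fin n → ι) → ℝ≥0∞),
      ∑' s', trunc n s (F s') = trunc n s fun x => ∑' s', F s' x := by
    intro n s F
    unfold trunc; split_ifs <;> simp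
  have mono : ∀ {n : ℕ} (s : Seqs ι) {F G : (Fin n → ι) → ℝ≥0∞}, (∀ x, F x ≤ G x) →
      trunc n s F ≤ trunc n s G := by
    intro n s F G h
    unfold trunc; split_ifs
    · exact h _
    · exact le_rfl
  rw [ENNReal.tsum_prod']
  refine le_trans (ENNReal.tsum_le_tsum fun s₁ => ?_) (tsum_seqWt_trunc_le h₁ P₁ n _)
  have e1 : ∀ D : Seqs ι × Seqs ι,
      ENNReal.ofReal (seqWt3 p₁ p₂ p₃ (s₁, D)) * trunc3 n m e (s₁, D) =
      ENNReal.ofReal (seqWt p₁ s₁) * trunc n s₁ fun x =>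
        ENNReal.ofReal (seqWt p₂ D.1) * (ENNReal.ofReal (seqWt p₃ D.2) *
          trunc n D.1 fun y => trunc m D.2 fun z => e (x, y, z)) := by
    intro D
    rw [ofReal_seqWt3 p₃ h₁ h₂, trunc3]
    simp only
    rw [← pull, ← pull]
    ring
  simp_rw [e1]
  rw [ENNReal.tsum_mul_left]
  gcongr
  rw [ENNReal.tsum_prod']
  simp_rw [pullsum]
  refine mono s₁ fun x => ?_
  refine le_trans (ENNReal.tsum_le_tsum fun s₂ => ?_) (tsum_seqWt_trunc_le h₂ P₂ n _)
  rw [ENNReal.tsum_mul_left]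
  gcongr
  simp_rw [pull]
  rw [pullsum]
  refine mono s₂ fun y => ?_
  simp_rw [← pull]
  exact tsum_seqWt_trunc_le h₃ P₃ m _

/-! ### From fixed-size samples to mixtures of Poissonised samples -/

/-- The probability distribution on `Fin k` proportional to the weights `p`. -/
def normLaw {k : ℕ} (p : Fin k → ℝ) (hp : ∀ i, 0 ≤ p i) (hP : 0 < ∑ i, p i) :
    ProbabilityMeasure (Fin k) :=
  ⟨Measure.sum fun i => ENNReal.ofReal (p i / ∑ j, p j) • Measure.dirac i, by
    constructor
    rw [Measure.sum_apply _ MeasurableSet.univ, tsum_fintype]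
    simp only [Measure.smul_apply, measure_univ, smul_eq_mul, mul_one]
    rw [← ENNReal.ofReal_sum_of_nonneg fun i _ => div_nonneg (hp i) hP.le, ← Finset.sum_div,
      div_self hP.ne', ENNReal.ofReal_one]⟩

lemma normLaw_singleton {k : ℕ} (p : Fin k → ℝ) (hp : ∀ i, 0 ≤ p i) (hP : 0 < ∑ i, p i)
    (i : Fin k) :
    (normLaw p hp hP : Measure (Fin k)) {i} = ENNReal.ofReal (p i / ∑ j, p j) := by
  simp only [normLaw, ProbabilityMeasure.coe_mk]
  rw [Measure.sum_apply _ (measurableSet_singleton i), tsum_fintype, Finset.sum_eq_single i]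
  · simp
  · intro j _ hj
    simp [hj]
  · simp

lemma normLaw_real {k : ℕ} (p : Fin k → ℝ) (hp : ∀ i, 0 ≤ p i) (hP : 0 < ∑ i, p i)
    (A : Finset (Fin k)) :
    (normLaw p hp hP : Measure (Fin k)).real A = (∑ i ∈ A, p i) / ∑ j, p j := by
  rw [← sum_measureReal_singleton, Finset.sum_div]
  refine Finset.sum_congr rfl fun i _ => ?_
  rw [measureReal_def, normLaw_singleton, ENNReal.toReal_ofReal (div_nonneg (hp i) hP.le)]

lemma abs_sub_le_tvDist {𝒳 : Type*} [MeasurableSpace 𝒳] (μ ν : Measure 𝒳)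
    [IsProbabilityMeasure μ] [IsProbabilityMeasure ν] {A : Set 𝒳} (hA : MeasurableSet A) :
    |μ.real A - ν.real A| ≤ tvDist μ ν := by
  refine le_ciSup (f := fun A : {A : Set 𝒳 // MeasurableSet A} => |μ.real A.1 - ν.real A.1|)
    ⟨1, ?_⟩ ⟨A, hA⟩
  rintro _ ⟨B, rfl⟩
  have h1 : μ.real B.1 ≤ 1 := measureReal_le_one
  have h2 : ν.real B.1 ≤ 1 := measureReal_le_one
  have h3 : 0 ≤ μ.real B.1 := measureReal_nonneg
  have h4 : 0 ≤ ν.real B.1 := measureReal_nonneg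
  exact abs_le.2 ⟨by linarith, by linarith⟩

lemma tvDist_comm {𝒳 : Type*} [MeasurableSpace 𝒳] (μ ν : Measure 𝒳) :
    tvDist μ ν = tvDist ν μ := by
  unfold tvDist
  simp_rw [abs_sub_comm]

instance isProbabilityMeasure_sampleLaw {𝒳 : Type*} [MeasurableSpace 𝒳]
    (PX PY PZ : ProbabilityMeasure 𝒳) (n m : ℕ) :
    IsProbabilityMeasure (sampleLaw PX PY PZ n m) := by
  unfold sampleLaw; infer_instance

lemma measure_le_ofReal_of_real_le {Ω : Type*} [MeasurableSpace Ω] {μ : Measure Ω}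
    [IsFiniteMeasure μ] {S : Set Ω} {d : ℝ} (h : μ.real S ≤ d) : μ S ≤ ENNReal.ofReal d := by
  rw [← ENNReal.ofReal_toReal (measure_ne_top μ S)]
  exact ENNReal.ofReal_le_ofReal h

/-- Probabilities of events under the law of three independent samples from a finite alphabet. -/
lemma sampleLaw_apply {k n m : ℕ} (PX PY PZ : ProbabilityMeasure (Fin k))
    (S : Set ((Fin n → Fin k) × (Fin n → Fin k) × (Fin m → Fin k))) :
    sampleLaw PX PY PZ n m S = ∑ x : Fin n → Fin k, (∏ j, (PX : Measure (Fin k)) {x j}) *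
      ∑ y : Fin n → Fin k, (∏ j, (PY : Measure (Fin k)) {y j}) *
        ∑ z : Fin m → Fin k, (∏ j, (PZ : Measure (Fin k)) {z j}) *
          S.indicator 1 (x, y, z) := by
  classical
  have hS : MeasurableSet S := MeasurableSet.of_discrete
  rw [← lintegral_indicator_one hS, lintegral_fintype, Fintype.sum_prod_type]
  refine Finset.sum_congr rfl fun x _ => ?_
  rw [Fintype.sum_prod_type, Finset.mul_sum]
  refine Finset.sum_congr rfl fun y _ => ?_
  rw [Finset.mul_sum, Finset.mul_sum]
  refine Finset.sum_congr rfl fun z _ => ?_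
  have e : ({(x, y, z)} : Set ((Fin n → Fin k) × (Fin n → Fin k) × (Fin m → Fin k))) =
      {x} ×ˢ ({y} ×ˢ {z}) := by simp
  rw [e, sampleLaw, Measure.prod_prod, Measure.prod_prod, Measure.pi_singleton,
    Measure.pi_singleton, Measure.pi_singleton]
  ring

/-- The mixture over i.i.d. letter states `θ` (with probabilities `w`) of three independent
Poissonised samples, where the letter `i` in state `θ` has the rates `r₁ i θ`, `r₂ i θ`,
`r₃ i θ`. -/
def mixLaw {ι Θ : Type*} [Fintype ι] [DecidableEq ι] [Fintype Θ] (w : Θ → ℝ)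
    (r₁ r₂ r₃ : ι → Θ → ℝ) (D : Seqs3 ι) : ℝ :=
  ∑ θ : ι → Θ, (∏ i, w (θ i)) *
    seqWt3 (fun i => r₁ i (θ i)) (fun i => r₂ i (θ i)) (fun i => r₃ i (θ i)) D

/-- The mixture factorises over the letters. -/
lemma mixLaw_eq_prod {ι Θ : Type*} [Fintype ι] [DecidableEq ι] [Fintype Θ] (w : Θ → ℝ)
    (r₁ r₂ r₃ : ι → Θ → ℝ) (D : Seqs3 ι) :
    mixLaw w r₁ r₂ r₃ D =
      (∏ i, mixWt w (r₁ i) (r₂ i) (r₃ i) (cnt D.1.2 i, cnt D.2.1.2 i, cnt D.2.2.2 i)) /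
        fact3 (D.1.1, D.2.1.1, D.2.2.1) := by
  classical
  simp only [mixWt]
  rw [Finset.prod_univ_sum, Finset.sum_div, mixLaw, Fintype.piFinset_univ]
  refine Finset.sum_congr rfl fun θ _ => ?_
  simp only [seqWt3, seqWt_eq_prod_poiWt, fact3, poiWt3, Finset.prod_mul_distrib]
  field_simp

section mixture

variable {ι Θ : Type*} [Fintype ι] [DecidableEq ι] [Fintype Θ] {w : Θ → ℝ}
  {r₁ r₂ r₃ : ι → Θ → ℝ}

lemma mixLaw_nonneg (hw : ∀ θ, 0 ≤ w θ) (h₁ : ∀ i θ, 0 ≤ r₁ i θ) (h₂ : ∀ i θ, 0 ≤ r₂ i θ)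
    (h₃ : ∀ i θ, 0 ≤ r₃ i θ) (D : Seqs3 ι) : 0 ≤ mixLaw w r₁ r₂ r₃ D :=
  Finset.sum_nonneg fun _ _ => mul_nonneg (Finset.prod_nonneg fun _ _ => hw _)
    (seqWt3_nonneg (fun _ => h₁ _ _) (fun _ => h₂ _ _) (fun _ => h₃ _ _) D)

/-- Averages over the mixture are averages over `θ` of the averages given `θ`. -/
lemma tsum_mixLaw_mul (hw : ∀ θ, 0 ≤ w θ) (h₁ : ∀ i θ, 0 ≤ r₁ i θ) (h₂ : ∀ i θ, 0 ≤ r₂ i θ)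
    (h₃ : ∀ i θ, 0 ≤ r₃ i θ) (f : Seqs3 ι → ℝ≥0∞) :
    ∑' D, ENNReal.ofReal (mixLaw w r₁ r₂ r₃ D) * f D =
      ∑ θ : ι → Θ, ENNReal.ofReal (∏ i, w (θ i)) *
        ∑' D, ENNReal.ofReal (seqWt3 (fun i => r₁ i (θ i)) (fun i => r₂ i (θ i))
          (fun i => r₃ i (θ i)) D) * f D := by
  have hW : ∀ θ : ι → Θ, 0 ≤ ∏ i, w (θ i) := fun θ => Finset.prod_nonneg fun _ _ => hw _
  have e : ∀ D, ENNReal.ofReal (mixLaw w r₁ r₂ r₃ D) * f D =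
      ∑ θ : ι → Θ, ENNReal.ofReal (∏ i, w (θ i)) *
        (ENNReal.ofReal (seqWt3 (fun i => r₁ i (θ i)) (fun i => r₂ i (θ i))
          (fun i => r₃ i (θ i)) D) * f D) := by
    intro D
    rw [mixLaw, ENNReal.ofReal_sum_of_nonneg fun θ _ => mul_nonneg (hW θ)
      (seqWt3_nonneg (fun _ => h₁ _ _) (fun _ => h₂ _ _) (fun _ => h₃ _ _) D), Finset.sum_mul]
    refine Finset.sum_congr rfl fun θ _ => ?_
    rw [ENNReal.ofReal_mul (hW θ), mul_assoc]
  simp_rw [e]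
  rw [Summable.tsum_finsetSum fun _ _ => ENNReal.summable]
  simp_rw [ENNReal.tsum_mul_left]

lemma sum_prod_wt (hw1 : ∑ θ, w θ = 1) : ∑ θ : ι → Θ, ∏ i, w (θ i) = 1 := by
  have := Finset.prod_univ_sum (fun _ : ι => (Finset.univ : Finset Θ)) (fun _ θ => w θ)
  rw [Fintype.piFinset_univ] at this
  rw [← this]
  simp [hw1]

lemma sum_ofReal_prod_wt (hw : ∀ θ, 0 ≤ w θ) (hw1 : ∑ θ, w θ = 1) :
    ∑ θ : ι → Θ, ENNReal.ofReal (∏ i, w (θ i)) = 1 := by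
  rw [← ENNReal.ofReal_sum_of_nonneg fun θ _ => Finset.prod_nonneg fun _ _ => hw _,
    sum_prod_wt hw1, ENNReal.ofReal_one]

lemma tsum_mixLaw (hw : ∀ θ, 0 ≤ w θ) (hw1 : ∑ θ, w θ = 1) (h₁ : ∀ i θ, 0 ≤ r₁ i θ)
    (h₂ : ∀ i θ, 0 ≤ r₂ i θ) (h₃ : ∀ i θ, 0 ≤ r₃ i θ) :
    ∑' D, ENNReal.ofReal (mixLaw w r₁ r₂ r₃ D) = 1 := by
  have := tsum_mixLaw_mul hw h₁ h₂ h₃ fun _ => 1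
  simp only [mul_one] at this
  rw [this, ← sum_ofReal_prod_wt (ι := ι) hw hw1]
  refine Finset.sum_congr rfl fun θ _ => ?_
  rw [tsum_seqWt3 (fun _ => h₁ _ _) (fun _ => h₂ _ _) (fun _ => h₃ _ _), mul_one]

/-- A quantity at most `1` that is at most `d` on the configurations in `G` averages to at most
`d` plus the probability of the complement of `G`. -/
lemma tsum_mixLaw_mul_le (hw : ∀ θ, 0 ≤ w θ) (hw1 : ∑ θ, w θ = 1) (h₁ : ∀ i θ, 0 ≤ r₁ i θ)
    (h₂ : ∀ i θ, 0 ≤ r₂ i θ) (h₃ : ∀ i θ, 0 ≤ r₃ i θ) {f : Seqs3 ι → ℝ≥0∞} (hf : ∀ D, f D ≤ 1)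
    (G : Set (ι → Θ)) [DecidablePred (· ∈ G)] {β d : ℝ}
    (hβ : ∑ θ : ι → Θ with θ ∉ G, ∏ i, w (θ i) ≤ β) (hd0 : 0 ≤ d)
    (hd : ∀ θ ∈ G, ∑' D, ENNReal.ofReal (seqWt3 (fun i => r₁ i (θ i)) (fun i => r₂ i (θ i))
      (fun i => r₃ i (θ i)) D) * f D ≤ ENNReal.ofReal d) :
    ∑' D, ENNReal.ofReal (mixLaw w r₁ r₂ r₃ D) * f D ≤ ENNReal.ofReal (d + β) := by
  have hW : ∀ θ : ι → Θ, 0 ≤ ∏ i, w (θ i) := fun θ => Finset.prod_nonneg fun _ _ => hw _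
  have hβ0 : 0 ≤ β := (Finset.sum_nonneg fun θ _ => hW θ).trans hβ
  rw [tsum_mixLaw_mul hw h₁ h₂ h₃, ← Finset.sum_filter_add_sum_filter_not _ (· ∈ G),
    ENNReal.ofReal_add hd0 hβ0]
  refine add_le_add ?_ ?_
  · calc _ ≤ ∑ θ : ι → Θ with θ ∈ G, ENNReal.ofReal (∏ i, w (θ i)) * ENNReal.ofReal d := by
          refine Finset.sum_le_sum fun θ hθ => ?_
          gcongr
          exact hd θ (Finset.mem_filter.1 hθ).2
      _ ≤ ∑ θ : ι → Θ, ENNReal.ofReal (∏ i, w (θ i)) * ENNReal.ofReal d :=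
          Finset.sum_le_sum_of_subset (Finset.filter_subset _ _)
      _ = ENNReal.ofReal d := by
          rw [← Finset.sum_mul, sum_ofReal_prod_wt hw hw1, one_mul]
  · refine le_trans (Finset.sum_le_sum (g := fun θ => ENNReal.ofReal (∏ i, w (θ i)))
      fun θ _ => ?_) ?_
    · refine mul_le_of_le_one_right (zero_le) ?_
      rw [← tsum_seqWt3 (fun i => h₁ i (θ i)) (fun i => h₂ i (θ i)) (fun i => h₃ i (θ i))]
      exact ENNReal.tsum_le_tsum fun D => mul_le_of_le_one_right (zero_le) (hf D)
    · rw [← ENNReal.ofReal_sum_of_nonneg fun θ _ => hW θ]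
      exact ENNReal.ofReal_le_ofReal hβ

/-- The probability that one of the Poissonised samples is too short, by Markov's inequality for
`2^{-N}`. -/
lemma tsum_mixLaw_short_le (hw : ∀ θ, 0 ≤ w θ) (hw1 : ∑ θ, w θ = 1) (h₁ : ∀ i θ, 0 ≤ r₁ i θ)
    (h₂ : ∀ i θ, 0 ≤ r₂ i θ) (h₃ : ∀ i θ, 0 ≤ r₃ i θ) {n m : ℕ} {A B : ℝ}
    (hA₁ : ∀ θ : ι → Θ, A ≤ ∑ i, r₁ i (θ i)) (hA₂ : ∀ θ : ι → Θ, A ≤ ∑ i, r₂ i (θ i))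
    (hB : ∀ θ : ι → Θ, B ≤ ∑ i, r₃ i (θ i)) :
    ∑' D : Seqs3 ι, ENNReal.ofReal (mixLaw w r₁ r₂ r₃ D) *
      (2 ^ n * ENNReal.ofReal ((1 / 2) ^ D.1.1) + 2 ^ n * ENNReal.ofReal ((1 / 2) ^ D.2.1.1) +
        2 ^ m * ENNReal.ofReal ((1 / 2) ^ D.2.2.1)) ≤
      ENNReal.ofReal (2 * (2 ^ n * Real.exp (-A / 2)) + 2 ^ m * Real.exp (-B / 2)) := by
  set c := ENNReal.ofReal (2 * (2 ^ n * Real.exp (-A / 2)) + 2 ^ m * Real.exp (-B / 2))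
  rw [tsum_mixLaw_mul hw h₁ h₂ h₃]
  calc _ ≤ ∑ θ : ι → Θ, ENNReal.ofReal (∏ i, w (θ i)) * c := by
        refine Finset.sum_le_sum fun θ _ => ?_
        gcongr
        have a₁ : ∀ i, 0 ≤ r₁ i (θ i) := fun i => h₁ i _
        have a₂ : ∀ i, 0 ≤ r₂ i (θ i) := fun i => h₂ i _
        have a₃ : ∀ i, 0 ≤ r₃ i (θ i) := fun i => h₃ i _
        simp_rw [mul_add, ENNReal.tsum_add]
        have E₁ := tsum_seqWt3_mul (fun i => r₃ i (θ i)) a₁ a₂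
          (fun s => ENNReal.ofReal ((1 / 2) ^ s.1)) (fun _ => 1) (fun _ => 1)
        have E₂ := tsum_seqWt3_mul (fun i => r₃ i (θ i)) a₁ a₂ (fun _ => 1)
          (fun s => ENNReal.ofReal ((1 / 2) ^ s.1)) (fun _ => 1)
        have E₃ := tsum_seqWt3_mul (fun i => r₃ i (θ i)) a₁ a₂ (fun _ => 1) (fun _ => 1)
          (fun s => ENNReal.ofReal ((1 / 2) ^ s.1))
        simp only [mul_one, one_mul, tsum_seqWt a₁, tsum_seqWt a₂, tsum_seqWt a₃,
          tsum_seqWt_mul_half_pow a₁, tsum_seqWt_mul_half_pow a₂,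
          tsum_seqWt_mul_half_pow a₃] at E₁ E₂ E₃
        have two : ∀ j : ℕ, (2 : ℝ≥0∞) ^ j = ENNReal.ofReal (2 ^ j) := fun j => by
          rw [ENNReal.ofReal_pow (by norm_num)]; simp
        simp_rw [mul_left_comm _ ((2 : ℝ≥0∞) ^ _) _, ENNReal.tsum_mul_left, E₁, E₂, E₃, two]
        rw [← ENNReal.ofReal_mul (by positivity), ← ENNReal.ofReal_mul (by positivity),
          ← ENNReal.ofReal_mul (by positivity), ← ENNReal.ofReal_add (by positivity)
          (by positivity), ← ENNReal.ofReal_add (by positivity) (by positivity)]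
        refine ENNReal.ofReal_le_ofReal ?_
        have b₁ : Real.exp (-(∑ i, r₁ i (θ i)) / 2) ≤ Real.exp (-A / 2) :=
          Real.exp_le_exp.2 (by linarith [hA₁ θ])
        have b₂ : Real.exp (-(∑ i, r₂ i (θ i)) / 2) ≤ Real.exp (-A / 2) :=
          Real.exp_le_exp.2 (by linarith [hA₂ θ])
        have b₃ : Real.exp (-(∑ i, r₃ i (θ i)) / 2) ≤ Real.exp (-B / 2) :=
          Real.exp_le_exp.2 (by linarith [hB θ])
        have c₁ := mul_le_mul_of_nonneg_left b₁ (by positivity : (0 : ℝ) ≤ 2 ^ n)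
        have c₂ := mul_le_mul_of_nonneg_left b₂ (by positivity : (0 : ℝ) ≤ 2 ^ n)
        have c₃ := mul_le_mul_of_nonneg_left b₃ (by positivity : (0 : ℝ) ≤ 2 ^ m)
        linarith
    _ = c := by rw [← Finset.sum_mul, sum_ofReal_prod_wt hw hw1, one_mul]

end mixture

/-- The probability of a test's error for fixed-size samples bounds that of the test applied to
the first letters of Poissonised samples with proportional rates. -/
lemma tsum_seqWt3_indicator_le {k n m : ℕ} {p₁ p₂ p₃ : Fin k → ℝ} (h₁ : ∀ i, 0 ≤ p₁ i)
    (h₂ : ∀ i, 0 ≤ p₂ i) (h₃ : ∀ i, 0 ≤ p₃ i) (P₁ : 0 < ∑ i, p₁ i) (P₂ : 0 < ∑ i, p₂ i)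
    (P₃ : 0 < ∑ i, p₃ i)
    (S : Set ((Fin n → Fin k) × (Fin n → Fin k) × (Fin m → Fin k))) {N₁ N₂ N₃ : ℝ}
    (hN₁ : 0 < N₁) (hN₂ : 0 < N₂) (hN₃ : 0 < N₃) :
    ∑' D, ENNReal.ofReal (seqWt3 (fun i => N₁ * p₁ i) (fun i => N₂ * p₂ i)
        (fun i => N₃ * p₃ i) D) * trunc3 n m (S.indicator 1) D ≤
      sampleLaw (normLaw p₁ h₁ P₁) (normLaw p₂ h₂ P₂) (normLaw p₃ h₃ P₃) n m S := by
  have hs : ∀ {N : ℝ} {p : Fin k → ℝ}, 0 < N → 0 < ∑ i, p i → 0 < ∑ i, N * p i := by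
    intro N p hN hp
    rw [← Finset.mul_sum]; positivity
  refine (tsum_seqWt3_trunc3_le (fun i => mul_nonneg hN₁.le (h₁ i))
    (fun i => mul_nonneg hN₂.le (h₂ i)) (fun i => mul_nonneg hN₃.le (h₃ i)) (hs hN₁ P₁)
    (hs hN₂ P₂) (hs hN₃ P₃) n m _).trans_eq ?_
  rw [sampleLaw_apply]
  have e : ∀ {N : ℝ} {p : Fin k → ℝ} (hN : 0 < N) (hp : ∀ i, 0 ≤ p i) (hP : 0 < ∑ i, p i)
      {j : ℕ} (x : Fin j → Fin k), ENNReal.ofReal (∏ l, N * p (x l) / ∑ i, N * p i) =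
      ∏ l, (normLaw p hp hP : Measure (Fin k)) {x l} := by
    intro N p hN hp hP j x
    simp_rw [normLaw_singleton]
    rw [← ENNReal.ofReal_prod_of_nonneg fun l _ => div_nonneg (hp _) hP.le]
    congr 1
    refine Finset.prod_congr rfl fun l _ => ?_
    rw [← Finset.mul_sum, mul_div_mul_left _ _ hN.ne']
  simp_rw [e hN₁ h₁ P₁, e hN₂ h₂ P₂, e hN₃ h₃ P₃]

/-! ### Bhattacharyya affinity of the two mixtures -/

/-- The overlap of two distributions bounds their Bhattacharyya affinity: pointwise
`√(ab) = √(min · max) ≤ (s · min + max / s) / 2` and `max = a + b - min`. -/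
lemma sqrt_mul_le_min {a b s : ℝ} (ha : 0 ≤ a) (hb : 0 ≤ b) (hs : 0 < s) :
    √(a * b) ≤ (s - 1 / s) / 2 * min a b + 1 / (2 * s) * (a + b) := by
  have h1 : min a b + max a b = a + b := min_add_max a b
  have h2 : min a b * max a b = a * b := min_mul_max a b
  have h3 : 0 ≤ min a b := le_min ha hb
  have h4 : 0 ≤ max a b := le_max_of_le_left ha
  have e : (s - 1 / s) / 2 * min a b + 1 / (2 * s) * (a + b) =
      (s * min a b + max a b / s) / 2 := by rw [← h1]; field_simp; ring
  rw [e, ← h2]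
  refine Real.sqrt_le_iff.2 ⟨by positivity, ?_⟩
  have h5 : s * min a b * (max a b / s) = min a b * max a b := by field_simp
  nlinarith [sq_nonneg (s * min a b - max a b / s)]

lemma sqrt_mul_ge {a b : ℝ} (ha : 0 ≤ a) (hb : 0 < b) :
    (a + b) / 2 ≤ √(a * b) + (a - b) ^ 2 / b / 2 := by
  rw [Real.sqrt_mul ha]
  have h1 := Real.sq_sqrt ha
  have h2 := Real.sq_sqrt hb.le
  have h3 := Real.sqrt_nonneg a
  have h4 := Real.sqrt_pos.2 hb
  set u := √a
  set v := √b
  rw [← h1, ← h2]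
  have h5 : (u - v) ^ 2 ≤ (u ^ 2 - v ^ 2) ^ 2 / v ^ 2 := by
    rw [le_div_iff₀ (by positivity), show (u ^ 2 - v ^ 2) ^ 2 = (u - v) ^ 2 * (u + v) ^ 2 by ring]
    gcongr
    linarith
  nlinarith

lemma tsum_sqrt_mul_le {α : Type*} {A B : α → ℝ} (hA : ∀ D, 0 ≤ A D) (hB : ∀ D, 0 ≤ B D)
    (hA1 : ∑' D, ENNReal.ofReal (A D) = 1) (hB1 : ∑' D, ENNReal.ofReal (B D) = 1) {M s : ℝ}
    (hM : ∑' D, ENNReal.ofReal (min (A D) (B D)) ≤ ENNReal.ofReal M) (hM0 : 0 ≤ M) (hs : 1 ≤ s) :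
    ∑' D, ENNReal.ofReal √(A D * B D) ≤ ENNReal.ofReal ((s - 1 / s) / 2 * M + 1 / s) := by
  have hs0 : 0 < s := by linarith
  have c1 : 0 ≤ (s - 1 / s) / 2 := by
    have : 1 / s ≤ 1 := (div_le_one hs0).2 hs
    linarith
  have c2 : 0 ≤ 1 / (2 * s) := by positivity
  calc _ ≤ ∑' D, (ENNReal.ofReal ((s - 1 / s) / 2) * ENNReal.ofReal (min (A D) (B D)) +
          ENNReal.ofReal (1 / (2 * s)) * (ENNReal.ofReal (A D) + ENNReal.ofReal (B D))) := by
        refine ENNReal.tsum_le_tsum fun D => ?_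
        have h0 : 0 ≤ min (A D) (B D) := le_min (hA D) (hB D)
        rw [← ENNReal.ofReal_add (hA D) (hB D), ← ENNReal.ofReal_mul c1, ← ENNReal.ofReal_mul c2,
          ← ENNReal.ofReal_add (mul_nonneg c1 h0) (mul_nonneg c2 (add_nonneg (hA D) (hB D)))]
        exact ENNReal.ofReal_le_ofReal (sqrt_mul_le_min (hA D) (hB D) hs0)
    _ = ENNReal.ofReal ((s - 1 / s) / 2) * (∑' D, ENNReal.ofReal (min (A D) (B D))) +
          ENNReal.ofReal (1 / (2 * s)) * (1 + 1) := by
        rw [ENNReal.tsum_add, ENNReal.tsum_mul_left, ENNReal.tsum_mul_left, ENNReal.tsum_add, hA1,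
          hB1]
    _ ≤ ENNReal.ofReal ((s - 1 / s) / 2) * ENNReal.ofReal M +
          ENNReal.ofReal (1 / (2 * s)) * (1 + 1) := by gcongr
    _ = _ := by
        have : (1 : ℝ≥0∞) + 1 = ENNReal.ofReal 2 := by norm_num
        rw [this, ← ENNReal.ofReal_mul c1, ← ENNReal.ofReal_mul c2,
          ← ENNReal.ofReal_add (mul_nonneg c1 hM0) (by positivity)]
        congr 1
        field_simp

/-- The affinity of the laws of one letter in terms of their `χ²`-divergence. -/
lemma ofReal_one_sub_le_tsum_sqrt {a b : ℕ × ℕ × ℕ → ℝ} (ha : ∀ x, 0 ≤ a x) (hb : ∀ x, 0 < b x)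
    (ha1 : ∑' x, ENNReal.ofReal (a x / fact3 x) = 1)
    (hb1 : ∑' x, ENNReal.ofReal (b x / fact3 x) = 1) {χ : ℝ} (hχ0 : 0 ≤ χ)
    (hχ : ∑' x, ENNReal.ofReal ((a x - b x) ^ 2 / b x / fact3 x) ≤ ENNReal.ofReal χ) :
    ENNReal.ofReal (1 - χ / 2) ≤ ∑' x, ENNReal.ofReal (√(a x * b x) / fact3 x) := by
  rw [ENNReal.ofReal_sub _ (by positivity), ENNReal.ofReal_one, tsub_le_iff_right]
  have half : ∀ y : ℝ, ENNReal.ofReal (y / 2) = ENNReal.ofReal (1 / 2) * ENNReal.ofReal y :=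
    fun y => by rw [← ENNReal.ofReal_mul (by norm_num)]; congr 1; ring
  have h1 : (1 : ℝ≥0∞) = ∑' x, ENNReal.ofReal ((a x + b x) / 2 / fact3 x) := by
    have e : ∀ x, ENNReal.ofReal ((a x + b x) / 2 / fact3 x) =
        ENNReal.ofReal (1 / 2) * (ENNReal.ofReal (a x / fact3 x) +
          ENNReal.ofReal (b x / fact3 x)) := by
      intro x
      rw [← ENNReal.ofReal_add (div_nonneg (ha x) (fact3_pos x).le)
        (div_nonneg (hb x).le (fact3_pos x).le), ← half]
      congr 1
      ring
    simp_rw [e]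
    rw [ENNReal.tsum_mul_left, ENNReal.tsum_add, ha1, hb1,
      show (1 : ℝ≥0∞) + 1 = ENNReal.ofReal 2 by norm_num, ← ENNReal.ofReal_mul (by norm_num)]
    norm_num
  calc (1 : ℝ≥0∞) = ∑' x, ENNReal.ofReal ((a x + b x) / 2 / fact3 x) := h1
    _ ≤ ∑' x, (ENNReal.ofReal (√(a x * b x) / fact3 x) +
          ENNReal.ofReal (1 / 2) * ENNReal.ofReal ((a x - b x) ^ 2 / b x / fact3 x)) := by
        refine ENNReal.tsum_le_tsum fun x => ?_
        have h2 := fact3_pos x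
        have h3 := hb x
        rw [← half, ← ENNReal.ofReal_add (by positivity) (by positivity)]
        refine ENNReal.ofReal_le_ofReal ?_
        have h4 := div_le_div_of_nonneg_right (sqrt_mul_ge (ha x) h3) h2.le
        refine h4.trans_eq ?_
        ring
    _ ≤ _ := by
        rw [ENNReal.tsum_add, ENNReal.tsum_mul_left, half χ]
        gcongr

/-- The affinity of two mixtures of Poissonised samples is the product of the affinities of the
letters. -/
lemma pow_le_tsum_sqrt_mixLaw {k : ℕ} {Θ : Type*} [Fintype Θ] {w : Θ → ℝ}
    {r₁ r₂ r₃ r₁' r₂' r₃' : Fin k → Θ → ℝ} (hw : ∀ θ, 0 ≤ w θ) (hw1 : ∑ θ, w θ = 1)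
    (h₁ : ∀ i θ, 0 ≤ r₁ i θ) (h₂ : ∀ i θ, 0 ≤ r₂ i θ) (h₃ : ∀ i θ, 0 ≤ r₃ i θ)
    (h₁' : ∀ i θ, 0 ≤ r₁' i θ) (h₂' : ∀ i θ, 0 ≤ r₂' i θ) (h₃' : ∀ i θ, 0 ≤ r₃' i θ)
    (hb : ∀ i x, 0 < mixWt w (r₁' i) (r₂' i) (r₃' i) x) {χ : ℝ} (hχ0 : 0 ≤ χ) (hχ1 : χ ≤ 1)
    (hχ : ∀ i, ∑' x, ENNReal.ofReal ((mixWt w (r₁ i) (r₂ i) (r₃ i) x -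
      mixWt w (r₁' i) (r₂' i) (r₃' i) x) ^ 2 / mixWt w (r₁' i) (r₂' i) (r₃' i) x / fact3 x) ≤
      ENNReal.ofReal χ) :
    ENNReal.ofReal ((1 - χ / 2) ^ k) ≤
      ∑' D, ENNReal.ofReal √(mixLaw w r₁ r₂ r₃ D * mixLaw w r₁' r₂' r₃' D) := by
  have ha : ∀ i x, 0 ≤ mixWt w (r₁ i) (r₂ i) (r₃ i) x := fun i =>
    mixWt_nonneg hw (h₁ i) (h₂ i) (h₃ i)
  have e : ∀ D, √(mixLaw w r₁ r₂ r₃ D * mixLaw w r₁' r₂' r₃' D) =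
      (∏ i, (fun i x => √(mixWt w (r₁ i) (r₂ i) (r₃ i) x * mixWt w (r₁' i) (r₂' i) (r₃' i) x)) i
        (cnt D.1.2 i, cnt D.2.1.2 i, cnt D.2.2.2 i)) / fact3 (D.1.1, D.2.1.1, D.2.2.1) := by
    intro D
    rw [mixLaw_eq_prod, mixLaw_eq_prod]
    have hf := fact3_pos (D.1.1, D.2.1.1, D.2.2.1)
    rw [← Real.sqrt_sq (div_nonneg (Finset.prod_nonneg fun _ _ => Real.sqrt_nonneg _) hf.le)]
    congr 1
    rw [div_pow, ← Finset.prod_pow,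
      Finset.prod_congr rfl fun i _ => Real.sq_sqrt (mul_nonneg (ha i _) (hb i _).le),
      Finset.prod_mul_distrib]
    ring
  have E := (tsum_congr fun D => congrArg ENNReal.ofReal (e D)).trans (tsum_three_cnt
    (g := fun i x => √(mixWt w (r₁ i) (r₂ i) (r₃ i) x * mixWt w (r₁' i) (r₂' i) (r₃' i) x))
    fun i x => Real.sqrt_nonneg _)
  rw [E, ENNReal.ofReal_pow (by linarith)]
  refine (le_of_eq ?_).trans (Finset.prod_le_prod' fun i _ =>
    ofReal_one_sub_le_tsum_sqrt (ha i) (hb i) (tsum_mixWt hw hw1 (h₁ i) (h₂ i) (h₃ i))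
      (tsum_mixWt hw hw1 (h₁' i) (h₂' i) (h₃' i)) hχ0 (hχ i))
  simp

/-- A test bounds the overlap of two mixtures of Poissonised samples: on samples that are long
enough it rejects one of the two mixtures. -/
lemma ofReal_min_le_test {ι : Type*} {n m : ℕ}
    (ψ : (Fin n → ι) × (Fin n → ι) × (Fin m → ι) → Fin 2) (a b : ℝ) (D : Seqs3 ι) :
    ENNReal.ofReal (min a b) ≤ ENNReal.ofReal a * trunc3 n m (Set.indicator {s | ψ s ≠ 0} 1) D +
      ENNReal.ofReal b * trunc3 n m (Set.indicator {s | ψ s ≠ 1} 1) D +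
      ENNReal.ofReal a * (2 ^ n * ENNReal.ofReal ((1 / 2) ^ D.1.1) +
        2 ^ n * ENNReal.ofReal ((1 / 2) ^ D.2.1.1) + 2 ^ m * ENNReal.ofReal ((1 / 2) ^ D.2.2.1)) := by
  have hlen : ∀ {j N : ℕ}, ¬ j ≤ N → 1 ≤ (2 : ℝ≥0∞) ^ j * ENNReal.ofReal ((1 / 2) ^ N) := by
    intro j N h
    rw [show (2 : ℝ≥0∞) ^ j = ENNReal.ofReal (2 ^ j) by rw [ENNReal.ofReal_pow (by norm_num)]; simp,
      ← ENNReal.ofReal_mul (by positivity), ENNReal.one_le_ofReal, one_div, inv_pow,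
      ← div_eq_mul_inv, le_div_iff₀ (by positivity), one_mul]
    exact pow_le_pow_right₀ (by norm_num) (by omega)
  have hmin : ENNReal.ofReal (min a b) ≤ ENNReal.ofReal a :=
    ENNReal.ofReal_le_ofReal (min_le_left _ _)
  have hmin' : ENNReal.ofReal (min a b) ≤ ENNReal.ofReal b :=
    ENNReal.ofReal_le_ofReal (min_le_right _ _)
  have hshort : ∀ L : ℝ≥0∞, 1 ≤ L → ENNReal.ofReal (min a b) ≤ ENNReal.ofReal a * L :=
    fun L hL => hmin.trans (le_mul_of_one_le_right zero_le hL)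
  by_cases h1 : n ≤ D.1.1
  · by_cases h2 : n ≤ D.2.1.1
    · by_cases h3 : m ≤ D.2.2.1
      · simp only [trunc3, trunc, h1, h2, h3, dif_pos]
        refine le_add_right ?_
        set s := ((fun j => D.1.2 (Fin.castLE h1 j)), (fun j => D.2.1.2 (Fin.castLE h2 j)),
          (fun j => D.2.2.2 (Fin.castLE h3 j)))
        rcases Fin.exists_fin_two.1 ⟨ψ s, rfl⟩ with h | h
        · refine le_add_left ?_
          rw [Set.indicator_of_mem (by simp [h]), Pi.one_apply, mul_one]
          exact hmin'
        · refine le_add_right ?_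
          rw [Set.indicator_of_mem (by simp [h]), Pi.one_apply, mul_one]
          exact hmin
      · exact le_add_left (hshort _ (le_add_left (hlen h3)))
    · exact le_add_left (hshort _ (le_add_right (le_add_left (hlen h2))))
  · exact le_add_left (hshort _ (le_add_right (le_add_right (hlen h1))))

lemma indicator_trunc3_le_one {ι : Type*} {n m : ℕ}
    (S : Set ((Fin n → ι) × (Fin n → ι) × (Fin m → ι))) (D : Seqs3 ι) :
    trunc3 n m (S.indicator 1) D ≤ 1 := by
  unfold trunc3 trunc
  split_ifs <;> first | exact zero_le | exact Set.indicator_le_self' (fun _ _ => zero_le) _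

/-! ### Typical configurations of the letters -/

/-- A Chernoff bound for the number of letters in a given state. -/
lemma sum_prod_wt_card_gt_le {ι Θ : Type*} [Fintype ι] [DecidableEq ι] [Fintype Θ]
    [DecidableEq Θ] {w : Θ → ℝ} (hw : ∀ θ, 0 ≤ w θ) (hw1 : ∑ θ, w θ = 1) (j : Θ) {l : ℝ}
    (hl : 0 ≤ l) (y : ℝ) :
    ∑ θ : ι → Θ with y < (Finset.univ.filter fun i => θ i = j).card, ∏ i, w (θ i) ≤
      Real.exp (Fintype.card ι * (Real.exp l * w j) - l * y) := by
  have hW : ∀ θ : ι → Θ, 0 ≤ ∏ i, w (θ i) := fun θ => Finset.prod_nonneg fun _ _ => hw _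
  have hone : ∑ θ, w θ * (if θ = j then Real.exp l else 1) ≤ Real.exp (Real.exp l * w j) := by
    have e : ∀ θ, w θ * (if θ = j then Real.exp l else 1) =
        w θ + if θ = j then w j * (Real.exp l - 1) else 0 := by
      intro θ
      split_ifs with h
      · rw [h]; ring
      · ring
    simp_rw [e]
    rw [Finset.sum_add_distrib, hw1, Finset.sum_ite_eq' Finset.univ j, if_pos (Finset.mem_univ _)]
    have := Real.add_one_le_exp (Real.exp l * w j)
    nlinarith [hw j]
  calc _ ≤ ∑ θ : ι → Θ with y < (Finset.univ.filter fun i => θ i = j).card,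
          Real.exp (-(l * y)) * ∏ i, (w (θ i) * if θ i = j then Real.exp l else 1) := by
        refine Finset.sum_le_sum fun θ hθ => ?_
        rw [Finset.prod_mul_distrib, Finset.prod_ite, Finset.prod_const, Finset.prod_const_one,
          mul_one, ← Real.exp_nat_mul, mul_left_comm, ← Real.exp_add]
        refine le_mul_of_one_le_right (hW θ) (Real.one_le_exp ?_)
        have := (Finset.mem_filter.1 hθ).2
        nlinarith
    _ ≤ ∑ θ : ι → Θ,
          Real.exp (-(l * y)) * ∏ i, (w (θ i) * if θ i = j then Real.exp l else 1) := by
        refine Finset.sum_le_sum_of_subset_of_nonneg (Finset.filter_subset _ _) fun θ _ _ => ?_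
        refine mul_nonneg (Real.exp_pos _).le (Finset.prod_nonneg fun i _ =>
          mul_nonneg (hw _) ?_)
        split_ifs
        · exact (Real.exp_pos _).le
        · norm_num
    _ = Real.exp (-(l * y)) *
          (∑ θ, w θ * (if θ = j then Real.exp l else 1)) ^ Fintype.card ι := by
        rw [← Finset.mul_sum]
        have := Finset.prod_univ_sum (fun _ : ι => (Finset.univ : Finset Θ))
          (fun _ θ => w θ * if θ = j then Real.exp l else 1)
        rw [Fintype.piFinset_univ] at this
        rw [← this, Finset.prod_const, Finset.card_univ]
    _ ≤ Real.exp (-(l * y)) * Real.exp (Real.exp l * w j) ^ Fintype.card ι := by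
        gcongr
        refine Finset.sum_nonneg fun θ _ => mul_nonneg (hw θ) ?_
        split_ifs
        · exact (Real.exp_pos _).le
        · norm_num
    _ = _ := by
        rw [← Real.exp_nat_mul, ← Real.exp_add]
        congr 1
        ring

/-- The value attached to the letter `i` in state `θ`: the distinguished letter `i₀` always has
value `1`, so that the total mass is at least `1`; the other letters have value `v θ`. -/
def letVal {k : ℕ} (i₀ : Fin k) (v : Fin 3 → ℝ) (i : Fin k) (θ : Fin 3) : ℝ :=
  if i = i₀ then 1 else v θ

lemma letVal_nonneg {k : ℕ} (i₀ : Fin k) {v : Fin 3 → ℝ} (hv : ∀ θ, 0 ≤ v θ) (i : Fin k)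
    (θ : Fin 3) : 0 ≤ letVal i₀ v i θ := by
  unfold letVal
  split_ifs
  · norm_num
  · exact hv θ

lemma one_le_sum_letVal {k : ℕ} (i₀ : Fin k) {v : Fin 3 → ℝ} (hv : ∀ θ, 0 ≤ v θ)
    (θ : Fin k → Fin 3) : 1 ≤ ∑ i, letVal i₀ v i (θ i) := by
  have := Finset.single_le_sum (f := fun i => letVal i₀ v i (θ i))
    (fun i _ => letVal_nonneg i₀ hv i (θ i)) (Finset.mem_univ i₀)
  simpa [letVal] using this

/-- The set of letters in state `j`. -/
def inState {k : ℕ} (θ : Fin k → Fin 3) (j : Fin 3) : Finset (Fin k) :=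
  Finset.univ.filter fun i => θ i = j

/-- In a configuration with few heavy letters and few light letters with `q > 0`, the letters with
`q = 0` witness that the normalised distributions are separated in total variation. -/
lemma le_tvDist_normLaw {k : ℕ} (hk : 2 ≤ k) (i₀ : Fin k) {a b t ε ε₀ κ x : ℝ} (ha : 0 ≤ a)
    (hb : 0 ≤ b) (hε : 0 < ε) (hε₀ : ε ≤ ε₀) (hε₁ : ε₀ < 1)
    (hbk : b * k = κ * ε) (hκ : κ * (1 - ε₀) = 16) (hx : x = (1 - ε₀) / 8) (θ : Fin k → Fin 3)
    (h0 : ((inState θ 0).card : ℝ) ≤ x * k) (h0a : (inState θ 0).card * a ≤ 1)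
    (h1 : ((inState θ 1).card : ℝ) ≤ x * k)
    (hp : ∀ i, 0 ≤ letVal i₀ (stP a b) i (θ i)) (hP : 0 < ∑ i, letVal i₀ (stP a b) i (θ i))
    (hq : ∀ i, 0 ≤ letVal i₀ (stQ a b t) i (θ i)) (hQ : 0 < ∑ i, letVal i₀ (stQ a b t) i (θ i)) :
    ε ≤ tvDist (normLaw _ hp hP : Measure (Fin k)) (normLaw _ hq hQ : Measure (Fin k)) := by
  classical
  set A := (inState θ 2).erase i₀ with hA
  have hAmem : ∀ i ∈ A, i ≠ i₀ ∧ θ i = 2 := by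
    intro i hi
    rw [hA, Finset.mem_erase, inState, Finset.mem_filter] at hi
    exact ⟨hi.1, hi.2.2⟩
  have hpA : ∑ i ∈ A, letVal i₀ (stP a b) i (θ i) = A.card * b := by
    rw [← nsmul_eq_mul, ← Finset.sum_const]
    refine Finset.sum_congr rfl fun i hi => ?_
    obtain ⟨h, h'⟩ := hAmem i hi
    simp [letVal, h, h', stP]
  have hqA : ∑ i ∈ A, letVal i₀ (stQ a b t) i (θ i) = 0 := by
    refine Finset.sum_eq_zero fun i hi => ?_
    obtain ⟨h, h'⟩ := hAmem i hi
    simp [letVal, h, h', stQ]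
  have htv := abs_sub_le_tvDist (normLaw _ hp hP : Measure (Fin k))
    (normLaw _ hq hQ : Measure (Fin k)) (A := (A : Set (Fin k))) (MeasurableSet.of_discrete)
  rw [normLaw_real, normLaw_real, hpA, hqA, zero_div, sub_zero] at htv
  refine le_trans ?_ ((le_abs_self _).trans htv)
  rw [le_div_iff₀ hP]
  -- The total mass of `p`, letter by letter.
  have hsum : ∑ i, letVal i₀ (stP a b) i (θ i) ≤
      1 + (inState θ 0).card * a + (inState θ 1).card * b + A.card * b := by
    have hpt : ∀ i, letVal i₀ (stP a b) i (θ i) ≤ (if i = i₀ then 1 else 0) +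
        (if i ∈ inState θ 0 then a else 0) + (if i ∈ inState θ 1 then b else 0) +
        (if i ∈ A then b else 0) := by
      intro i
      have hA' : i ∈ A ↔ i ≠ i₀ ∧ θ i = 2 := by simp [hA, inState]
      simp only [hA', inState, Finset.mem_filter, Finset.mem_univ, true_and, letVal]
      by_cases h : i = i₀
      · simp only [h, if_true, ne_eq, not_true_eq_false, false_and, if_false]
        split_ifs <;> linarith
      · generalize θ i = j
        fin_cases j <;> simp [h, stP]
    refine (Finset.sum_le_sum fun i _ => hpt i).trans_eq ?_
    simp only [Finset.sum_add_distrib, Finset.sum_ite_eq', Finset.mem_univ, if_true,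
      Finset.sum_ite_mem, Finset.univ_inter, Finset.sum_const, nsmul_eq_mul]
  have hcard : (k : ℝ) ≤ (inState θ 0).card + (inState θ 1).card + A.card + 1 := by
    have hcov : (Finset.univ : Finset (Fin k)) ⊆ inState θ 0 ∪ inState θ 1 ∪ insert i₀ A := by
      intro i _
      simp only [hA, inState, Finset.mem_union, Finset.mem_filter, Finset.mem_univ, true_and,
        Finset.mem_insert, Finset.mem_erase]
      generalize θ i = j
      fin_cases j <;> simp [em]
    have h := Finset.card_le_card hcov
    rw [Finset.card_univ, Fintype.card_fin] at h
    have h2 := Finset.card_union_le (inState θ 0 ∪ inState θ 1) (insert i₀ A)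
    have h3 := Finset.card_union_le (inState θ 0) (inState θ 1)
    have h4 := Finset.card_insert_le i₀ A
    exact_mod_cast (by omega : k ≤ (inState θ 0).card + (inState θ 1).card + A.card + 1)
  have hk' : (2 : ℝ) ≤ k := by exact_mod_cast hk
  have hx8 : x ≤ 1 / 8 := by rw [hx]; linarith
  have hA4 : (k : ℝ) / 4 ≤ A.card := by nlinarith
  have hκ0 : 0 < κ := by
    by_contra h
    have : κ * (1 - ε₀) ≤ 0 := mul_nonpos_of_nonpos_of_nonneg (not_lt.1 h) (by linarith)
    linarith
  have hAb : κ * ε / 4 ≤ A.card * b := by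
    have := mul_le_mul_of_nonneg_right hA4 hb
    linarith
  have h1b : (inState θ 1).card * b ≤ 2 * ε := by
    have h := mul_le_mul_of_nonneg_right h1 hb
    have : x * k * b = 2 * ε := by
      rw [mul_assoc, mul_comm (k : ℝ) b, hbk, hx,
        show (1 - ε₀) / 8 * (κ * ε) = κ * (1 - ε₀) * ε / 8 by ring, hκ]
      ring
    linarith
  have hlow : 4 * ε ≤ (1 - ε) * (A.card * b) := by
    have h2 : (1 - ε₀) * (κ * ε / 4) ≤ (1 - ε) * (A.card * b) :=
      mul_le_mul (by linarith) hAb (by positivity) (by linarith)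
    have h3 : (1 - ε₀) * (κ * ε / 4) = 4 * ε := by
      rw [show (1 - ε₀) * (κ * ε / 4) = κ * (1 - ε₀) * ε / 4 by ring, hκ]; ring
    linarith
  nlinarith [mul_le_mul_of_nonneg_left hsum hε.le]

/-! ### Elementary necessary sample sizes -/

/-- A lower bound on probabilities of events, from the samples `X` and `Z` that consist of the
letter `i₀` only. -/
lemma le_sampleLaw {k n m : ℕ} (PX PY PZ : ProbabilityMeasure (Fin k)) (i₀ : Fin k)
    (S : Set ((Fin n → Fin k) × (Fin n → Fin k) × (Fin m → Fin k))) :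
    (PX : Measure (Fin k)) {i₀} ^ n * ∑ y : Fin n → Fin k, (∏ j, (PY : Measure (Fin k)) {y j}) *
      ((PZ : Measure (Fin k)) {i₀} ^ m * S.indicator 1 (fun _ => i₀, y, fun _ => i₀)) ≤
      sampleLaw PX PY PZ n m S := by
  rw [sampleLaw_apply]
  refine le_trans ?_ (Finset.single_le_sum (f := fun x : Fin n → Fin k =>
    (∏ j, (PX : Measure (Fin k)) {x j}) * ∑ y : Fin n → Fin k,
      (∏ j, (PY : Measure (Fin k)) {y j}) * ∑ z : Fin m → Fin k,
        (∏ j, (PZ : Measure (Fin k)) {z j}) * S.indicator 1 (x, y, z))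
    (fun _ _ => zero_le) (Finset.mem_univ fun _ => i₀))
  simp only [Finset.prod_const, Finset.card_univ, Fintype.card_fin]
  gcongr with y
  refine le_trans ?_ (Finset.single_le_sum (f := fun z : Fin m → Fin k =>
        (∏ j, (PZ : Measure (Fin k)) {z j}) * S.indicator 1 (fun _ => i₀, y, z))
    (fun _ _ => zero_le) (Finset.mem_univ fun _ => i₀))
  simp

lemma sum_prod_singleton {k n : ℕ} (P : ProbabilityMeasure (Fin k)) :
    ∑ y : Fin n → Fin k, ∏ j, (P : Measure (Fin k)) {y j} = 1 := by
  refine (Fintype.sum_pow (fun i => (P : Measure (Fin k)) {i}) n).symm.trans ?_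
  rw [sum_measure_singleton]
  simp

/-- A point mass and a distribution at distance `ε₀` from it cannot be told apart on samples that
consist of the common letter only; hence both sample sizes are at least logarithmic in `1 / δ`. -/
lemma one_sub_pow_le_of_testable {k n m : ℕ} {ε ε₀ δ : ℝ} (hk : 2 ≤ k) (hε₀ : 0 < ε₀)
    (hε : ε ≤ ε₀) (hε₁ : ε₀ < 1) (hT : Testable (allDistributions k) ε δ n m) :
    (1 - ε₀) ^ n ≤ 2 * δ ∧ (1 - ε₀) ^ m ≤ 2 * δ := by
  classical
  obtain ⟨ψ, -, hψ⟩ := hT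
  set i₀ : Fin k := ⟨0, by omega⟩
  set i₁ : Fin k := ⟨1, by omega⟩
  have h01 : i₁ ≠ i₀ := by simp [i₀, i₁]
  set p : Fin k → ℝ := fun i => if i = i₀ then 1 else 0 with hp
  set q : Fin k → ℝ := fun i => if i = i₀ then 1 - ε₀ else if i = i₁ then ε₀ else 0 with hq
  have hp0 : ∀ i, 0 ≤ p i := fun i => by simp only [hp]; split_ifs <;> norm_num
  have hq0 : ∀ i, 0 ≤ q i := fun i => by simp only [hq]; split_ifs <;> linarith
  have hp1 : ∑ i, p i = 1 := by simp [hp]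
  have hq1 : ∑ i, q i = 1 := by
    have : ∀ i, q i = (if i = i₀ then 1 - ε₀ else 0) + if i = i₁ then ε₀ else 0 := by
      intro i
      simp only [hq]
      by_cases h : i = i₀
      · simp [h, h01.symm]
      · simp [h]
    simp_rw [this]
    rw [Finset.sum_add_distrib]
    simp
  set P := normLaw p hp0 (by rw [hp1]; norm_num) with hPdef
  set Q := normLaw q hq0 (by rw [hq1]; norm_num) with hQdef
  have hP0 : (P : Measure (Fin k)) {i₀} = 1 := by
    rw [hPdef, normLaw_singleton, hp1]; simp [hp]
  have hQ0 : (Q : Measure (Fin k)) {i₀} = ENNReal.ofReal (1 - ε₀) := by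
    rw [hQdef, normLaw_singleton, hq1]; simp [hq]
  have htv : ε ≤ tvDist (P : Measure (Fin k)) (Q : Measure (Fin k)) := by
    refine hε.trans (le_trans ?_ (abs_sub_le_tvDist (P : Measure (Fin k)) (Q : Measure (Fin k))
      (A := (({i₁} : Finset (Fin k)) : Set (Fin k))) MeasurableSet.of_discrete))
    rw [hPdef, hQdef, normLaw_real, normLaw_real, hp1, hq1]
    simp [hp, hq, h01, h01.symm, abs_of_pos hε₀]
  obtain ⟨hA0, hA1⟩ := hψ P trivial Q trivial htv
  obtain ⟨-, hB1⟩ := hψ Q trivial P trivial (by rwa [tvDist_comm])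
  have hδ0 : 0 ≤ δ := measureReal_nonneg.trans hA0
  have L0 := (le_sampleLaw P Q P i₀ _).trans (measure_le_ofReal_of_real_le hA0)
  have L1 := (le_sampleLaw P Q Q i₀ _).trans (measure_le_ofReal_of_real_le hA1)
  have L2 := (le_sampleLaw Q P P i₀ _).trans (measure_le_ofReal_of_real_le hB1)
  simp only [hP0, hQ0, one_pow, one_mul, ← ENNReal.ofReal_pow (sub_pos.2 hε₁).le] at L0 L1 L2
  have hn1 : ENNReal.ofReal ((1 - ε₀) ^ n) ≤ ENNReal.ofReal δ := by
    rcases Fin.exists_fin_two.1 ⟨ψ (fun _ => i₀, fun _ => i₀, fun _ => i₀), rfl⟩ with h | h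
    · refine le_trans ?_ L2
      refine le_mul_of_one_le_right zero_le ?_
      refine le_trans ?_ (Finset.single_le_sum (fun _ _ => zero_le)
        (Finset.mem_univ fun _ => i₀))
      rw [Set.indicator_of_mem (by simp [h])]
      simp [hP0]
    · refine le_trans ?_ L0
      refine le_trans ?_ (Finset.single_le_sum (fun _ _ => zero_le)
        (Finset.mem_univ fun _ => i₀))
      rw [Set.indicator_of_mem (by simp [h])]
      simp [hQ0, ENNReal.ofReal_pow (sub_pos.2 hε₁).le]
  have hm1 : ENNReal.ofReal ((1 - ε₀) ^ m) ≤ ENNReal.ofReal (δ + δ) := by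
    have hc1 : ENNReal.ofReal ((1 - ε₀) ^ m) ≤ 1 := by
      rw [ENNReal.ofReal_le_one]
      exact pow_le_one₀ (by linarith) (by linarith)
    rw [ENNReal.ofReal_add hδ0 hδ0]
    refine le_trans ?_ (add_le_add L0 L1)
    rw [← Finset.sum_add_distrib]
    calc _ = ∑ y : Fin n → Fin k, (∏ j, (Q : Measure (Fin k)) {y j}) *
          ENNReal.ofReal ((1 - ε₀) ^ m) := by rw [← Finset.sum_mul, sum_prod_singleton, one_mul]
      _ ≤ _ := by
        refine Finset.sum_le_sum fun y _ => ?_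
        rw [← mul_add]
        gcongr
        rcases Fin.exists_fin_two.1 ⟨ψ (fun _ => i₀, y, fun _ => i₀), rfl⟩ with h | h
        · refine le_add_left ?_
          rw [Set.indicator_of_mem (by simp [h])]
          simp
        · refine le_add_right ?_
          rw [Set.indicator_of_mem (by simp [h])]
          simpa using hc1
  rw [ENNReal.ofReal_le_ofReal_iff hδ0] at hn1
  rw [ENNReal.ofReal_le_ofReal_iff (by linarith)] at hm1
  constructor <;> linarith

/-! ### The lower bound for likelihood-free hypothesis testing -/

/-- A test for fixed sample sizes limits the affinity of any two mixtures of Poissonised samples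
that typically consist of instances of the two hypotheses; here `G` is the set of typical
configurations and `γ` bounds the probability that a Poissonised sample is too short. -/
lemma pow_one_sub_le_of_testable {k n m : ℕ} {ε δ : ℝ} (hδ : 0 ≤ δ)
    (hT : Testable (allDistributions k) ε δ n m) {w : Fin 3 → ℝ} (hw : ∀ θ, 0 ≤ w θ)
    (hw1 : ∑ θ, w θ = 1) {pA qA pB qB : Fin k → Fin 3 → ℝ} (hpA : ∀ i θ, 0 ≤ pA i θ)
    (hqA : ∀ i θ, 0 ≤ qA i θ) (hpB : ∀ i θ, 0 ≤ pB i θ) (hqB : ∀ i θ, 0 ≤ qB i θ)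
    (spA : ∀ θ : Fin k → Fin 3, 1 ≤ ∑ i, pA i (θ i))
    (sqA : ∀ θ : Fin k → Fin 3, 1 ≤ ∑ i, qA i (θ i))
    (spB : ∀ θ : Fin k → Fin 3, 1 ≤ ∑ i, pB i (θ i))
    (sqB : ∀ θ : Fin k → Fin 3, 1 ≤ ∑ i, qB i (θ i))
    (G : Set (Fin k → Fin 3)) [DecidablePred (· ∈ G)] {β : ℝ}
    (hβ : ∑ θ : Fin k → Fin 3 with θ ∉ G, ∏ i, w (θ i) ≤ β)
    (tvA : ∀ θ ∈ G, ε ≤ tvDist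
      (normLaw _ (fun i => hpA i (θ i)) (one_pos.trans_le (spA θ)) : Measure (Fin k))
      (normLaw _ (fun i => hqA i (θ i)) (one_pos.trans_le (sqA θ)) : Measure (Fin k)))
    (tvB : ∀ θ ∈ G, ε ≤ tvDist
      (normLaw _ (fun i => hpB i (θ i)) (one_pos.trans_le (spB θ)) : Measure (Fin k))
      (normLaw _ (fun i => hqB i (θ i)) (one_pos.trans_le (sqB θ)) : Measure (Fin k)))
    {N M : ℝ} (hN : 0 < N) (hM : 0 < M) {γ : ℝ}
    (hγ : 2 * (2 ^ n * Real.exp (-N / 2)) + 2 ^ m * Real.exp (-M / 2) ≤ γ)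
    (hpos : ∀ i x, 0 < mixWt w (fun θ => N * pB i θ) (fun θ => N * qB i θ)
      (fun θ => M * qB i θ) x) {χ : ℝ} (hχ0 : 0 ≤ χ) (hχ1 : χ ≤ 1)
    (hχ : ∀ i, ∑' x, ENNReal.ofReal ((
      mixWt w (fun θ => N * pA i θ) (fun θ => N * qA i θ) (fun θ => M * pA i θ) x -
      mixWt w (fun θ => N * pB i θ) (fun θ => N * qB i θ) (fun θ => M * qB i θ) x) ^ 2 /
      mixWt w (fun θ => N * pB i θ) (fun θ => N * qB i θ) (fun θ => M * qB i θ) x / fact3 x) ≤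
      ENNReal.ofReal χ) {s : ℝ} (hs : 1 ≤ s) :
    (1 - χ / 2) ^ k ≤ (s - 1 / s) / 2 * (2 * (δ + β) + γ) + 1 / s := by
  obtain ⟨ψ, -, hψ⟩ := hT
  have hNn : ∀ {p : Fin k → Fin 3 → ℝ}, (∀ i θ, 0 ≤ p i θ) → ∀ i θ, 0 ≤ N * p i θ :=
    fun h i θ => mul_nonneg hN.le (h i θ)
  have hMn : ∀ {p : Fin k → Fin 3 → ℝ}, (∀ i θ, 0 ≤ p i θ) → ∀ i θ, 0 ≤ M * p i θ :=
    fun h i θ => mul_nonneg hM.le (h i θ)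
  have hNs : ∀ {p : Fin k → Fin 3 → ℝ}, (∀ θ : Fin k → Fin 3, 1 ≤ ∑ i, p i (θ i)) →
      ∀ θ : Fin k → Fin 3, N ≤ ∑ i, N * p i (θ i) := fun h θ => by
    rw [← Finset.mul_sum]; exact le_mul_of_one_le_right hN.le (h θ)
  have hMs : ∀ {p : Fin k → Fin 3 → ℝ}, (∀ θ : Fin k → Fin 3, 1 ≤ ∑ i, p i (θ i)) →
      ∀ θ : Fin k → Fin 3, M ≤ ∑ i, M * p i (θ i) := fun h θ => by
    rw [← Finset.mul_sum]; exact le_mul_of_one_le_right hM.le (h θ)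
  set A := mixLaw w (fun i θ => N * pA i θ) (fun i θ => N * qA i θ) (fun i θ => M * pA i θ)
  set B := mixLaw w (fun i θ => N * pB i θ) (fun i θ => N * qB i θ) (fun i θ => M * qB i θ)
  have hβ0 : 0 ≤ β :=
    (Finset.sum_nonneg fun θ _ => Finset.prod_nonneg fun _ _ => hw _).trans hβ
  have hγ0 : 0 ≤ γ := le_trans (by positivity) hγ
  have e0 := tsum_mixLaw_mul_le (r₁ := fun i θ => N * pA i θ) (r₂ := fun i θ => N * qA i θ)
    (r₃ := fun i θ => M * pA i θ) hw hw1 (hNn hpA) (hNn hqA) (hMn hpA)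
    (indicator_trunc3_le_one {s | ψ s ≠ 0}) G hβ hδ fun θ hθ =>
      (tsum_seqWt3_indicator_le (fun i => hpA i (θ i)) (fun i => hqA i (θ i))
        (fun i => hpA i (θ i)) (one_pos.trans_le (spA θ)) (one_pos.trans_le (sqA θ))
        (one_pos.trans_le (spA θ)) _ hN hN hM).trans
        (measure_le_ofReal_of_real_le (hψ _ trivial _ trivial (tvA θ hθ)).1)
  have e1 := tsum_mixLaw_mul_le (r₁ := fun i θ => N * pB i θ) (r₂ := fun i θ => N * qB i θ)
    (r₃ := fun i θ => M * qB i θ) hw hw1 (hNn hpB) (hNn hqB) (hMn hqB)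
    (indicator_trunc3_le_one {s | ψ s ≠ 1}) G hβ hδ fun θ hθ =>
      (tsum_seqWt3_indicator_le (fun i => hpB i (θ i)) (fun i => hqB i (θ i))
        (fun i => hqB i (θ i)) (one_pos.trans_le (spB θ)) (one_pos.trans_le (sqB θ))
        (one_pos.trans_le (sqB θ)) _ hN hN hM).trans
        (measure_le_ofReal_of_real_le (hψ _ trivial _ trivial (tvB θ hθ)).2)
  have e2 := (tsum_mixLaw_short_le (n := n) (m := m) hw hw1 (hNn hpA) (hNn hqA) (hMn hpA)
    (hNs spA) (hNs sqA) (hMs spA)).trans (ENNReal.ofReal_le_ofReal hγ)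
  have hmin : ∑' D, ENNReal.ofReal (min (A D) (B D)) ≤ ENNReal.ofReal (2 * (δ + β) + γ) := by
    refine (ENNReal.tsum_le_tsum fun D => ofReal_min_le_test ψ (A D) (B D) D).trans ?_
    rw [ENNReal.tsum_add, ENNReal.tsum_add, two_mul, ENNReal.ofReal_add (by positivity) hγ0,
      ENNReal.ofReal_add (by positivity) (by positivity)]
    exact add_le_add (add_le_add e0 e1) e2
  have hup := tsum_sqrt_mul_le (mixLaw_nonneg hw (hNn hpA) (hNn hqA) (hMn hpA))
    (mixLaw_nonneg hw (hNn hpB) (hNn hqB) (hMn hqB))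
    (tsum_mixLaw hw hw1 (hNn hpA) (hNn hqA) (hMn hpA))
    (tsum_mixLaw hw hw1 (hNn hpB) (hNn hqB) (hMn hqB)) hmin (by positivity) hs
  have hlow := pow_le_tsum_sqrt_mixLaw hw hw1 (hNn hpA) (hNn hqA) (hMn hpA) (hNn hpB) (hNn hqB)
    (hMn hqB) hpos hχ0 hχ1 hχ
  have hs1 : 1 / s ≤ 1 := (div_le_one (by linarith)).2 hs
  have hM0 : 0 ≤ 2 * (δ + β) + γ := by positivity
  have := mul_nonneg (by linarith : 0 ≤ (s - 1 / s) / 2) hM0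
  exact (ENNReal.ofReal_le_ofReal_iff (by positivity)).1 (hlow.trans hup)

/-- The bound on the affinity, optimised over `s`, in logarithmic form. -/
lemma neg_log_le_of_forall_pow_le {k : ℕ} {M χ : ℝ} (hM0 : 0 < M) (hM1 : M < 1) (hχ0 : 0 ≤ χ)
    (hχ1 : χ ≤ 1) (h : ∀ s : ℝ, 1 ≤ s → (1 - χ / 2) ^ k ≤ (s - 1 / s) / 2 * M + 1 / s) :
    -Real.log (M * (2 - M)) ≤ 2 * (k * χ) := by
  set u := √M
  set v := √(2 - M)
  have hu0 : 0 < u := Real.sqrt_pos.2 hM0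
  have hv0 : 0 < v := Real.sqrt_pos.2 (by linarith)
  have hu2 : u ^ 2 = M := Real.sq_sqrt hM0.le
  have hv2 : v ^ 2 = 2 - M := Real.sq_sqrt (by linarith)
  -- The minimiser is `s = √((2 - M) / M)`.
  have hs : 1 ≤ v / u := by
    rw [le_div_iff₀ hu0, one_mul]
    exact Real.sqrt_le_sqrt (by linarith)
  have h1 := h _ hs
  have e : (v / u - 1 / (v / u)) / 2 * M + 1 / (v / u) = u * v := by
    rw [← hu2]
    have h2 : v ^ 2 = 2 - u ^ 2 := by rw [hu2, hv2]
    field_simp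
    linear_combination (-1 : ℝ) * h2
  rw [e] at h1
  have h2 : Real.exp (-(k * χ)) ≤ (1 - χ / 2) ^ k := by
    have h3 : Real.exp (-χ) ≤ 1 - χ / 2 := by
      have h4 := abs_le.1 (abs_exp_neg_sub_one_add_le hχ0)
      nlinarith
    calc _ = Real.exp (-χ) ^ k := by rw [← Real.exp_nat_mul]; congr 1; ring
      _ ≤ _ := pow_le_pow_left₀ (Real.exp_pos _).le h3 k
  have h3 := Real.log_le_log (Real.exp_pos _) (h2.trans h1)
  rw [Real.log_exp] at h3
  have h4 : Real.log (M * (2 - M)) = 2 * Real.log (u * v) := by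
    rw [← hv2, ← hu2, ← mul_pow, Real.log_pow]
    norm_num
  linarith

/-- A positive lower bound `c` and a lower bound `L - g` for `l` combine into a multiplicative one;
this absorbs additive constants without distinguishing small and large `L`. -/
lemma le_mul_one_add_div {L l c g : ℝ} (hc : 0 < c) (hg : 0 ≤ g) (h1 : c ≤ l) (h2 : L - g ≤ l) :
    L ≤ l * (1 + g / c) := by
  have : g ≤ l * (g / c) := by
    rw [mul_div_assoc', le_div_iff₀ hc, mul_comm g c]
    exact mul_le_mul_of_nonneg_right h1 hg
  linarith

/-- Overlap bounded by `3δ` and away from `1` makes the logarithmic affinity of order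
`log (1 / δ)`. -/
lemma log_inv_le_mul_neg_log {δ M c : ℝ} (hδ : 0 < δ) (hM0 : 0 < M) (hM3 : M ≤ 3 * δ)
    (hc : 0 < c) (hM1 : M ≤ 1 - c) :
    Real.log (1 / δ) ≤ -Real.log (M * (2 - M)) * (1 + Real.log 6 / c ^ 2) := by
  have hpos : 0 < M * (2 - M) := mul_pos hM0 (by linarith)
  refine le_mul_one_add_div (by positivity) (Real.log_nonneg (by norm_num)) ?_ ?_
  · have := Real.log_le_sub_one_of_pos hpos
    nlinarith
  · have h1 : M * (2 - M) ≤ 6 * δ := by nlinarith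
    have h2 := Real.log_le_log hpos h1
    rw [Real.log_mul (by norm_num) hδ.ne'] at h2
    rw [one_div, Real.log_inv]
    linarith

lemma log_inv_le_mul_of_pow_le {ε₀ δ δ₀ : ℝ} {n : ℕ} (hε₁ : ε₀ < 1) (hδ : 0 < δ) (hδ₀ : δ ≤ δ₀)
    (hδ₁ : δ₀ < 1 / 2) (h : (1 - ε₀) ^ n ≤ 2 * δ) :
    Real.log (1 / δ) ≤ n * (-Real.log (1 - ε₀) * (1 + Real.log 2 / -Real.log (2 * δ₀))) := by
  have hpos : 0 < (1 - ε₀) ^ n := pow_pos (by linarith) n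
  have h1 := Real.log_le_log hpos h
  rw [Real.log_pow] at h1
  have h2 : Real.log (2 * δ) ≤ Real.log (2 * δ₀) := Real.log_le_log (by linarith) (by linarith)
  have h3 : Real.log (2 * δ₀) < 0 := Real.log_neg (by linarith) (by linarith)
  have h4 : Real.log (2 * δ) = Real.log 2 + Real.log δ := Real.log_mul (by norm_num) hδ.ne'
  rw [← mul_assoc]
  refine le_mul_one_add_div (by linarith) (Real.log_nonneg (by norm_num)) (by linarith) ?_
  rw [one_div, Real.log_inv]
  linarith

/-- The probability of an atypical configuration: too many heavy letters, or too many light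
letters with `q > 0`. -/
lemma sum_atypical_le {k : ℕ} {r l x X : ℝ} (hk : 0 < k) (hr0 : 0 < r) (hrk : r ≤ k) (hl : 0 ≤ l)
    (hlx : l * x = X + 1) (hX : 0 ≤ X) (G : Set (Fin k → Fin 3)) [DecidablePred (· ∈ G)]
    (hG : ∀ θ, ((inState θ 0).card : ℝ) ≤ x * r → ((inState θ 1).card : ℝ) ≤ x * k → θ ∈ G) :
    ∑ θ : Fin k → Fin 3 with θ ∉ G, ∏ i, stWt (Real.exp (-l) * (r / k)) (Real.exp (-l)) (θ i) ≤
      2 * Real.exp (-(r * X)) := by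
  classical
  have hk0 : (0 : ℝ) < k := by exact_mod_cast hk
  have he1 : Real.exp (-l) ≤ 1 := Real.exp_le_one_iff.2 (by linarith)
  have he0 := Real.exp_pos (-l)
  have hrk1 : r / k ≤ 1 := (div_le_one hk0).2 hrk
  have hrk0 : 0 < r / k := by positivity
  have hw0 : 0 ≤ Real.exp (-l) * (r / k) := by positivity
  have hw1 : Real.exp (-l) * (r / k) ≤ 1 := by nlinarith
  have hwn := stWt_nonneg hw0 hw1 he0.le he1
  have hee : Real.exp l * Real.exp (-l) = 1 := by rw [← Real.exp_add]; simp
  set w := stWt (Real.exp (-l) * (r / k)) (Real.exp (-l)) with hw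
  have c0 := sum_prod_wt_card_gt_le (ι := Fin k) hwn (sum_stWt _ _) 0 hl (x * r)
  have c1 := sum_prod_wt_card_gt_le (ι := Fin k) hwn (sum_stWt _ _) 1 hl (x * k)
  rw [Fintype.card_fin] at c0 c1
  have d0 : Real.exp (k * (Real.exp l * w 0) - l * (x * r)) ≤ Real.exp (-(r * X)) := by
    refine Real.exp_le_exp.2 ?_
    have : (k : ℝ) * (Real.exp l * w 0) = r := by
      simp only [hw, stWt, Matrix.cons_val_zero]
      rw [← mul_assoc (Real.exp l), hee]
      field_simp
    rw [this, ← mul_assoc, hlx]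
    linarith
  have d1 : Real.exp (k * (Real.exp l * w 1) - l * (x * k)) ≤ Real.exp (-(r * X)) := by
    refine Real.exp_le_exp.2 ?_
    have h1 : Real.exp l * w 1 ≤ 1 := by
      simp only [hw, stWt, Matrix.cons_val_one, Matrix.cons_val_zero]
      rw [mul_left_comm, hee]
      linarith
    rw [← mul_assoc l, hlx]
    nlinarith
  have hP : ∀ θ : Fin k → Fin 3, 0 ≤ ∏ i, w (θ i) := fun θ =>
    Finset.prod_nonneg fun _ _ => hwn _
  calc _ ≤ ∑ θ ∈ (Finset.univ.filter fun θ : Fin k → Fin 3 => x * r < (inState θ 0).card) ∪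
          (Finset.univ.filter fun θ : Fin k → Fin 3 => x * k < (inState θ 1).card),
          ∏ i, w (θ i) := by
        refine Finset.sum_le_sum_of_subset_of_nonneg ?_ fun θ _ _ => hP θ
        intro θ hθ
        simp only [Finset.mem_union, Finset.mem_filter, Finset.mem_univ, true_and] at hθ ⊢
        by_contra hcon
        push Not at hcon
        exact hθ (hG θ hcon.1 hcon.2)
    _ ≤ (∑ θ : Fin k → Fin 3 with x * r < (inState θ 0).card, ∏ i, w (θ i)) +
          ∑ θ : Fin k → Fin 3 with x * k < (inState θ 1).card, ∏ i, w (θ i) := by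
        rw [← Finset.sum_union_inter]
        exact le_add_of_nonneg_right (Finset.sum_nonneg fun θ _ => hP θ)
    _ ≤ _ := by
        rw [two_mul]
        exact add_le_add (c0.trans d0) (c1.trans d1)

/-- The affinity bound for the two constructions of the alternative: `(f, g)` is `(p, q)` (the
third sample changes from `p` to `q`) or `(q, p)` (the first two samples are exchanged). Here `r`
is the larger sample size and `c`, `K` describe a pointwise `χ²`-bound for one letter. -/
lemma pow_one_sub_le_of_pointwise {k n m r : ℕ} {ε ε₀ δ κ x l X R c K N M a b t w : ℝ}
    (hk : 2 ≤ k) (hr : 1 ≤ r) (hrk : r ≤ k) (hε : 0 < ε) (hε₀ : ε ≤ ε₀) (hε₁ : ε₀ < 1)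
    (hδ : 0 ≤ δ) (hκ : κ * (1 - ε₀) = 16) (hx : x = (1 - ε₀) / 8) (hl : 0 ≤ l)
    (hlx : l * x = X + 1) (hX : 0 ≤ X) (hR : 1 ≤ R) (ha : a = 1 / (R * r)) (hb : b = κ * ε / k)
    (ht : t = Real.exp (-l)) (hw : w = Real.exp (-l) * (r / k)) (hN : 0 < N) (hM : 0 < M)
    {f g : Fin 3 → ℝ}
    (hfg : (f = stP a b ∧ g = stQ a b t) ∨ (f = stQ a b t ∧ g = stP a b)) (hc : 0 ≤ c)
    (hpt : ∀ x, (mixWt (stWt w t) (fun θ => N * stP a b θ) (fun θ => N * stQ a b t θ)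
        (fun θ => M * stP a b θ) x -
      mixWt (stWt w t) (fun θ => N * f θ) (fun θ => N * g θ) (fun θ => M * g θ) x) ^ 2 /
      mixWt (stWt w t) (fun θ => N * f θ) (fun θ => N * g θ) (fun θ => M * g θ) x ≤
      c * (K ^ 2) ^ (x.1 + x.2.1 + x.2.2))
    (hχ1 : c * Real.exp (3 * K ^ 2) ≤ 1) (hT : Testable (allDistributions k) ε δ n m) {s : ℝ}
    (hs : 1 ≤ s) :
    (1 - c * Real.exp (3 * K ^ 2) / 2) ^ k ≤ (s - 1 / s) / 2 *
      (2 * (δ + 2 * Real.exp (-(r * X))) +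
        (2 * (2 ^ n * Real.exp (-N / 2)) + 2 ^ m * Real.exp (-M / 2))) + 1 / s := by
  classical
  have hk0 : (0 : ℝ) < k := by exact_mod_cast (by omega : 0 < k)
  have hr0 : (0 : ℝ) < r := by exact_mod_cast hr
  have hrk' : (r : ℝ) ≤ k := by exact_mod_cast hrk
  have hκ0 : 0 < κ := by
    by_contra h
    have : κ * (1 - ε₀) ≤ 0 := mul_nonpos_of_nonpos_of_nonneg (not_lt.1 h) (by linarith)
    linarith
  have hx0 : 0 ≤ x := by rw [hx]; linarith
  have hx8 : x ≤ 1 / 8 := by rw [hx]; linarith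
  have ha0 : 0 < a := by rw [ha]; positivity
  have hb0 : 0 ≤ b := by rw [hb]; positivity
  have ht0 : 0 < t := by rw [ht]; exact Real.exp_pos _
  have ht1 : t ≤ 1 := by rw [ht]; exact Real.exp_le_one_iff.2 (by linarith)
  have hrk1 : (r : ℝ) / k ≤ 1 := (div_le_one hk0).2 hrk'
  have hw0 : 0 < w := by rw [hw]; positivity
  have hw1 : w ≤ 1 := by
    have : (0 : ℝ) < r / k := by positivity
    rw [hw, ← ht]; nlinarith
  set i₀ : Fin k := ⟨0, by omega⟩
  have hP := stP_nonneg ha0.le hb0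
  have hQ := stQ_nonneg (t := t) ha0.le hb0 ht0.le
  have hf : ∀ θ, 0 ≤ f θ := by rcases hfg with ⟨rfl, -⟩ | ⟨rfl, -⟩ <;> assumption
  have hg : ∀ θ, 0 ≤ g θ := by rcases hfg with ⟨-, rfl⟩ | ⟨-, rfl⟩ <;> assumption
  have hf0 : 0 < f 0 := by rcases hfg with ⟨rfl, -⟩ | ⟨rfl, -⟩ <;> simpa [stP, stQ] using ha0
  have hg0 : 0 < g 0 := by rcases hfg with ⟨-, rfl⟩ | ⟨-, rfl⟩ <;> simpa [stP, stQ] using ha0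
  have hlet : ∀ (v : Fin 3 → ℝ), 0 < v 0 → ∀ i, 0 < letVal i₀ v i 0 := by
    intro v hv i
    unfold letVal
    split_ifs
    · norm_num
    · exact hv
  have hwn := stWt_nonneg hw0.le hw1 ht0.le ht1
  set G : Set (Fin k → Fin 3) :=
    {θ | ((inState θ 0).card : ℝ) ≤ x * r ∧ ((inState θ 1).card : ℝ) ≤ x * k}
  have htv : ∀ θ ∈ G, ε ≤ tvDist
      (normLaw _ (fun i => letVal_nonneg i₀ hP i (θ i))
        (one_pos.trans_le (one_le_sum_letVal i₀ hP θ)) : Measure (Fin k))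
      (normLaw _ (fun i => letVal_nonneg i₀ hQ i (θ i))
        (one_pos.trans_le (one_le_sum_letVal i₀ hQ θ)) : Measure (Fin k)) := by
    rintro θ ⟨h0, h1⟩
    refine le_tvDist_normLaw hk i₀ ha0.le hb0 hε hε₀ hε₁ (by rw [hb]; field_simp) hκ hx θ
      (h0.trans (by gcongr)) ?_ h1 _ _ _ _
    calc _ ≤ x * r * a := by gcongr
      _ = x / R := by rw [ha]; field_simp
      _ ≤ 1 := by rw [div_le_one (by linarith)]; linarith
  have htv' : ∀ θ ∈ G, ε ≤ tvDist
      (normLaw _ (fun i => letVal_nonneg i₀ hf i (θ i))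
        (one_pos.trans_le (one_le_sum_letVal i₀ hf θ)) : Measure (Fin k))
      (normLaw _ (fun i => letVal_nonneg i₀ hg i (θ i))
        (one_pos.trans_le (one_le_sum_letVal i₀ hg θ)) : Measure (Fin k)) := by
    rcases hfg with ⟨rfl, rfl⟩ | ⟨rfl, rfl⟩
    · exact htv
    · intro θ hθ
      rw [tvDist_comm]
      exact htv θ hθ
  have hβ : ∑ θ : Fin k → Fin 3 with θ ∉ G, ∏ i, stWt w t (θ i) ≤ 2 * Real.exp (-(r * X)) := by
    rw [hw, ht]
    exact sum_atypical_le (by omega) hr0 hrk' hl hlx hX G fun θ h0 h1 => ⟨h0, h1⟩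
  refine pow_one_sub_le_of_testable hδ hT hwn (sum_stWt w t) (letVal_nonneg i₀ hP)
    (letVal_nonneg i₀ hQ) (letVal_nonneg i₀ hf) (letVal_nonneg i₀ hg) (one_le_sum_letVal i₀ hP)
    (one_le_sum_letVal i₀ hQ) (one_le_sum_letVal i₀ hf) (one_le_sum_letVal i₀ hg) G hβ htv htv'
    hN hM le_rfl ?_ (mul_nonneg hc (Real.exp_pos _).le) hχ1 ?_ hs
  · intro i x
    exact mixWt_st_pos hw0 hw1 ht0 ht1 (fun θ => mul_nonneg hN.le (letVal_nonneg i₀ hf i θ))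
      (fun θ => mul_nonneg hN.le (letVal_nonneg i₀ hg i θ))
      (fun θ => mul_nonneg hM.le (letVal_nonneg i₀ hg i θ)) (mul_pos hN (hlet f hf0 i))
      (mul_pos hN (hlet g hg0 i)) (mul_pos hM (hlet g hg0 i)) x
  · intro i
    by_cases hi : i = i₀
    · -- The distinguished letter has the same law under both hypotheses.
      simp [letVal, hi]
    · simp only [letVal, hi, if_false]
      exact tsum_fact3_le hc (sq_nonneg K) hpt

lemma two_pow_mul_exp_le {n : ℕ} {X R : ℝ} (hR : R = 2 * (X + 1)) :
    2 ^ n * Real.exp (-(R * n) / 2) ≤ Real.exp (-(n * X)) := by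
  have h2 : (2 : ℝ) ≤ Real.exp 1 := by
    have := Real.add_one_le_exp (1 : ℝ)
    linarith
  calc (2 : ℝ) ^ n * Real.exp (-(R * n) / 2) ≤ Real.exp 1 ^ n * Real.exp (-(R * n) / 2) := by
        gcongr
    _ = _ := by
        rw [← Real.exp_nat_mul, ← Real.exp_add, hR]
        congr 1
        ring

/-- The affinity bound in either of the two regimes `m ≤ n` and `n ≤ m`, where the larger of the
two sample sizes determines the heavy letters. -/
lemma pow_one_sub_le_of_testable_of_le {k n m : ℕ} {ε ε₀ δ κ x l X R K t χ Mt : ℝ}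
    (hk : 2 ≤ k) (hn : 1 ≤ n) (hm : 1 ≤ m) (hnk : n ≤ k) (hmk : m ≤ k) (hε : 0 < ε)
    (hεε₀ : ε ≤ ε₀) (hε₁ : ε₀ < 1) (hδ : 0 ≤ δ) (hκ0 : 0 < κ) (hκ16 : κ * (1 - ε₀) = 16)
    (hx : x = (1 - ε₀) / 8) (hl : 0 ≤ l) (hlx : l * x = X + 1) (hX : 0 ≤ X) (hR1 : 1 ≤ R)
    (ht : t = Real.exp (-l)) (hK : K = 1 + R * κ / t)
    (hχdef : χ = chiConst t * (R ^ 4 * κ ^ 4 / t) * Real.exp (3 * K ^ 2) *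
      (ε ^ 4 * m * n ^ 2 / k ^ 3)) (hχ1 : χ ≤ 1)
    (hfail : ∀ r : ℕ, (r = n ∨ r = m) → 2 * (δ + 2 * Real.exp (-(r * X))) +
        (2 * (2 ^ n * Real.exp (-(R * n) / 2)) + 2 ^ m * Real.exp (-(R * m) / 2)) ≤ Mt)
    (hT : Testable (allDistributions k) ε δ n m) {s : ℝ} (hs : 1 ≤ s) :
    (1 - χ / 2) ^ k ≤ (s - 1 / s) / 2 * Mt + 1 / s := by
  have hk0 : (0 : ℝ) < k := by exact_mod_cast (by omega : 0 < k)
  have hn0 : (0 : ℝ) < n := by exact_mod_cast hn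
  have hm0 : (0 : ℝ) < m := by exact_mod_cast hm
  have hR0 : 0 < R := by linarith
  have ht0 : 0 < t := by rw [ht]; exact Real.exp_pos _
  have ht1 : t ≤ 1 := by rw [ht]; exact Real.exp_le_one_iff.2 (by linarith)
  have hK1 : 1 ≤ K := by
    have : 0 < R * κ / t := by positivity
    rw [hK]; linarith
  have hs0 : 0 ≤ (s - 1 / s) / 2 := by
    have : 1 / s ≤ 1 := (div_le_one (by linarith)).2 hs
    linarith
  set b : ℝ := κ * ε / k with hb
  clear_value b
  have hb0 : 0 ≤ b := by rw [hb]; positivity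
  have hrate : ∀ r : ℕ, r ≤ k → R * r * b / t ≤ K := by
    intro r hrk
    have hrk1 : (r : ℝ) / k ≤ 1 := (div_le_one hk0).2 (by exact_mod_cast hrk)
    have h1 : R * r * b / t = R * κ / t * (r / k * ε) := by rw [hb]; field_simp
    have h2 : (r : ℝ) / k * ε ≤ 1 := by
      have : (0 : ℝ) ≤ r / k := by positivity
      nlinarith
    have h3 : 0 < R * κ / t := by positivity
    rw [h1, hK]
    nlinarith
  have hwt : ∀ r : ℕ, 1 ≤ r → r ≤ k → 0 < t * (r / k : ℝ) ∧ t * (r / k : ℝ) ≤ 1 := by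
    intro r hr hrk
    have hr0 : (0 : ℝ) < r := by exact_mod_cast hr
    have hrk1 : (r : ℝ) / k ≤ 1 := (div_le_one hk0).2 (by exact_mod_cast hrk)
    have : (0 : ℝ) < r / k := by positivity
    exact ⟨by positivity, by nlinarith⟩
  have hcc := chiConst_pos ht0
  rcases le_total m n with hmn | hnm
  · obtain ⟨hw0, hw1⟩ := hwt n hn hnk
    have hmn' : (m : ℝ) ≤ n := by exact_mod_cast hmn
    have hpt := chi_pointwise_XYY (N := R * n) (M := R * m) (a := 1 / (R * n)) (b := b)
      (w := t * (n / k)) (t := t) (K := K) (by field_simp) (by positivity) (by positivity)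
      (by gcongr) hw0 hw1 ht0 ht1 hb0 hK1 (hrate n hnk)
    have hχe : chiConst t * ((R * n * b) ^ 4 * (R * m / (R * n)) / (t * (n / k))) *
        Real.exp (3 * K ^ 2) = χ := by
      rw [hχdef, hb]; field_simp
    have h := pow_one_sub_le_of_pointwise (κ := κ) (x := x) (R := R) hk hn hnk hε hεε₀ hε₁
      hδ hκ16 hx hl hlx hX hR1 rfl hb ht (by rw [ht]) (by positivity) (by positivity)
      (Or.inl ⟨rfl, rfl⟩) (by positivity) hpt (by rw [hχe]; exact hχ1) hT hs
    rw [hχe] at h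
    refine h.trans ?_
    gcongr
    exact hfail n (Or.inl rfl)
  · obtain ⟨hw0, hw1⟩ := hwt m hm hmk
    have hnm' : (n : ℝ) ≤ m := by exact_mod_cast hnm
    have hpt := chi_pointwise_YXX (N := R * n) (M := R * m) (a := 1 / (R * m)) (b := b)
      (w := t * (m / k)) (t := t) (K := K) (by field_simp) (by positivity) (by positivity)
      (by gcongr) hw0 hw1 ht0 ht1 hb0 hK1 (hrate m hmk)
    have hχe : chiConst t * ((R * m * b) ^ 4 * (R * n / (R * m)) ^ 2 / (t * (m / k))) *
        Real.exp (3 * K ^ 2) = χ := by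
      rw [hχdef, hb]; field_simp
    have h := pow_one_sub_le_of_pointwise (κ := κ) (x := x) (R := R) hk hm hmk hε hεε₀ hε₁
      hδ hκ16 hx hl hlx hX hR1 rfl hb ht (by rw [ht]) (by positivity) (by positivity)
      (Or.inr ⟨rfl, rfl⟩) (by positivity) hpt (by rw [hχe]; exact hχ1) hT hs
    rw [hχe] at h
    refine h.trans ?_
    gcongr
    exact hfail m (Or.inr rfl)

/-- The lower bound on sample sizes for likelihood-free hypothesis testing over all
distributions. -/
lemma testable_lower_bound {ε₀ δ₀ : ℝ} (hε₀ : 0 < ε₀) (hε₁ : ε₀ < 1) (hδ₁ : δ₀ < 1 / 2)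
    (hδ₀ : 0 < δ₀) :
    ∃ c : ℝ, 0 < c ∧ ∀ (k n m : ℕ) (ε δ : ℝ), 2 ≤ k → n ≤ k → m ≤ k →
      0 < ε → ε ≤ ε₀ → 0 < δ → δ ≤ δ₀ → Testable (allDistributions k) ε δ n m →
      c * ((k : ℝ) ^ 2 * Real.log (1 / δ) / ε ^ 4) ≤ (n : ℝ) ^ 2 * m := by
  have hε1 : 0 < 1 - ε₀ := by linarith
  -- Each sample size is at least `log (1 / δ) / D`.
  set D : ℝ := -Real.log (1 - ε₀) * (1 + Real.log 2 / -Real.log (2 * δ₀)) with hD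
  clear_value D
  have hD0 : 0 < D := by
    have h1 : Real.log (1 - ε₀) < 0 := Real.log_neg hε1 (by linarith)
    have h2 : Real.log (2 * δ₀) < 0 := Real.log_neg (by linarith) (by linarith)
    have h3 : 0 < Real.log 2 := Real.log_pos (by norm_num)
    have h4 : 0 < Real.log 2 / -Real.log (2 * δ₀) := div_pos h3 (by linarith)
    rw [hD]
    exact mul_pos (by linarith) (by linarith)
  -- `X` is chosen such that all failure probabilities `exp (-n X)` are small multiples of `δ`.
  set T : ℝ := -Real.log ((1 - 2 * δ₀) / 14) with hTdef
  clear_value T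
  have hT0 : 0 < T := by
    rw [hTdef]
    have := Real.log_neg (x := (1 - 2 * δ₀) / 14) (by linarith) (by linarith)
    linarith
  set X : ℝ := T + D with hXdef
  clear_value X
  have hX0 : 0 < X := by rw [hXdef]; positivity
  set x : ℝ := (1 - ε₀) / 8 with hx
  set κ : ℝ := 16 / (1 - ε₀) with hκdef
  set l : ℝ := (X + 1) / x with hldef
  set R : ℝ := 2 * (X + 1) with hRdef
  set t : ℝ := Real.exp (-l) with htdef
  set K : ℝ := 1 + R * κ / t with hKdef
  set C : ℝ := chiConst t * (R ^ 4 * κ ^ 4 / t) * Real.exp (3 * K ^ 2) with hCdef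
  clear_value x κ l R t K C
  have hx0 : 0 < x := by rw [hx]; positivity
  have hκ0 : 0 < κ := by rw [hκdef]; positivity
  have hl0 : 0 < l := by rw [hldef]; positivity
  have hR1 : 1 ≤ R := by rw [hRdef]; linarith
  have hR0 : 0 < R := by linarith
  have ht0 : 0 < t := by rw [htdef]; exact Real.exp_pos _
  have hC0 : 0 < C := by
    have := chiConst_pos ht0
    rw [hCdef]
    positivity
  have hκ16 : κ * (1 - ε₀) = 16 := by rw [hκdef]; field_simp
  have hlx : l * x = X + 1 := by rw [hldef]; field_simp
  set E : ℝ := 1 + Real.log 6 / (3 / 4 * (1 - 2 * δ₀)) ^ 2 with hE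
  clear_value E
  have hlog6 : 0 < Real.log 6 := Real.log_pos (by norm_num)
  have hE0 : 0 < E := by
    have h1 : 0 < 3 / 4 * (1 - 2 * δ₀) := by linarith
    rw [hE]
    positivity
  refine ⟨1 / (C * (2 * E + D)), by positivity, ?_⟩
  intro k n m ε δ hk hnk hmk hε hεε₀ hδ hδδ₀ hT
  have hk0 : (0 : ℝ) < k := by exact_mod_cast (by omega : 0 < k)
  obtain ⟨hn1, hm1⟩ := one_sub_pow_le_of_testable hk hε₀ hεε₀ hε₁ hT
  have hLn := log_inv_le_mul_of_pow_le hε₁ hδ hδδ₀ hδ₁ hn1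
  have hLm := log_inv_le_mul_of_pow_le hε₁ hδ hδδ₀ hδ₁ hm1
  rw [← hD] at hLn hLm
  set L := Real.log (1 / δ) with hL
  clear_value L
  have hL0 : 0 < L := by
    rw [hL]
    exact Real.log_pos (by rw [lt_div_iff₀ hδ]; linarith)
  have hpos : ∀ j : ℕ, L ≤ j * D → 1 ≤ j := by
    intro j hj
    rcases Nat.eq_zero_or_pos j with rfl | h
    · simp at hj; linarith
    · exact h
  have hn := hpos n hLn
  have hm := hpos m hLm
  have hn0 : (0 : ℝ) < n := by exact_mod_cast hn
  have hm0 : (0 : ℝ) < m := by exact_mod_cast hm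
  -- It suffices to bound `L` by `k` times the one-letter `χ²`-divergence.
  set χ : ℝ := C * (ε ^ 4 * m * n ^ 2 / k ^ 3) with hχdef
  clear_value χ
  have hχ0 : 0 < χ := by rw [hχdef]; positivity
  suffices hmain : L ≤ (2 * E + D) * (k * χ) by
    rw [one_div, inv_mul_le_iff₀ (by positivity), div_le_iff₀ (by positivity)]
    calc (k : ℝ) ^ 2 * L ≤ k ^ 2 * ((2 * E + D) * (k * χ)) := by gcongr
      _ = _ := by rw [hχdef]; field_simp
  rcases lt_or_ge 1 χ with hχ1 | hχ1
  · have h1 : (n : ℝ) ≤ k := by exact_mod_cast hnk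
    have h2 : (k : ℝ) ≤ k * χ := le_mul_of_one_le_right hk0.le hχ1.le
    have h3 : 0 ≤ 2 * E * (k * χ) := by positivity
    have h4 := mul_le_mul_of_nonneg_right (h1.trans h2) hD0.le
    linarith
  -- The failure probabilities.
  have hexp : ∀ j : ℕ, 1 ≤ j → L ≤ j * D →
      Real.exp (-(j * X)) ≤ (1 - 2 * δ₀) / 14 * δ := by
    intro j hj hjL
    have hj1 : (1 : ℝ) ≤ j := by exact_mod_cast hj
    have h1 : -(j * X) ≤ -T + -L := by
      have := le_mul_of_one_le_left hT0.le hj1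
      rw [hXdef, mul_add]
      linarith
    refine (Real.exp_le_exp.2 h1).trans_eq ?_
    rw [Real.exp_add, hTdef, neg_neg, Real.exp_log (by linarith), hL, one_div, Real.log_inv,
      neg_neg, Real.exp_log hδ]
  have hfail : ∀ r : ℕ, (r = n ∨ r = m) → ∀ N M : ℝ, N = R * n → M = R * m →
      2 * (δ + 2 * Real.exp (-(r * X))) +
        (2 * (2 ^ n * Real.exp (-N / 2)) + 2 ^ m * Real.exp (-M / 2)) ≤
      2 * δ + (1 - 2 * δ₀) / 2 * δ := by
    rintro r hr N M rfl rfl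
    have h1 := two_pow_mul_exp_le (n := n) hRdef
    have h2 := two_pow_mul_exp_le (n := m) hRdef
    have h3 := hexp n hn hLn
    have h4 := hexp m hm hLm
    have h5 : Real.exp (-(r * X)) ≤ (1 - 2 * δ₀) / 14 * δ := by rcases hr with rfl | rfl <;> assumption
    linarith
  set Mt : ℝ := 2 * δ + (1 - 2 * δ₀) / 2 * δ with hMt
  clear_value Mt
  have hMt0 : 0 < Mt := by
    have : 0 < (1 - 2 * δ₀) / 2 * δ := mul_pos (by linarith) hδ
    rw [hMt]; linarith
  have hMt3 : Mt ≤ 3 * δ := by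
    have := mul_le_mul_of_nonneg_right (by linarith : (1 - 2 * δ₀) / 2 ≤ 1) hδ.le
    linarith
  have hMt1 : Mt ≤ 1 - 3 / 4 * (1 - 2 * δ₀) := by
    have := mul_le_mul_of_nonneg_left (by linarith : δ ≤ 1 / 2)
      (by linarith : 0 ≤ (1 - 2 * δ₀) / 2)
    linarith
  have haff : ∀ s : ℝ, 1 ≤ s → (1 - χ / 2) ^ k ≤ (s - 1 / s) / 2 * Mt + 1 / s := fun s hs =>
    pow_one_sub_le_of_testable_of_le hk hn hm hnk hmk hε hεε₀ hε₁ hδ.le hκ0 hκ16 hx hl0.le hlx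
      hX0.le hR1 htdef hKdef (by rw [hχdef, hCdef]) hχ1
      (fun r hr => hfail r hr _ _ rfl rfl) hT hs
  have h1 := neg_log_le_of_forall_pow_le hMt0 (by linarith) hχ0.le hχ1 haff
  have h2 := log_inv_le_mul_neg_log hδ hMt0 hMt3 (by linarith : 0 < 3 / 4 * (1 - 2 * δ₀)) hMt1
  rw [← hE] at h2
  have h3 := mul_le_mul_of_nonneg_right h1 hE0.le
  have h4 : 0 ≤ D * (k * χ) := by positivity
  linarith

end LFHT

end

theorem mainTheorem7 :
    -- the random vector `(p, q)` has the moments required of a pseudo-distribution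
    (∀ (r k : ℕ) (ε : ℝ), 1 ≤ r → 2 * r ≤ k → 0 < ε → ε ≤ 1 →
      IsProbabilityMeasure (LFHT.pseudoLaw r k ε) ∧
      (∀ᵐ v ∂(LFHT.pseudoLaw r k ε), v ∈ Set.Icc (0 : ℝ) 1 ×ˢ Set.Icc (0 : ℝ) 1) ∧
      ∫ v, v.1 ∂(LFHT.pseudoLaw r k ε) = ∫ v, v.2 ∂(LFHT.pseudoLaw r k ε) ∧
      ∫ v, v.1 ∂(LFHT.pseudoLaw r k ε) ∈ Set.Icc (1 / (k : ℝ)) (2 / k) ∧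
      ∫ v, |v.1 - v.2| ∂(LFHT.pseudoLaw r k ε) ∈ Set.Icc (ε / (2 * k)) (ε / k)) ∧
    -- the `χ²`-bound in the case `m ≤ n ≤ k`
    (∃ C : ℝ, 0 < C ∧ ∀ (k n m : ℕ) (ε : ℝ), 1 ≤ n → m ≤ n → n ≤ k → 0 < ε → ε ≤ 1 →
      LFHT.chiSqDiv (LFHT.mixXYX (LFHT.pseudoLaw n k ε) n m)
          (LFHT.mixXYY (LFHT.pseudoLaw n k ε) n m) ≤
        ENNReal.ofReal (C * (ε ^ 4 * m * n ^ 2 / k ^ 3))) ∧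
    -- the `χ²`-bound in the case `n ≤ m ≤ k`
    (∃ C : ℝ, 0 < C ∧ ∀ (k n m : ℕ) (ε : ℝ), 1 ≤ m → n ≤ m → m ≤ k → 0 < ε → ε ≤ 1 →
      LFHT.chiSqDiv (LFHT.mixXYX (LFHT.pseudoLaw m k ε) n m)
          (LFHT.mixYXX (LFHT.pseudoLaw m k ε) n m) ≤
        ENNReal.ofReal (C * (ε ^ 4 * m * n ^ 2 / k ^ 3))) ∧
    -- the lower bound for likelihood-free hypothesis testing
    (∀ ε₀ δ₀ : ℝ, 0 < ε₀ → ε₀ < 1 → 0 < δ₀ → δ₀ < 1 / 2 →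
      ∃ c : ℝ, 0 < c ∧ ∀ (k n m : ℕ) (ε δ : ℝ), 2 ≤ k → n ≤ k → m ≤ k →
        0 < ε → ε ≤ ε₀ → 0 < δ → δ ≤ δ₀ →
        LFHT.Testable (LFHT.allDistributions k) ε δ n m →
        c * ((k : ℝ) ^ 2 * Real.log (1 / δ) / ε ^ 4) ≤ (n : ℝ) ^ 2 * m) := by
  refine ⟨LFHT.pseudoLaw_moments, LFHT.exists_chiSqDiv_XYY_le, LFHT.exists_chiSqDiv_YXX_le, ?_⟩
  intro ε₀ δ₀ hε₀ hε₁ hδ₀ hδ₁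
  exact LFHT.testable_lower_bound hε₀ hε₁ hδ₁ hδ₀
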